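/- Let $\mathbb{A}$ be $\mathbb{C}$, $\mathbb{H}$ (with $n\ge 1$) or the octonions $\mathbb{O}$ (with $n=1$), where $\mathbb{O}=\mathbb{H}\oplus\mathbb{H}$ with $(a,b)(c,d)=(ac-d\bar b,\ \bar a d+cb)$. Give $\mathbb{A}^n$ its standard Euclidean inner product and let $\mathbb{A}$ act by right multiplication; $\operatorname{Im}\mathbb{A}$ is the orthogonal complement of $\mathbb{R}\cdot 1$. Let $G_{\mathbb{A}}(n)$ be the group (with the operator norm topology) of real linear isometries $\phi$ of $\mathbb{A}^n$ for which there is $\theta\in SO(\mathbb{A})$ with $\phi(vx)=\phi(v)\theta(x)$ for all $v\in\mathbb{A}^n$, $x\in\mathbb{A}$. A real linear subspace $C\subset\mathbb{A}^n$ with $\dim_{\mathbb R} C=\frac12\dim_{\mathbb R}\mathbb{A}^n$ is called $\frac12\mathbb{A}$-Lagrangian if there is a real subspace $L\subset\operatorname{Im}\mathbb{A}$ with $\dim L=\frac12\dim\mathbb{A}$ such that $Cu\perp C$ for every unit vector $u\in L$. Let $\mathcal{L}_{\mathbb{A}}(n)$ be the set of these subspaces, topologized as a subset of the Grassmannian (through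 orthogonal projections), and let $C_0=\mathbb{R}^n\subset\mathbb{C}^n$, $C_0=\mathbb{C}^n\subset\mathbb{H}^n$, $C_0=\mathbb{H}\oplus 0\subset\mathbb{O}$ respectively. **Proposition.** $\mathcal{L}_{\mathbb{A}}(n)$ is a homogeneous space of $G_{\mathbb{A}}(n)$: the group maps $\mathcal{L}_{\mathbb{A}}(n)$ to itself and acts transitively on it, and $gK\mapsto gC_0$ is a homeomorphism $G_{\mathbb{A}}(n)/K\cong\mathcal{L}_{\mathbb{A}}(n)$ for the following subgroup $K$ (which is therefore the stabilizer of $C_0$). 1. $\mathbb{A}=\mathbb{C}$, $n\ge1$. $G_{\mathbb{C}}(n)=U(n)$ as topological groups, acting by matrix multiplication, and $K=O(n)$, so $\mathcal{L}_{\mathbb{C}}(n)\cong U(n)/O(n)$. The subgroup $SO(n)$ has index two in $O(n)$, and $U(n)/SO(n)$ is the space of oriented Lagrangian subspaces: for each orientation $o$ of $\mathbb{R}^n$, $g\,SO(n)\mapsto g(\mathbb{R}^n,o)$ is a homeomorphism from $U(n)/SO(n)$ onto the space of pairs (Lagrangian subspace, orientation of it), whose topology is given by orthogonal projections and volume forms.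 2. $\mathbb{A}=\mathbb{H}$, $n\ge1$. $G_{\mathbb{H}}(n)=Sp(n)Sp(1)$, that is, $(\alpha,\beta)\mapsto(v\mapsto\alpha v\bar\beta)$ is a continuous surjective homomorphism $Sp(n)\times Sp(1)\to G_{\mathbb{H}}(n)$ with kernel $\{\pm(1,1)\}$. Let $U(n)U(1)$ be the image of $U(n)\times U(1)$ (entries in $\mathbb{C}=\mathbb{R}+\mathbb{R}i$). Then $K$ is the subgroup generated by $U(n)U(1)$ and the image of $(j\cdot 1,j)$, in which $U(n)U(1)$ has index two. The quotient $Sp(n)Sp(1)/U(n)U(1)$ is the space of pairs $(C,v)$ with $C\in\mathcal{L}_{\mathbb{H}}(n)$ and $v\in\operatorname{Im}\mathbb{H}$, $|v|=1$, $Cv\subset C$: the map $g\mapsto(g\,\mathbb{C}^n,w)$, where $w$ is given by $g(xi)=g(x)w$ for all $x\in\mathbb{H}^n$, induces a homeomorphism onto it. 3. $\mathbb{A}=\mathbb{O}$, $n=1$. $G_{\mathbb{O}}(1)=Spin(7)$: the spin representation on $\mathbb{O}$, that is, the action of the Clifford algebra of $(\operatorname{Im}\mathbb{O},-|u|^2)$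 in which $u$ acts as $y\mapsto yu$, restricts to a group isomorphism $Spin(7)\cong G_{\mathbb{O}}(1)$. The subgroup $K$ is the image of $Sp(1)^3$ under the continuous homomorphism $(p,q,r)\mapsto\big((a,b)\mapsto(pa\bar q,\ qb\bar r)\big)$ into $G_{\mathbb{O}}(1)$, whose kernel is $\{\pm(1,1,1)\}$. Thus $\mathcal{L}_{\mathbb{O}}(1)\cong Spin(7)/Sp(1)^3$, with $Sp(1)^3$ read as this image. -/

import Mathlib

open scoped Quaternion

/-! ### The octonions, by the Cayley-Dickson process from the quaternions -/

/-- The underlying Euclidean space `ℍ ⊕ ℍ` of the octonions. -/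
abbrev Octonion : Type := WithLp 2 (ℍ[ℝ] × ℍ[ℝ])

/-- `(a, b)(c, d) = (ac - d b*, a* d + c b)`. -/
noncomputable instance : Mul Octonion where
  mul x y := WithLp.toLp 2
    (x.fst * y.fst - y.snd * star x.snd, star x.fst * y.snd + y.fst * x.snd)

noncomputable instance : One Octonion where
  one := WithLp.toLp 2 (1, 0)

theorem Octonion.mul_fst (x y : Octonion) :
    (x * y).fst = x.fst * y.fst - y.snd * star x.snd := rfl

theorem Octonion.mul_snd (x y : Octonion) :
    (x * y).snd = star x.fst * y.snd + y.fst * x.snd := rfl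

theorem Octonion.one_fst : (1 : Octonion).fst = 1 := rfl

theorem Octonion.one_snd : (1 : Octonion).snd = 0 := rfl

/-! ### Normed linear spaces over a normed algebra, twisted isomorphisms, Lagrangian subspaces -/

section General

variable (A : Type) [NormedAddCommGroup A] [InnerProductSpace ℝ A] [Mul A] [One A] (n : ℕ)

/-- `𝔸ⁿ` with its standard inner product. -/
abbrev LinSpace : Type := PiLp 2 (fun _ : Fin n => A)

variable {A n} in
/-- Right multiplication of a vector `v` of `𝔸ⁿ` by `x ∈ 𝔸`; for a unit imaginary `u` the complex
structure `J_u` is `v ↦ rightMul v u`. -/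
noncomputable def rightMul (v : LinSpace A n) (x : A) : LinSpace A n := WithLp.toLp 2 (fun i => v i * x)

/-- `Im 𝔸`, the orthogonal complement of `ℝ ⋅ 1`. -/
noncomputable def imPart : Submodule ℝ A := (Submodule.span ℝ {(1 : A)})ᗮ

/-- The group `G_𝔸(n)` of twisted isomorphisms of `𝔸ⁿ`: the real linear isometries `φ` for which
there is `θ ∈ SO(𝔸)` with `φ(v x) = φ(v) θ(x)`. -/
noncomputable def twistedGroup : Subgroup (LinSpace A n ≃ₗᵢ[ℝ] LinSpace A n) where
  carrier := {φ | ∃ θ : A ≃ₗᵢ[ℝ] A, LinearMap.det (θ.toLinearEquiv : A →ₗ[ℝ] A) = 1 ∧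
    ∀ (v : LinSpace A n) (x : A), φ (rightMul v x) = rightMul (φ v) (θ x)}
  mul_mem' := by
    rintro φ ψ ⟨θ, hθ, h⟩ ⟨η, hη, k⟩
    refine ⟨θ * η, ?_, fun v x => ?_⟩
    · have : (((θ * η : A ≃ₗᵢ[ℝ] A).toLinearEquiv : A →ₗ[ℝ] A))
          = (θ.toLinearEquiv : A →ₗ[ℝ] A) * (η.toLinearEquiv : A →ₗ[ℝ] A) := rfl
      rw [this, map_mul, hθ, hη, one_mul]
    · change φ (ψ _) = rightMul (φ (ψ v)) (θ (η x))
      rw [k, h]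
  one_mem' := by
    refine ⟨1, ?_, fun v x => rfl⟩
    have : (((1 : A ≃ₗᵢ[ℝ] A).toLinearEquiv : A →ₗ[ℝ] A)) = 1 := rfl
    rw [this, map_one]
  inv_mem' := by
    rintro φ ⟨θ, hθ, h⟩
    refine ⟨θ⁻¹, ?_, fun v x => ?_⟩
    · have : (((θ⁻¹ : A ≃ₗᵢ[ℝ] A).toLinearEquiv : A →ₗ[ℝ] A))
          * (θ.toLinearEquiv : A →ₗ[ℝ] A) = 1 := by
        ext x
        exact θ.symm_apply_apply x
      have h2 := congrArg LinearMap.det this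
      rwa [map_mul, hθ, map_one, mul_one] at h2
    · change φ.symm _ = rightMul (φ.symm v) (θ.symm x)
      rw [LinearIsometryEquiv.symm_apply_eq, h]
      simp

/-- `G_𝔸(n)` carries the topology of a matrix group: the operator norm topology. -/
noncomputable instance : TopologicalSpace (twistedGroup A n) :=
  TopologicalSpace.induced
    (fun g => ((g : LinSpace A n ≃ₗᵢ[ℝ] LinSpace A n).toContinuousLinearEquiv :
      LinSpace A n →L[ℝ] LinSpace A n)) inferInstance

variable {A n}

/-- The image `g C` of a real linear subspace `C` of `𝔸ⁿ` under `g ∈ G_𝔸(n)`. -/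
noncomputable def imageUnder (g : twistedGroup A n) (C : Submodule ℝ (LinSpace A n)) :
    Submodule ℝ (LinSpace A n) :=
  C.map ((g : LinSpace A n ≃ₗᵢ[ℝ] LinSpace A n).toLinearEquiv : LinSpace A n →ₗ[ℝ] LinSpace A n)

/-- `½𝔸`-Lagrangian subspaces: real subspaces `C` of `𝔸ⁿ` of half the dimension such that
`J_u C ⟂ C` for all unit vectors `u` of some real subspace `L` of `Im 𝔸` with
`dim L = ½ dim 𝔸`. -/
def IsHalfLagrangian (C : Submodule ℝ (LinSpace A n)) : Prop :=
  2 * Module.finrank ℝ C = Module.finrank ℝ (LinSpace A n) ∧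
  ∃ L : Submodule ℝ A, L ≤ imPart A ∧ 2 * Module.finrank ℝ L = Module.finrank ℝ A ∧
    ∀ u ∈ L, ‖u‖ = 1 → ∀ c ∈ C, ∀ c' ∈ C, inner ℝ (rightMul c u) c' = 0

variable (A n)

/-- The space of `½𝔸`-Lagrangian subspaces of `𝔸ⁿ`. -/
def HalfLagrangian : Type := {C : Submodule ℝ (LinSpace A n) // IsHalfLagrangian C}

/-- The topology of the Grassmannian: subspaces are close when the orthogonal projections onto
them are. -/
noncomputable instance [FiniteDimensional ℝ A] : TopologicalSpace (HalfLagrangian A n) :=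
  TopologicalSpace.induced (fun C => C.1.starProjection) inferInstance

variable {A n}

/-- `G_𝔸(n)` maps `½𝔸`-Lagrangian subspaces to `½𝔸`-Lagrangian subspaces, acts transitively on
them, and `g K ↦ g C₀` is a well-defined homeomorphism from `G_𝔸(n)/K` onto the space of
`½𝔸`-Lagrangian subspaces. -/
def IsHomogeneousSpace [FiniteDimensional ℝ A] (K : Subgroup (twistedGroup A n))
    (C₀ : Submodule ℝ (LinSpace A n)) : Prop :=
  (∀ (g : twistedGroup A n) (C : Submodule ℝ (LinSpace A n)),
    IsHalfLagrangian C → IsHalfLagrangian (imageUnder g C)) ∧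
  (∀ C C' : Submodule ℝ (LinSpace A n), IsHalfLagrangian C → IsHalfLagrangian C' →
    ∃ g : twistedGroup A n, imageUnder g C = C') ∧
  ∃ h : (twistedGroup A n ⧸ K) ≃ₜ HalfLagrangian A n,
    ∀ g : twistedGroup A n, (h (g : twistedGroup A n ⧸ K)).1 = imageUnder g C₀

end General

/-! ### The complex case -/

/-- `ℝⁿ ⊂ ℂⁿ`. -/
def realSubspace (n : ℕ) : Submodule ℝ (LinSpace ℂ n) where
  carrier := {v | ∀ i, (v i).im = 0}
  add_mem' := by intro a b ha hb i; simp [ha i, hb i]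
  zero_mem' := by intro i; simp
  smul_mem' := by intro c v hv i; simp [hv i]

/-- `O(n) ⊂ U(n)`: the unitary matrices with real entries. -/
def orthogonalInUnitary (n : ℕ) : Subgroup (Matrix.unitaryGroup (Fin n) ℂ) where
  carrier := {M | ∀ i j, ((M : Matrix (Fin n) (Fin n) ℂ) i j).im = 0}
  mul_mem' := by
    intro a b ha hb i j
    simp only [Submonoid.coe_mul, Matrix.mul_apply, Complex.im_sum]
    refine Finset.sum_eq_zero fun k _ => ?_
    simp [Complex.mul_im, ha i k, hb k j]
  one_mem' := by
    intro i j
    simp only [OneMemClass.coe_one, Matrix.one_apply]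
    split_ifs <;> simp
  inv_mem' := by
    intro a ha i j
    change ((star (a : Matrix (Fin n) (Fin n) ℂ)) i j).im = 0
    simp [Matrix.star_apply, ha j i]

/-- `SO(n) ⊂ U(n)`: the unitary matrices with real entries and determinant one. -/
def specialOrthogonalInUnitary (n : ℕ) : Subgroup (Matrix.unitaryGroup (Fin n) ℂ) where
  carrier := {M | M ∈ orthogonalInUnitary n ∧ (M : Matrix (Fin n) (Fin n) ℂ).det = 1}
  mul_mem' := by
    rintro a b ⟨ha, ha'⟩ ⟨hb, hb'⟩
    exact ⟨mul_mem ha hb, by simp [ha', hb']⟩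
  one_mem' := ⟨one_mem _, by simp⟩
  inv_mem' := by
    rintro a ⟨ha, ha'⟩
    refine ⟨inv_mem ha, ?_⟩
    change (star (a : Matrix (Fin n) (Fin n) ℂ)).det = 1
    rw [Matrix.star_eq_conjTranspose, Matrix.det_conjTranspose, ha', star_one]

/-- Lagrangian subspaces of `ℂⁿ` with an orientation. -/
structure OrientedLagrangian (n : ℕ) where
  /-- the Lagrangian subspace -/
  C : Submodule ℝ (LinSpace ℂ n)
  lagrangian : IsHalfLagrangian C
  /-- the orientation -/
  o : Orientation ℝ C (Fin n)

theorem OrientedLagrangian.finrank_eq {n : ℕ} (X : OrientedLagrangian n) :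
    Module.finrank ℝ X.C = n := by
  have h := X.lagrangian.1
  have h2 : Module.finrank ℝ (LinSpace ℂ n) = n * 2 := by
    rw [(WithLp.linearEquiv 2 ℝ (Fin n → ℂ)).finrank_eq]
    simp [Module.finrank_pi_fintype]
  omega

/-- The volume form of an oriented Lagrangian subspace, extended to `ℂⁿ` by orthogonal
projection. -/
noncomputable def OrientedLagrangian.form {n : ℕ} (X : OrientedLagrangian n) :
    (Fin n → LinSpace ℂ n) → ℝ :=
  haveI : Fact (Module.finrank ℝ X.C = n) := ⟨X.finrank_eq⟩
  fun w => X.o.volumeForm fun i => X.C.orthogonalProjectionOnto (w i)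

/-- Oriented subspaces are close when the orthogonal projections onto them and their volume forms
are (the topology of the oriented Grassmannian). -/
noncomputable instance (n : ℕ) : TopologicalSpace (OrientedLagrangian n) :=
  TopologicalSpace.induced (fun X => (X.C.starProjection, X.form)) inferInstance

/-! ### The quaternionic case -/

/-- `Sp(n)`, the group of quaternionic matrices `M` with `M* M = M M* = 1`. -/
abbrev SpGroup (n : ℕ) : Type := unitary (Matrix (Fin n) (Fin n) ℍ[ℝ])

/-- `Sp(1)`, the group of unit quaternions. -/
abbrev UnitQuaternions : Type := unitary ℍ[ℝ]

/-- `ℂⁿ ⊂ ℍⁿ`, where `ℂ = ℝ + ℝ i ⊂ ℍ`. -/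
def complexSubspace (n : ℕ) : Submodule ℝ (LinSpace ℍ[ℝ] n) where
  carrier := {v | ∀ k, (v k).imJ = 0 ∧ (v k).imK = 0}
  add_mem' := by
    intro a b ha hb k
    simp [(ha k).1, (ha k).2, (hb k).1, (hb k).2]
  zero_mem' := by intro k; simp
  smul_mem' := by
    intro c v hv k
    simp [(hv k).1, (hv k).2]

/-- `U(n) × U(1) ⊂ Sp(n) × Sp(1)`: the pairs whose entries lie in `ℂ = ℝ + ℝ i ⊂ ℍ`. -/
def unitaryPairs (n : ℕ) : Subgroup (SpGroup n × UnitQuaternions) where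
  carrier := {p | (∀ k l, (p.1 : Matrix (Fin n) (Fin n) ℍ[ℝ]) k l ∈ Quaternion.ofComplex.range) ∧
    (p.2 : ℍ[ℝ]) ∈ Quaternion.ofComplex.range}
  mul_mem' := by
    rintro a b ⟨ha, ha'⟩ ⟨hb, hb'⟩
    refine ⟨fun k l => ?_, mul_mem ha' hb'⟩
    change ((a.1 : Matrix (Fin n) (Fin n) ℍ[ℝ]) * (b.1 : Matrix (Fin n) (Fin n) ℍ[ℝ])) k l ∈ _
    rw [Matrix.mul_apply]
    exact sum_mem fun m _ => mul_mem (ha k m) (hb m l)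
  one_mem' := by
    refine ⟨fun k l => ?_, one_mem _⟩
    change (1 : Matrix (Fin n) (Fin n) ℍ[ℝ]) k l ∈ _
    rw [Matrix.one_apply]
    split_ifs
    · exact one_mem _
    · exact zero_mem _
  inv_mem' := by
    have key : ∀ x : ℍ[ℝ], x ∈ Quaternion.ofComplex.range →
        star x ∈ Quaternion.ofComplex.range := by
      rintro _ ⟨z, rfl⟩
      refine ⟨star z, ?_⟩
      change ((star z : ℂ) : ℍ[ℝ]) = star ((z : ℂ) : ℍ[ℝ])
      ext <;> simp
    rintro a ⟨ha, ha'⟩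
    exact ⟨fun k l => key _ (ha l k), key _ ha'⟩

/-- The quaternion `j`. -/
def quatJ : ℍ[ℝ] := ⟨0, 0, 1, 0⟩

theorem quatJ_mem : quatJ ∈ unitary ℍ[ℝ] := by
  have h0 : quatJ.re = 0 := rfl
  have h1 : quatJ.imI = 0 := rfl
  have h2 : quatJ.imJ = 1 := rfl
  have h3 : quatJ.imK = 0 := rfl
  rw [Unitary.mem_iff]
  constructor <;> ext <;> simp [h0, h1, h2, h3]

/-- `j` as an element of `Sp(1)`. -/
def quaternionJ : UnitQuaternions := ⟨quatJ, quatJ_mem⟩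

/-- The scalar matrix `j ⋅ 1` in `Sp(n)`. -/
noncomputable def scalarJ (n : ℕ) : SpGroup n :=
  ⟨Matrix.diagonal fun _ => (quaternionJ : ℍ[ℝ]), by
    rw [Unitary.mem_iff, Matrix.star_eq_conjTranspose, Matrix.diagonal_conjTranspose,
      Matrix.diagonal_mul_diagonal, Matrix.diagonal_mul_diagonal]
    constructor
    · rw [← Matrix.diagonal_one]
      congr 1
      funext i
      exact Unitary.coe_star_mul_self quaternionJ
    · rw [← Matrix.diagonal_one]
      congr 1
      funext i
      exact Unitary.coe_mul_star_self quaternionJ⟩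

/-- The subgroup of `Sp(n) × Sp(1)` generated by `U(n) × U(1)` and `(j, j)`. -/
noncomputable def extendedUnitaryPairs (n : ℕ) : Subgroup (SpGroup n × UnitQuaternions) :=
  unitaryPairs n ⊔ Subgroup.zpowers (scalarJ n, quaternionJ)

/-- Pairs `(C, v)` of a `ℂ`-Lagrangian subspace `C` of `ℍⁿ` and a unit imaginary quaternion `v` for
which `C` is a `J_v`-complex subspace. -/
def PolarizedLagrangian (n : ℕ) : Type :=
  {p : Submodule ℝ (LinSpace ℍ[ℝ] n) × ℍ[ℝ] // IsHalfLagrangian p.1 ∧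
    p.2 ∈ imPart ℍ[ℝ] ∧ ‖p.2‖ = 1 ∧ ∀ c ∈ p.1, rightMul c p.2 ∈ p.1}

noncomputable instance (n : ℕ) : TopologicalSpace (PolarizedLagrangian n) :=
  TopologicalSpace.induced (fun p => (p.1.1.starProjection, p.1.2)) inferInstance

/-! ### The octonionic case -/

/-- `ℍ ⊕ 0 ⊂ ℍ ⊕ ℍ = 𝕆`, as a subspace of `𝕆¹`. -/
def quaternionSubspace : Submodule ℝ (LinSpace Octonion 1) where
  carrier := {v | ∀ k, (v k).snd = 0}
  add_mem' := by intro a b ha hb k; simp [ha k, hb k]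
  zero_mem' := by intro k; simp
  smul_mem' := by intro c v hv k; simp [hv k]

/-- The quadratic form `u ↦ -|u|²` on `Im 𝕆 ≅ ℝ⁷`. -/
noncomputable def imForm : QuadraticForm ℝ (imPart Octonion) :=
  -(LinearMap.BilinMap.toQuadraticMap (innerₗ (imPart Octonion)))

theorem imForm_apply (u : imPart Octonion) : imForm u = -‖(u : Octonion)‖ ^ 2 := by
  simp [imForm]

theorem re_fst_of_mem_imPart {u : Octonion} (hu : u ∈ imPart Octonion) : u.fst.re = 0 := by
  rw [imPart, Submodule.mem_orthogonal_singleton_iff_inner_right] at hu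
  simpa [WithLp.prod_inner_apply, Octonion.one_fst, Octonion.one_snd, Quaternion.inner_def]
    using hu

/-- Right multiplication `R_u : y ↦ y u` of octonions by an imaginary octonion. -/
noncomputable def rightMulHom : imPart Octonion →ₗ[ℝ] Module.End ℝ Octonion :=
  LinearMap.mk₂ ℝ (fun (u : imPart Octonion) (y : Octonion) => y * (u : Octonion))
    (fun u v y => by
      apply WithLp.ofLp_injective
      ext1
      · change (y * ((u : Octonion) + v)).fst = (y * (u : Octonion) + y * v).fst
        simp only [Octonion.mul_fst, WithLp.add_fst, WithLp.add_snd]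
        noncomm_ring
      · change (y * ((u : Octonion) + v)).snd = (y * (u : Octonion) + y * v).snd
        simp only [Octonion.mul_snd, WithLp.add_fst, WithLp.add_snd]
        noncomm_ring)
    (fun c u y => by
      apply WithLp.ofLp_injective
      ext1
      · change (y * (c • (u : Octonion))).fst = (c • (y * (u : Octonion))).fst
        simp only [Octonion.mul_fst, WithLp.smul_fst, WithLp.smul_snd]
        simp [smul_sub]
      · change (y * (c • (u : Octonion))).snd = (c • (y * (u : Octonion))).snd
        simp only [Octonion.mul_snd, WithLp.smul_fst, WithLp.smul_snd]
        simp [smul_add])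
    (fun u y z => by
      apply WithLp.ofLp_injective
      ext1
      · change ((y + z) * (u : Octonion)).fst = (y * (u : Octonion) + z * u).fst
        simp only [Octonion.mul_fst, WithLp.add_fst, WithLp.add_snd, star_add]
        noncomm_ring
      · change ((y + z) * (u : Octonion)).snd = (y * (u : Octonion) + z * u).snd
        simp only [Octonion.mul_snd, WithLp.add_fst, WithLp.add_snd, star_add]
        noncomm_ring)
    (fun c u y => by
      apply WithLp.ofLp_injective
      ext1
      · change ((c • y) * (u : Octonion)).fst = (c • (y * (u : Octonion))).fst
        simp only [Octonion.mul_fst, WithLp.smul_fst, WithLp.smul_snd]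
        simp [smul_sub]
      · change ((c • y) * (u : Octonion)).snd = (c • (y * (u : Octonion))).snd
        simp only [Octonion.mul_snd, WithLp.smul_fst, WithLp.smul_snd]
        simp [smul_add])

theorem rightMulHom_apply (u : imPart Octonion) (y : Octonion) :
    rightMulHom u y = y * (u : Octonion) := rfl

theorem rightMulHom_sq (u : imPart Octonion) :
    rightMulHom u * rightMulHom u = algebraMap ℝ (Module.End ℝ Octonion) (imForm u) := by
  have hre := re_fst_of_mem_imPart u.2
  have hn : ‖(u : Octonion)‖ ^ 2 = (u : Octonion).fst.re ^ 2 + (u : Octonion).fst.imI ^ 2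
      + (u : Octonion).fst.imJ ^ 2 + (u : Octonion).fst.imK ^ 2
      + ((u : Octonion).snd.re ^ 2 + (u : Octonion).snd.imI ^ 2
      + (u : Octonion).snd.imJ ^ 2 + (u : Octonion).snd.imK ^ 2) := by
    rw [WithLp.prod_norm_sq_eq_of_L2, sq, sq, ← Quaternion.normSq_eq_norm_mul_self,
      ← Quaternion.normSq_eq_norm_mul_self, Quaternion.normSq_def', Quaternion.normSq_def']
  refine LinearMap.ext fun y => WithLp.ofLp_injective 2 ?_
  change ((y * (u : Octonion)) * (u : Octonion)).ofLp = ((imForm u) • y).ofLp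
  rw [imForm_apply, hn]
  ext1
  · change ((y * (u : Octonion)) * (u : Octonion)).fst = _ • y.fst
    simp only [Octonion.mul_fst, Octonion.mul_snd]
    ext <;> simp [hre] <;> ring
  · change ((y * (u : Octonion)) * (u : Octonion)).snd = _ • y.snd
    simp only [Octonion.mul_fst, Octonion.mul_snd]
    ext <;> simp [hre] <;> ring

/-- The group `Spin(7)` of `Im 𝕆 ≅ ℝ⁷`, inside the Clifford algebra. -/
abbrev SpinSeven : Type := spinGroup imForm

/-- The spin representation on `𝕆`: the action of the Clifford algebra of `Im 𝕆` in which
`u ∈ Im 𝕆` acts as `y ↦ y u`. -/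
noncomputable def spinRep : CliffordAlgebra imForm →ₐ[ℝ] Module.End ℝ Octonion :=
  CliffordAlgebra.lift imForm ⟨rightMulHom, rightMulHom_sq⟩

/-!
Polarizing `|v x| = |v| |x|` shows that right multiplication by a unit vector `u ∈ Im 𝔸` is a
complex structure on `𝔸ⁿ`, and that orthogonal imaginary units anticommute. The plane `C` and the
imaginary units `u` with `C u ⟂ C` are carried by `g` and by its twist `θ`, so transitivity is a
matter of normalizing first `L` by a suitable `θ` and then `C`: over `ℂ` an orthonormal basis of a
Lagrangian subspace is a unitary basis of `ℂⁿ`; over `ℍ`, products of two elements of `L` give an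
imaginary unit `v` with `C v = C`, and `C` becomes a complex form of `ℍⁿ`; over `𝕆`, once
`L = 0 ⊕ ℍ`, the only candidates are `ℍ ⊕ 0` and `0 ⊕ ℍ`, which are exchanged by right
multiplication by an element of `L`.

`Spin(7)` maps onto the twisted group of `𝕆` because right multiplication by a unit vector
`u ∈ Im 𝕆` is twisted by minus the reflection of `Im 𝕆` along `u`, and such reflections generate
the orthogonal group of `Im 𝕆`. All the homeomorphisms are continuous bijections from quotients of
compact groups to Hausdorff spaces.
-/

/-! ### Composition algebras and right multiplication -/

/-- A real algebra with unit, not necessarily associative, with a multiplicative Euclidean norm. It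
is a property of the bare operations, so that it applies to `ℂ`, `ℍ` and `Octonion` alike without
adding to the algebraic structure that they already carry. -/
class IsCompositionAlgebra (A : Type) [NormedAddCommGroup A] [InnerProductSpace ℝ A] [Mul A]
    [One A] : Prop where
  protected mul_add : ∀ x y z : A, x * (y + z) = x * y + x * z
  protected add_mul : ∀ x y z : A, (x + y) * z = x * z + y * z
  protected mul_smul : ∀ (c : ℝ) (x y : A), x * (c • y) = c • (x * y)
  protected smul_mul : ∀ (c : ℝ) (x y : A), (c • x) * y = c • (x * y)
  protected mul_one : ∀ x : A, x * 1 = x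
  protected norm_mul : ∀ x y : A, ‖x * y‖ = ‖x‖ * ‖y‖
  protected norm_one : ‖(1 : A)‖ = 1

theorem inner_map_map_of_norm_map_eq_mul {E F : Type*} [NormedAddCommGroup E]
    [InnerProductSpace ℝ E] [NormedAddCommGroup F] [InnerProductSpace ℝ F] {f : E →ₗ[ℝ] F} {c : ℝ}
    (hf : ∀ v, ‖f v‖ = c * ‖v‖) (v w : E) : inner ℝ (f v) (f w) = c ^ 2 * inner ℝ v w := by
  have h := congrArg (· ^ 2) (hf (v + w))
  simp only [map_add, mul_pow, norm_add_sq_real, hf] at h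
  linarith

theorem mem_imPart {A : Type} [NormedAddCommGroup A] [InnerProductSpace ℝ A] [One A] {x : A} :
    x ∈ imPart A ↔ inner ℝ (1 : A) x = 0 := by
  rw [imPart, Submodule.mem_orthogonal_singleton_iff_inner_right]

theorem finrank_linSpace (A : Type) [NormedAddCommGroup A] [InnerProductSpace ℝ A]
    [FiniteDimensional ℝ A] (n : ℕ) :
    Module.finrank ℝ (LinSpace A n) = n * Module.finrank ℝ A := by
  rw [(WithLp.linearEquiv 2 ℝ (Fin n → A)).finrank_eq, Module.finrank_pi_fintype,
    Finset.sum_const, Finset.card_univ, Fintype.card_fin, smul_eq_mul]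

theorem IsHalfLagrangian.finrank_eq {A : Type} [NormedAddCommGroup A] [InnerProductSpace ℝ A]
    [Mul A] [One A] {n : ℕ} {C D : Submodule ℝ (LinSpace A n)} (hC : IsHalfLagrangian C)
    (hD : IsHalfLagrangian D) : Module.finrank ℝ C = Module.finrank ℝ D :=
  Nat.eq_of_mul_eq_mul_left two_pos (hC.1.trans hD.1.symm)

section RightMultiplication

variable {A : Type} [Mul A] {n : ℕ}

@[simp] theorem rightMul_apply (v : LinSpace A n) (x : A) (k : Fin n) :
    rightMul v x k = v k * x := rfl

variable [NormedAddCommGroup A] [InnerProductSpace ℝ A] [One A] [IsCompositionAlgebra A]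

theorem rightMul_add (v : LinSpace A n) (x y : A) :
    rightMul v (x + y) = rightMul v x + rightMul v y := by
  ext i; exact IsCompositionAlgebra.mul_add _ _ _

theorem add_rightMul (v w : LinSpace A n) (x : A) :
    rightMul (v + w) x = rightMul v x + rightMul w x := by
  ext i; exact IsCompositionAlgebra.add_mul _ _ _

theorem rightMul_smul (c : ℝ) (v : LinSpace A n) (x : A) :
    rightMul v (c • x) = c • rightMul v x := by
  ext i; exact IsCompositionAlgebra.mul_smul _ _ _

theorem smul_rightMul (c : ℝ) (v : LinSpace A n) (x : A) :
    rightMul (c • v) x = c • rightMul v x := by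
  ext i; exact IsCompositionAlgebra.smul_mul _ _ _

theorem rightMul_one (v : LinSpace A n) : rightMul v (1 : A) = v := by
  ext i; exact IsCompositionAlgebra.mul_one _

/-- Right multiplication as a bilinear map. -/
noncomputable def rightMulₗ : LinSpace A n →ₗ[ℝ] A →ₗ[ℝ] LinSpace A n :=
  LinearMap.mk₂ ℝ rightMul add_rightMul smul_rightMul rightMul_add rightMul_smul

theorem rightMul_zero (v : LinSpace A n) : rightMul v (0 : A) = 0 := map_zero (rightMulₗ v)

theorem rightMul_neg (v : LinSpace A n) (x : A) : rightMul v (-x) = -rightMul v x :=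
  map_neg (rightMulₗ v) x

theorem norm_rightMul (v : LinSpace A n) (x : A) : ‖rightMul v x‖ = ‖v‖ * ‖x‖ := by
  rw [← sq_eq_sq₀ (norm_nonneg _) (by positivity), mul_pow, PiLp.norm_sq_eq_of_L2,
    PiLp.norm_sq_eq_of_L2, Finset.sum_mul]
  exact Finset.sum_congr rfl fun i _ => by
    rw [← mul_pow, ← IsCompositionAlgebra.norm_mul]
    rfl

theorem inner_rightMul_rightMul (v w : LinSpace A n) (x : A) :
    inner ℝ (rightMul v x) (rightMul w x) = ‖x‖ ^ 2 * inner ℝ v w :=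
  inner_map_map_of_norm_map_eq_mul (f := rightMulₗ.flip x)
    (fun v => (norm_rightMul v x).trans (mul_comm _ _)) v w

theorem inner_rightMul_same (v : LinSpace A n) (x y : A) :
    inner ℝ (rightMul v x) (rightMul v y) = ‖v‖ ^ 2 * inner ℝ x y :=
  inner_map_map_of_norm_map_eq_mul (f := rightMulₗ v) (norm_rightMul v) x y

theorem rightMul_injective_of_ne_zero {v : LinSpace A n} (hv : v ≠ 0) :
    Function.Injective fun x : A => rightMul v x :=
  (injective_iff_map_eq_zero (rightMulₗ v)).2 fun x hx => by
    have h := norm_rightMul v x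
    rw [show rightMul v x = 0 from hx, norm_zero, zero_eq_mul] at h
    exact norm_eq_zero.1 (h.resolve_left (norm_ne_zero_iff.2 hv))

theorem inner_rightMul_left_of_mem_imPart {x : A} (hx : x ∈ imPart A) (v w : LinSpace A n) :
    inner ℝ (rightMul v x) w = -inner ℝ v (rightMul w x) := by
  have h := inner_rightMul_rightMul v w (x + 1)
  rw [rightMul_add, rightMul_add, rightMul_one, rightMul_one, inner_add_left, inner_add_right,
    inner_add_right, inner_rightMul_rightMul, norm_add_sq_real, IsCompositionAlgebra.norm_one,
    real_inner_comm 1 x, mem_imPart.1 hx] at h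
  linarith

theorem sub_inner_one_smul_one_mem_imPart (x : A) : x - inner ℝ (1 : A) x • (1 : A) ∈ imPart A := by
  rw [mem_imPart, inner_sub_right, inner_smul_right, real_inner_self_eq_norm_sq,
    IsCompositionAlgebra.norm_one]
  ring

variable (A n) in
theorem nontrivial_linSpace [NeZero n] : Nontrivial (LinSpace A n) := by
  have : Nontrivial A :=
    ⟨1, 0, fun h => by simpa [h] using IsCompositionAlgebra.norm_one (A := A)⟩
  infer_instance

theorem eq_of_forall_rightMul_eq [NeZero n] {x y : A}
    (h : ∀ v : LinSpace A n, rightMul v x = rightMul v y) : x = y := by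
  have := nontrivial_linSpace A n
  obtain ⟨v, hv⟩ := exists_ne (0 : LinSpace A n)
  exact rightMul_injective_of_ne_zero hv (h v)

/-- The real subspace of those `u ∈ 𝔸` with `C u ⟂ C`. A subspace `C` of half the dimension is
`½𝔸`-Lagrangian when this subspace contains a half dimensional subspace of `Im 𝔸`. -/
noncomputable def perpMultipliers (C : Submodule ℝ (LinSpace A n)) : Submodule ℝ A where
  carrier := {u | ∀ c ∈ C, ∀ c' ∈ C, inner ℝ (rightMul c u) c' = 0}
  add_mem' {u w} hu hw c hc c' hc' := by
    rw [rightMul_add, inner_add_left, hu c hc c' hc', hw c hc c' hc', add_zero]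
  zero_mem' c _ c' _ := by rw [rightMul_zero, inner_zero_left]
  smul_mem' r u hu c hc c' hc' := by
    rw [rightMul_smul, inner_smul_left, hu c hc c' hc', mul_zero]

/-- The real subspace of those `u ∈ 𝔸` with `C u ⊂ C`. -/
noncomputable def stableMultipliers (C : Submodule ℝ (LinSpace A n)) : Submodule ℝ A where
  carrier := {u | ∀ c ∈ C, rightMul c u ∈ C}
  add_mem' hu hw c hc := rightMul_add c _ _ ▸ C.add_mem (hu c hc) (hw c hc)
  zero_mem' c _ := rightMul_zero c ▸ C.zero_mem
  smul_mem' r _ hu c hc := rightMul_smul r c _ ▸ C.smul_mem r (hu c hc)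

theorem isHalfLagrangian_iff {C : Submodule ℝ (LinSpace A n)} :
    IsHalfLagrangian C ↔ 2 * Module.finrank ℝ C = Module.finrank ℝ (LinSpace A n) ∧
      ∃ L : Submodule ℝ A, L ≤ imPart A ∧ 2 * Module.finrank ℝ L = Module.finrank ℝ A ∧
        L ≤ perpMultipliers C := by
  refine and_congr_right fun _ => exists_congr fun L => and_congr_right fun _ =>
    and_congr_right fun _ => ⟨fun h u hu => ?_, fun h u hu _ => h hu⟩
  rcases eq_or_ne u 0 with rfl | hu0
  · exact zero_mem _
  · have hmem : ‖u‖⁻¹ • u ∈ perpMultipliers C := h _ (L.smul_mem _ hu) (norm_smul_inv_norm hu0)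
    exact ((perpMultipliers C).smul_mem_iff (inv_ne_zero (norm_ne_zero_iff.2 hu0))).1 hmem

/-- Dimensions force `C u' = Cᗮ`, so that `C u ⊂ Cᗮ = C u'`; multiply by `u'` once more. -/
theorem rightMul_rightMul_mem [FiniteDimensional ℝ A] {C : Submodule ℝ (LinSpace A n)}
    (hC : 2 * Module.finrank ℝ C = Module.finrank ℝ (LinSpace A n)) {u u' : A}
    (hu : u ∈ perpMultipliers C) (hu' : u' ∈ perpMultipliers C)
    (hsq : ∀ v : LinSpace A n, rightMul (rightMul v u') u' = -v) {c : LinSpace A n} (hc : c ∈ C) :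
    rightMul (rightMul c u) u' ∈ C := by
  let R : LinSpace A n →ₗ[ℝ] LinSpace A n := rightMulₗ.flip u'
  have hR : Function.Injective R := fun v w h => by
    rw [← neg_inj, ← hsq v, ← hsq w]
    exact congrArg (rightMul · u') h
  have map_le : C.map R ≤ Cᗮ := by
    rintro _ ⟨x, hx, rfl⟩
    exact (C.mem_orthogonal' _).2 (hu' x hx)
  have map_eq : C.map R = Cᗮ := Submodule.eq_of_le_of_finrank_le map_le (by
    have h₁ := C.finrank_add_finrank_orthogonal
    have h₂ := (Submodule.equivMapOfInjective R hR C).finrank_eq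
    omega)
  obtain ⟨x, hx, hxu⟩ : rightMul c u ∈ C.map R := map_eq ▸ (C.mem_orthogonal' _).2 (hu c hc)
  rw [← hxu, show rightMul (R x) u' = -x from hsq x]
  exact C.neg_mem hx

end RightMultiplication

/-! ### The action of the twisted group on subspaces -/

section TwistedGroup

variable {A : Type} [NormedAddCommGroup A] [InnerProductSpace ℝ A] [Mul A] {n : ℕ}

theorem imageUnder_mul (g h : twistedGroup A n) (C : Submodule ℝ (LinSpace A n)) :
    imageUnder (g * h) C = imageUnder g (imageUnder h C) :=
  Submodule.map_comp (h.1.toLinearEquiv : LinSpace A n →ₗ[ℝ] LinSpace A n)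
    (g.1.toLinearEquiv : LinSpace A n →ₗ[ℝ] LinSpace A n) C

theorem imageUnder_one (C : Submodule ℝ (LinSpace A n)) :
    imageUnder (1 : twistedGroup A n) C = C := Submodule.map_id C

theorem imageUnder_inv_eq_iff {g : twistedGroup A n} {C D : Submodule ℝ (LinSpace A n)} :
    imageUnder g⁻¹ D = C ↔ imageUnder g C = D := by
  constructor <;> rintro rfl <;> simp [← imageUnder_mul, imageUnder_one]

theorem imageUnder_eq_imageUnder_iff {g h : twistedGroup A n} {C : Submodule ℝ (LinSpace A n)} :
    imageUnder g C = imageUnder h C ↔ imageUnder (g⁻¹ * h) C = C := by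
  rw [imageUnder_mul, imageUnder_inv_eq_iff]

theorem finrank_imageUnder (g : twistedGroup A n) (C : Submodule ℝ (LinSpace A n)) :
    Module.finrank ℝ (imageUnder g C) = Module.finrank ℝ C :=
  LinearEquiv.finrank_map_eq g.1.toLinearEquiv C

theorem imageUnder_eq_of_forall_mem [FiniteDimensional ℝ A] {g : twistedGroup A n}
    {C D : Submodule ℝ (LinSpace A n)} (hCD : Module.finrank ℝ D ≤ Module.finrank ℝ C)
    (h : ∀ x ∈ C, g.1 x ∈ D) : imageUnder g C = D :=
  Submodule.eq_of_le_of_finrank_le (Submodule.map_le_iff_le_comap.2 h)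
    (hCD.trans (finrank_imageUnder g C).ge)

variable [One A] [IsCompositionAlgebra A] [NeZero n]

/-- The isometry `θ` of `𝔸` with `g (v x) = g v θ(x)`, as a function of `g`. It is unique for
`n ≥ 1`, and therefore multiplicative in `g`. -/
noncomputable def twist : twistedGroup A n →* (A ≃ₗᵢ[ℝ] A) where
  toFun g := g.2.choose
  map_one' := LinearIsometryEquiv.ext fun x => eq_of_forall_rightMul_eq fun v =>
    ((1 : twistedGroup A n).2.choose_spec.2 v x).symm
  map_mul' g h := LinearIsometryEquiv.ext fun x =>
    eq_of_forall_rightMul_eq (n := n) <| (g * h).1.surjective.forall.2 fun v => by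
      rw [← (g * h).2.choose_spec.2]
      exact (congrArg g.1 (h.2.choose_spec.2 v x)).trans (g.2.choose_spec.2 _ _)

theorem apply_rightMul (g : twistedGroup A n) (v : LinSpace A n) (x : A) :
    g.1 (rightMul v x) = rightMul (g.1 v) (twist g x) := g.2.choose_spec.2 v x

theorem det_twist (g : twistedGroup A n) :
    LinearMap.det ((twist g).toLinearEquiv : A →ₗ[ℝ] A) = 1 := g.2.choose_spec.1

theorem twist_apply_eq_of_forall {g : twistedGroup A n} {x y : A}
    (h : ∀ v, g.1 (rightMul v x) = rightMul (g.1 v) y) : twist g x = y :=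
  eq_of_forall_rightMul_eq <| g.1.surjective.forall.2 fun v => by rw [← apply_rightMul, h]

theorem twist_apply_one (g : twistedGroup A n) : twist g 1 = 1 :=
  twist_apply_eq_of_forall fun v => by rw [rightMul_one, rightMul_one]

theorem twist_inv_apply_eq_iff (g : twistedGroup A n) {x y : A} :
    twist g⁻¹ x = y ↔ twist g y = x := by
  rw [map_inv, LinearIsometryEquiv.inv_def, LinearIsometryEquiv.symm_apply_eq, eq_comm]

theorem twist_mem_imPart (g : twistedGroup A n) {x : A} (hx : x ∈ imPart A) :
    twist g x ∈ imPart A := by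
  rw [mem_imPart] at *
  rw [← twist_apply_one g, LinearIsometryEquiv.inner_map_map, hx]

theorem twist_mem_perpMultipliers (g : twistedGroup A n) {C : Submodule ℝ (LinSpace A n)} {u : A}
    (hu : u ∈ perpMultipliers C) : twist g u ∈ perpMultipliers (imageUnder g C) := by
  rintro _ ⟨c, hc, rfl⟩ _ ⟨c', hc', rfl⟩
  exact (congrArg (inner ℝ · (g.1 c')) (apply_rightMul g c u)).symm.trans
    ((g.1.inner_map_map _ _).trans (hu c hc c' hc'))

theorem twist_mem_stableMultipliers (g : twistedGroup A n) {C : Submodule ℝ (LinSpace A n)} {u : A}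
    (hu : u ∈ stableMultipliers C) : twist g u ∈ stableMultipliers (imageUnder g C) := by
  rintro _ ⟨c, hc, rfl⟩
  exact ⟨rightMul c u, hu c hc, apply_rightMul g c u⟩

theorem IsHalfLagrangian.imageUnder {C : Submodule ℝ (LinSpace A n)} (hC : IsHalfLagrangian C)
    (g : twistedGroup A n) : IsHalfLagrangian (imageUnder g C) := by
  rw [isHalfLagrangian_iff] at *
  obtain ⟨hdim, L, hLim, hLdim, hL⟩ := hC
  refine ⟨(finrank_imageUnder g C).symm ▸ hdim,
    L.map ((twist g).toLinearEquiv : A →ₗ[ℝ] A), ?_, ?_, ?_⟩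
  · exact Submodule.map_le_iff_le_comap.2 fun u hu => twist_mem_imPart g (hLim hu)
  · exact (LinearEquiv.finrank_map_eq (twist g).toLinearEquiv L).symm ▸ hLdim
  · exact Submodule.map_le_iff_le_comap.2 fun u hu => twist_mem_perpMultipliers g (hL hu)

end TwistedGroup

/-! ### Topology of the twisted group and homogeneous spaces -/

theorem starProjection_injective {E : Type*} [NormedAddCommGroup E] [InnerProductSpace ℝ E]
    [FiniteDimensional ℝ E] :
    Function.Injective fun C : Submodule ℝ E => C.starProjection := fun C D h => by
  simpa using congrArg (fun f : E →L[ℝ] E => f.range) h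

theorem isCompact_setOf_norm_map {𝕜 E F : Type*} [NontriviallyNormedField 𝕜] [ProperSpace 𝕜]
    [NormedAddCommGroup E] [NormedSpace 𝕜 E] [FiniteDimensional 𝕜 E] [NormedAddCommGroup F]
    [NormedSpace 𝕜 F] [FiniteDimensional 𝕜 F] :
    IsCompact {f : E →L[𝕜] F | ∀ v, ‖f v‖ = ‖v‖} := by
  have : ProperSpace (E →L[𝕜] F) := FiniteDimensional.proper 𝕜 _
  refine (isCompact_closedBall (0 : E →L[𝕜] F) 1).of_isClosed_subset ?_ fun f hf => ?_
  · simp only [Set.ofPred_forall]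
    exact isClosed_iInter fun v => isClosed_eq (by fun_prop) continuous_const
  · rw [mem_closedBall_zero_iff]
    exact f.opNorm_le_bound zero_le_one fun v => by rw [hf v, one_mul]

theorem exists_quotient_homeomorph {G X : Type*} [Group G] [TopologicalSpace G] [CompactSpace G]
    [TopologicalSpace X] [T2Space X] {K : Subgroup G} {f : G → X} (hf : Continuous f)
    (hs : Function.Surjective f) (hK : ∀ g h, f g = f h ↔ g⁻¹ * h ∈ K) :
    ∃ e : (G ⧸ K) ≃ₜ X, ∀ g : G, e (g : G ⧸ K) = f g := by
  let F : G ⧸ K → X := Quotient.lift f fun a b hab =>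
    (hK a b).2 (QuotientGroup.leftRel_apply.1 hab)
  have hF : Function.Bijective F := by
    refine ⟨fun a b h => ?_, fun x => (hs x).imp' (QuotientGroup.mk ·) fun _ h => h⟩
    induction a using QuotientGroup.induction_on
    induction b using QuotientGroup.induction_on
    exact QuotientGroup.eq.2 ((hK _ _).1 h)
  have hc : Continuous (Equiv.ofBijective F hF) := hf.quotient_lift _
  exact ⟨hc.homeoOfEquivCompactToT2, fun _ => rfl⟩

section TwistedGroupTopology

variable {A : Type} [NormedAddCommGroup A] [InnerProductSpace ℝ A] [Mul A] {n : ℕ}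

/-- An element of the twisted group as a continuous linear map. This is the map from which the
twisted group takes its topology. -/
noncomputable def twistedCLM (g : twistedGroup A n) : LinSpace A n →L[ℝ] LinSpace A n :=
  ((g : LinSpace A n ≃ₗᵢ[ℝ] LinSpace A n).toContinuousLinearEquiv :
      LinSpace A n →L[ℝ] LinSpace A n)

theorem isInducing_twistedCLM :
    Topology.IsInducing (twistedCLM : twistedGroup A n → _) := ⟨rfl⟩

theorem continuous_twistedGroup_apply (v : LinSpace A n) :
    Continuous fun g : twistedGroup A n => g.1 v :=
  (ContinuousLinearMap.apply ℝ (LinSpace A n) v).continuous.comp isInducing_twistedCLM.continuous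

variable [FiniteDimensional ℝ A]

theorem continuous_twistedGroup_iff {X : Type*} [TopologicalSpace X] {f : X → twistedGroup A n} :
    Continuous f ↔ ∀ v, Continuous fun x => (f x).1 v := by
  rw [isInducing_twistedCLM.continuous_iff, continuous_clm_apply]
  rfl

theorem twistedCLM_inv (g : twistedGroup A n) :
    twistedCLM g⁻¹ = ContinuousLinearMap.adjoint (twistedCLM g) :=
  (ContinuousLinearMap.eq_adjoint_iff _ _).2 fun x y =>
    g.1.symm.inner_map_eq_flip x y

theorem continuous_twistedCLM_inv : Continuous fun g : twistedGroup A n => twistedCLM g⁻¹ := by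
  simp_rw [twistedCLM_inv]
  exact ContinuousLinearMap.adjoint.continuous.comp isInducing_twistedCLM.continuous

theorem starProjection_imageUnder (g : twistedGroup A n) (C : Submodule ℝ (LinSpace A n)) :
    (imageUnder g C).starProjection = twistedCLM g ∘L C.starProjection ∘L twistedCLM g⁻¹ :=
  ContinuousLinearMap.ext (Submodule.starProjection_map_apply g.1 C)

theorem continuous_starProjection_imageUnder (C : Submodule ℝ (LinSpace A n)) :
    Continuous fun g : twistedGroup A n => (imageUnder g C).starProjection := by
  simp_rw [starProjection_imageUnder]
  exact isInducing_twistedCLM.continuous.clm_comp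
    (continuous_const.clm_comp continuous_twistedCLM_inv)

variable [One A]

instance : T2Space (HalfLagrangian A n) :=
  T2Space.of_injective_continuous (f := fun C : HalfLagrangian A n => C.1.starProjection)
    (fun _ _ h => Subtype.ext (starProjection_injective h)) continuous_induced_dom

variable [IsCompositionAlgebra A]

theorem continuous_rightMul : Continuous fun q : LinSpace A n × A => rightMul q.1 q.2 :=
  ((LinearMap.toContinuousLinearMap.toLinearMap ∘ₗ
    (rightMulₗ : LinSpace A n →ₗ[ℝ] A →ₗ[ℝ] LinSpace A n)).toContinuousLinearMap
      |>.isBoundedBilinearMap).continuous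

theorem continuous_twist [NeZero n] (x : A) :
    Continuous fun g : twistedGroup A n => twist g x := by
  have := nontrivial_linSpace A n
  obtain ⟨v, hv⟩ := exists_norm_eq (LinSpace A n) zero_le_one
  have inner_twist (y : A) (g : twistedGroup A n) :
      inner ℝ y (twist g x) = inner ℝ (rightMul (g.1 v) y) (g.1 (rightMul v x)) := by
    rw [apply_rightMul, inner_rightMul_same, LinearIsometryEquiv.norm_map, hv, one_pow, one_mul]
  have continuous_inner (y : A) : Continuous fun g : twistedGroup A n => inner ℝ y (twist g x) := by
    simp_rw [inner_twist]
    exact (continuous_rightMul.comp ((continuous_twistedGroup_apply v).prodMk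
      continuous_const)).inner (continuous_twistedGroup_apply _)
  have twist_eq_sum (g : twistedGroup A n) := (stdOrthonormalBasis ℝ A).sum_repr' (twist g x)
  exact (continuous_finsetSum _ fun i _ => (continuous_inner _).smul continuous_const).congr
    twist_eq_sum

/-- The pairs `(φ, θ)` with `φ (v x) = φ v θ(x)` form a closed subset of a product of two compact
orthogonal groups, and the twisted group is its projection. -/
instance : CompactSpace (twistedGroup A n) := by
  let S : Set ((LinSpace A n →L[ℝ] LinSpace A n) × (A →L[ℝ] A)) :=
    ({f | ∀ v, ‖f v‖ = ‖v‖} ×ˢ {f | ∀ v, ‖f v‖ = ‖v‖}) ∩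
      ({p | p.2.det = 1} ∩ {p | ∀ v x, p.1 (rightMul v x) = rightMul (p.1 v) (p.2 x)})
  have isCompact_S : IsCompact S := by
    refine (isCompact_setOf_norm_map.prod isCompact_setOf_norm_map).inter_right
      ((isClosed_eq (ContinuousLinearMap.continuous_det.comp continuous_snd)
        continuous_const).inter ?_)
    simp only [Set.ofPred_forall]
    exact isClosed_iInter fun v => isClosed_iInter fun x => isClosed_eq (by fun_prop)
      (continuous_rightMul.comp (.prodMk (by fun_prop) (by fun_prop)))
  have range_eq : Set.range (twistedCLM : twistedGroup A n → _) = Prod.fst '' S := by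
    ext f
    constructor
    · rintro ⟨g, rfl⟩
      obtain ⟨θ, hθ, h⟩ := g.2
      exact ⟨(twistedCLM g, (θ.toContinuousLinearEquiv : A →L[ℝ] A)),
        ⟨⟨g.1.norm_map, θ.norm_map⟩, hθ, h⟩, rfl⟩
    · rintro ⟨⟨f, t⟩, ⟨⟨hf, ht⟩, hdet, h⟩, rfl⟩
      let φ := (⟨f.toLinearMap, hf⟩ : LinSpace A n →ₗᵢ[ℝ] LinSpace A n).toLinearIsometryEquiv rfl
      let θ := (⟨t.toLinearMap, ht⟩ : A →ₗᵢ[ℝ] A).toLinearIsometryEquiv rfl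
      exact ⟨⟨φ, θ, hdet, h⟩, rfl⟩
  rw [← isCompact_univ_iff, isInducing_twistedCLM.isCompact_iff, Set.image_univ, range_eq]
  exact isCompact_S.image continuous_fst

theorem isHomogeneousSpace_of_stabilizer_eq [NeZero n] {K : Subgroup (twistedGroup A n)}
    {C₀ : Submodule ℝ (LinSpace A n)} (hC₀ : IsHalfLagrangian C₀)
    (transitive : ∀ C, IsHalfLagrangian C → ∃ g : twistedGroup A n, imageUnder g C₀ = C)
    (stabilizer : ∀ g, imageUnder g C₀ = C₀ ↔ g ∈ K) : IsHomogeneousSpace K C₀ := by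
  refine ⟨fun g C hC => hC.imageUnder g, fun C C' hC hC' => ?_, ?_⟩
  · obtain ⟨g, hg⟩ := transitive C hC
    obtain ⟨g', hg'⟩ := transitive C' hC'
    exact ⟨g' * g⁻¹, by rw [imageUnder_mul, imageUnder_inv_eq_iff.2 hg, hg']⟩
  · let orbitMap (g : twistedGroup A n) : HalfLagrangian A n :=
      ⟨imageUnder g C₀, hC₀.imageUnder g⟩
    have continuous_orbitMap : Continuous orbitMap :=
      continuous_induced_rng.2 (continuous_starProjection_imageUnder C₀)
    obtain ⟨e, he⟩ := exists_quotient_homeomorph (K := K) continuous_orbitMap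
      (fun C => (transitive C.1 C.2).imp fun g hg => Subtype.ext hg)
      (fun g h => by rw [← stabilizer, ← imageUnder_eq_imageUnder_iff]; exact Subtype.ext_iff)
    exact ⟨e, fun g => by rw [he]⟩

end TwistedGroupTopology

/-! ### Associative composition algebras and unitary matrices -/

section UnitaryMatrices

open Matrix

/-- A composition algebra that is an associative star ring with `⟨x, y⟩ = Re (x* y)`. -/
class IsStarCompositionAlgebra (F : Type) [NormedRing F] [InnerProductSpace ℝ F]
    [StarRing F] : Prop extends IsCompositionAlgebra F where
  protected inner_eq : ∀ x y : F, inner ℝ x y = inner ℝ 1 (star x * y)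

instance : IsStarCompositionAlgebra ℂ where
  mul_add := mul_add
  add_mul := add_mul
  mul_smul c x y := mul_smul_comm c x y
  smul_mul c x y := smul_mul_assoc c x y
  mul_one := mul_one
  norm_mul := norm_mul
  norm_one := norm_one
  inner_eq x y := by simp [Complex.inner]; ring

instance : IsStarCompositionAlgebra ℍ[ℝ] where
  mul_add := mul_add
  add_mul := add_mul
  mul_smul c x y := mul_smul_comm c x y
  smul_mul c x y := smul_mul_assoc c x y
  mul_one := mul_one
  norm_mul := norm_mul
  norm_one := norm_one
  inner_eq x y := by simp [Quaternion.inner_def]; ring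

variable {F : Type} [NormedRing F] {n : ℕ}

theorem sum_rightMul_single (v : LinSpace F n) :
    ∑ l, rightMul (PiLp.single 2 l 1) (v l) = v := by
  ext k
  simp [WithLp.ofLp_sum]

variable [StarRing F]

/-- The sesquilinear product `∑ k, v k* w k` on `Fⁿ`, linear in the second variable for right
multiplication. -/
def herm (v w : LinSpace F n) : F := star v.ofLp ⬝ᵥ w.ofLp

theorem herm_def (v w : LinSpace F n) : herm v w = ∑ k, star (v k) * w k := rfl

theorem star_herm (v w : LinSpace F n) : star (herm v w) = herm w v := by
  simp [herm_def, star_sum, star_mul]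

theorem herm_rightMul_right (v w : LinSpace F n) (x : F) :
    herm v (rightMul w x) = herm v w * x := by
  simp [herm_def, Finset.sum_mul, mul_assoc]

theorem herm_rightMul_left (v w : LinSpace F n) (x : F) :
    herm (rightMul v x) w = star x * herm v w := by
  rw [← star_herm, herm_rightMul_right, star_mul, star_herm]

theorem herm_single (k l : Fin n) :
    herm (PiLp.single 2 k 1) (PiLp.single 2 l 1 : LinSpace F n) = if k = l then 1 else 0 := by
  rw [herm_def, Finset.sum_eq_single k (by simp +contextual) (by simp)]
  simp

variable [InnerProductSpace ℝ F] [IsStarCompositionAlgebra F]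

theorem inner_eq_inner_one_herm (v w : LinSpace F n) :
    inner ℝ v w = inner ℝ (1 : F) (herm v w) := by
  rw [herm_def, inner_sum, PiLp.inner_apply]
  exact Finset.sum_congr rfl fun k _ => IsStarCompositionAlgebra.inner_eq _ _

theorem inner_rightMul_right (v w : LinSpace F n) (x : F) :
    inner ℝ v (rightMul w x) = inner ℝ (star (herm v w)) x := by
  rw [inner_eq_inner_one_herm, herm_rightMul_right, IsStarCompositionAlgebra.inner_eq (star _),
    star_star]

theorem herm_eq_herm_of_forall_inner_eq {v w v' w' : LinSpace F n}
    (h : ∀ x : F, inner ℝ v (rightMul w x) = inner ℝ v' (rightMul w' x)) :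
    herm v w = herm v' w' := by
  refine star_injective (ext_inner_right ℝ fun x => ?_)
  rw [← inner_rightMul_right, h, inner_rightMul_right]

/-- Multiplication of column vectors by a unitary matrix. -/
noncomputable def unitaryHom :
    unitary (Matrix (Fin n) (Fin n) F) →* (LinSpace F n ≃ₗᵢ[ℝ] LinSpace F n) where
  toFun M :=
    { toFun := fun v => WithLp.toLp 2 (M.1 *ᵥ v.ofLp)
      invFun := fun v => WithLp.toLp 2 (star M.1 *ᵥ v.ofLp)
      map_add' := fun v w => by ext k; simp [mulVec_add]
      map_smul' := fun c v => by
        ext k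
        simp [mulVec, dotProduct, Finset.smul_sum, IsCompositionAlgebra.mul_smul]
      left_inv := fun v => by simp [mulVec_mulVec]
      right_inv := fun v => by simp [mulVec_mulVec]
      norm_map' := fun v => by
        change ‖WithLp.toLp 2 (M.1 *ᵥ v.ofLp)‖ = ‖v‖
        rw [← sq_eq_sq₀ (norm_nonneg _) (norm_nonneg _), ← real_inner_self_eq_norm_sq,
          ← real_inner_self_eq_norm_sq, inner_eq_inner_one_herm, inner_eq_inner_one_herm v]
        simp only [herm, star_mulVec, dotProduct_mulVec, vecMul_vecMul]
        rw [← star_eq_conjTranspose, Unitary.coe_star_mul_self, vecMul_one] }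
  map_one' := by ext v k; simp
  map_mul' M N := by
    ext v k
    exact congrFun (mulVec_mulVec v.ofLp M.1 N.1).symm k

theorem unitaryHom_apply (M : unitary (Matrix (Fin n) (Fin n) F)) (v : LinSpace F n) (k : Fin n) :
    unitaryHom M v k = ∑ l, M.1 k l * v l := rfl

theorem unitaryHom_rightMul (M : unitary (Matrix (Fin n) (Fin n) F)) (v : LinSpace F n) (x : F) :
    unitaryHom M (rightMul v x) = rightMul (unitaryHom M v) x := by
  ext k
  simp [unitaryHom_apply, Finset.sum_mul, mul_assoc]

theorem unitaryHom_single (M : unitary (Matrix (Fin n) (Fin n) F)) (k l : Fin n) :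
    unitaryHom M (PiLp.single 2 l 1) k = M.1 k l := by
  simp [unitaryHom_apply]

theorem unitaryHom_injective :
    Function.Injective (unitaryHom : unitary (Matrix (Fin n) (Fin n) F) → _) := fun M N h =>
  Subtype.ext <| Matrix.ext fun k l => by rw [← unitaryHom_single M, ← unitaryHom_single N, h]

theorem continuous_unitaryHom_apply {X : Type*} [TopologicalSpace X]
    {f : X → unitary (Matrix (Fin n) (Fin n) F)} (hf : ∀ k l, Continuous fun x => (f x).1 k l)
    (v : LinSpace F n) : Continuous fun x => unitaryHom (f x) v :=
  (PiLp.continuous_toLp 2 _).comp <| continuous_pi fun k => by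
    change Continuous fun x => ∑ l, (f x).1 k l * v l
    exact continuous_finsetSum _ fun l _ => (hf k l).mul continuous_const

variable [IsStablyFiniteRing F]

theorem exists_unitaryHom_single_eq {c : Fin n → LinSpace F n}
    (hc : ∀ k l, herm (c k) (c l) = if k = l then 1 else 0) :
    ∃ M : unitary (Matrix (Fin n) (Fin n) F), ∀ l, unitaryHom M (PiLp.single 2 l 1) = c l := by
  let M : Matrix (Fin n) (Fin n) F := Matrix.of fun k l => c l k
  have star_mul_self : star M * M = 1 := by
    ext k l
    rw [Matrix.one_apply, ← hc k l]
    rfl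
  refine ⟨⟨M, Unitary.mem_iff.2 ⟨star_mul_self, mul_eq_one_comm.1 star_mul_self⟩⟩, fun l => ?_⟩
  ext k
  rw [unitaryHom_single]
  rfl

theorem exists_unitaryHom_eq {φ : LinSpace F n ≃ₗᵢ[ℝ] LinSpace F n}
    (h : ∀ v x, φ (rightMul v x) = rightMul (φ v) x) :
    ∃ M : unitary (Matrix (Fin n) (Fin n) F), unitaryHom M = φ := by
  obtain ⟨M, hM⟩ := exists_unitaryHom_single_eq (c := fun l => φ (PiLp.single 2 l 1)) fun k l => by
    rw [← herm_single]
    refine herm_eq_herm_of_forall_inner_eq fun x => ?_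
    rw [← h, LinearIsometryEquiv.inner_map_map]
  refine ⟨M, LinearIsometryEquiv.ext fun v => ?_⟩
  rw [← sum_rightMul_single v, map_sum, map_sum]
  refine Finset.sum_congr rfl fun l _ => ?_
  rw [unitaryHom_rightMul, hM, h]

end UnitaryMatrices

/-! ### The complex case -/

section Complex

open Matrix

variable {n : ℕ}

theorem twist_complex [NeZero n] (g : twistedGroup ℂ n) : twist g = 1 := by
  refine (linear_isometry_complex_aux (twist_apply_one g)).resolve_right fun h => ?_
  have det_twist_eq : LinearMap.det ((twist g).toLinearEquiv : ℂ →ₗ[ℝ] ℂ) = -1 := by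
    rw [h]
    exact Complex.det_conjAe
  rw [det_twist] at det_twist_eq
  norm_num at det_twist_eq

theorem unitaryHom_mem_twistedGroup (M : Matrix.unitaryGroup (Fin n) ℂ) :
    unitaryHom M ∈ twistedGroup ℂ n :=
  ⟨LinearIsometryEquiv.refl ℝ ℂ, LinearMap.det_id, unitaryHom_rightMul M⟩

/-- The group `U(n)` as the group of twisted isomorphisms of `ℂⁿ`. -/
noncomputable def unitaryEquiv (n : ℕ) [NeZero n] :
    Matrix.unitaryGroup (Fin n) ℂ ≃ₜ* twistedGroup ℂ n :=
  let E : Matrix.unitaryGroup (Fin n) ℂ ≃* twistedGroup ℂ n :=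
    MulEquiv.ofBijective (unitaryHom.codRestrict _ unitaryHom_mem_twistedGroup)
      ⟨fun _ _ h => unitaryHom_injective (congrArg Subtype.val h), fun g =>
        (exists_unitaryHom_eq fun v x => by rw [apply_rightMul, twist_complex]; rfl).imp
          fun _ h => Subtype.ext h⟩
  { E with
    continuous_toFun := continuous_twistedGroup_iff.2 fun v =>
      continuous_unitaryHom_apply (X := Matrix.unitaryGroup (Fin n) ℂ) (f := id)
        (fun k l => (continuous_apply_apply k l).comp continuous_subtype_val) v
    continuous_invFun := by
      have entry (g : twistedGroup ℂ n) (k l : Fin n) :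
          (E.symm g).1 k l = g.1 (PiLp.single 2 l 1) k := by
        rw [← unitaryHom_single]
        exact congrArg (fun g : twistedGroup ℂ n => g.1 _ k) (E.apply_symm_apply g)
      refine continuous_induced_rng.2 (continuous_pi fun k => continuous_pi fun l => ?_)
      change Continuous fun g => (E.symm g).1 k l
      simp_rw [entry]
      exact (PiLp.continuous_apply 2 _ k).comp (continuous_twistedGroup_apply _) }

theorem unitaryEquiv_val [NeZero n] (M : Matrix.unitaryGroup (Fin n) ℂ) :
    (unitaryEquiv n M).1 = unitaryHom M := rfl

/-- The coordinates of `ℝⁿ ⊂ ℂⁿ`. -/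
noncomputable def realSubspaceEquiv (n : ℕ) : realSubspace n ≃ₗ[ℝ] (Fin n → ℝ) where
  toFun v i := (v.1 i).re
  map_add' v w := rfl
  map_smul' c v := by ext i; simp
  invFun x := ⟨WithLp.toLp 2 fun i => (x i : ℂ), fun i => Complex.ofReal_im _⟩
  left_inv v := Subtype.ext (PiLp.ext fun i => Complex.ext rfl (v.2 i).symm)
  right_inv x := rfl

instance fact_finrank_realSubspace : Fact (Module.finrank ℝ (realSubspace n) = n) :=
  ⟨by rw [(realSubspaceEquiv n).finrank_eq, Module.finrank_fin_fun]⟩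

theorem isHalfLagrangian_realSubspace : IsHalfLagrangian (realSubspace n) := by
  refine isHalfLagrangian_iff.2 ⟨?_, ℝ ∙ Complex.I, ?_, ?_, ?_⟩
  · rw [fact_finrank_realSubspace.out, finrank_linSpace, Complex.finrank_real_complex, mul_comm]
  · rw [Submodule.span_singleton_le_iff_mem, mem_imPart]
    simp [Complex.inner]
  · rw [finrank_span_singleton Complex.I_ne_zero, Complex.finrank_real_complex]
  · rw [Submodule.span_singleton_le_iff_mem]
    intro c hc c' hc'
    rw [PiLp.inner_apply]
    exact Finset.sum_eq_zero fun i _ => by simp [Complex.inner, hc i, hc' i]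

theorem I_mem_perpMultipliers {C : Submodule ℝ (LinSpace ℂ n)} (hC : IsHalfLagrangian C) :
    Complex.I ∈ perpMultipliers C := by
  obtain ⟨-, L, hLim, hLdim, hL⟩ := isHalfLagrangian_iff.1 hC
  have : Fact (Module.finrank ℝ ℂ = 1 + 1) := ⟨Complex.finrank_real_complex⟩
  have finrank_imPart : Module.finrank ℝ (imPart ℂ) = 1 :=
    Submodule.finrank_orthogonal_span_singleton one_ne_zero
  obtain rfl : L = imPart ℂ := Submodule.eq_of_le_of_finrank_le hLim (by
    rw [Complex.finrank_real_complex] at hLdim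
    omega)
  exact hL (mem_imPart.2 (by simp [Complex.inner]))

theorem IsHalfLagrangian.exists_herm_basis {C : Submodule ℝ (LinSpace ℂ n)}
    (hC : IsHalfLagrangian C) :
    ∃ c : Fin n → LinSpace ℂ n, (∀ k, c k ∈ C) ∧
      ∀ k l, herm (c k) (c l) = if k = l then 1 else 0 := by
  have finrank_C : Module.finrank ℝ C = n :=
    (hC.finrank_eq isHalfLagrangian_realSubspace).trans fact_finrank_realSubspace.out
  let b := (stdOrthonormalBasis ℝ C).reindex (finCongr finrank_C)
  refine ⟨fun k => b k, fun k => (b k).2, fun k l => Complex.ext ?_ ?_⟩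
  · have inner_eq := orthonormal_iff_ite.1 b.orthonormal k l
    rw [Submodule.coe_inner, inner_eq_inner_one_herm] at inner_eq
    simp only [Complex.inner, map_one, mul_one] at inner_eq
    rw [inner_eq]
    split_ifs <;> simp
  · have inner_I := I_mem_perpMultipliers hC _ (b k).2 _ (b l).2
    rw [inner_eq_inner_one_herm, herm_rightMul_left] at inner_I
    have im_eq : (herm (b k : LinSpace ℂ n) (b l)).im = 0 := by
      simpa [Complex.inner] using inner_I
    rw [im_eq]
    split_ifs <;> simp

variable [NeZero n]

theorem exists_imageUnder_realSubspace_eq {C : Submodule ℝ (LinSpace ℂ n)}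
    (hC : IsHalfLagrangian C) : ∃ g : twistedGroup ℂ n, imageUnder g (realSubspace n) = C := by
  obtain ⟨c, hc, herm_c⟩ := hC.exists_herm_basis
  obtain ⟨M, hM⟩ := exists_unitaryHom_single_eq herm_c
  refine ⟨unitaryEquiv n M, imageUnder_eq_of_forall_mem
    (hC.finrank_eq isHalfLagrangian_realSubspace).le fun x hx => ?_⟩
  rw [unitaryEquiv_val, ← sum_rightMul_single x, map_sum]
  refine sum_mem fun l _ => ?_
  have x_eq : x l = (x l).re • (1 : ℂ) := Complex.ext (by simp) (by simp [hx l])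
  rw [x_eq, rightMul_smul, rightMul_one, map_smul, hM]
  exact C.smul_mem _ (hc l)

theorem imageUnder_realSubspace_eq_iff {M : Matrix.unitaryGroup (Fin n) ℂ} :
    imageUnder (unitaryEquiv n M) (realSubspace n) = realSubspace n ↔
      M ∈ orthogonalInUnitary n := by
  constructor
  · intro h k l
    have column_mem : unitaryHom M (PiLp.single 2 l 1) ∈ realSubspace n :=
      h.le (Submodule.mem_map_of_mem fun i => by rw [PiLp.single_apply]; split_ifs <;> simp)
    simpa only [unitaryHom_single] using column_mem k
  · intro h
    refine imageUnder_eq_of_forall_mem le_rfl fun x hx k => ?_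
    rw [unitaryEquiv_val, unitaryHom_apply, Complex.im_sum]
    exact Finset.sum_eq_zero fun l _ => by simp [Complex.mul_im, h k l, hx l]

theorem mem_map_unitaryEquiv {K : Subgroup (Matrix.unitaryGroup (Fin n) ℂ)}
    {M : Matrix.unitaryGroup (Fin n) ℂ} :
    unitaryEquiv n M ∈ K.map (unitaryEquiv n).toMonoidHom ↔ M ∈ K :=
  Subgroup.mem_map_iff_mem (f := (unitaryEquiv n).toMonoidHom) (unitaryEquiv n).injective

theorem isHomogeneousSpace_realSubspace :
    IsHomogeneousSpace ((orthogonalInUnitary n).map (unitaryEquiv n).toMonoidHom)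
      (realSubspace n) := by
  refine isHomogeneousSpace_of_stabilizer_eq isHalfLagrangian_realSubspace
    (fun C hC => exists_imageUnder_realSubspace_eq hC) ((unitaryEquiv n).surjective.forall.2 ?_)
  intro M
  rw [imageUnder_realSubspace_eq_iff, mem_map_unitaryEquiv]

end Complex

/-! ### Oriented Lagrangian subspaces -/

section Oriented

variable {n : ℕ}

theorem det_eq_ofReal_of_mem_orthogonalInUnitary {M : Matrix.unitaryGroup (Fin n) ℂ}
    (hM : M ∈ orthogonalInUnitary n) : M.1.det = ((M.1.map Complex.re).det : ℂ) := by
  have M_eq : M.1 = Complex.ofRealHom.mapMatrix (M.1.map Complex.re) := by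
    ext k l
    exact Complex.ext rfl (hM k l)
  conv_lhs => rw [M_eq, ← RingHom.map_det]
  rfl

theorem det_eq_one_or_neg_one_of_mem_orthogonalInUnitary {M : Matrix.unitaryGroup (Fin n) ℂ}
    (hM : M ∈ orthogonalInUnitary n) : M.1.det = 1 ∨ M.1.det = -1 := by
  have star_det_mul : star M.1.det * M.1.det = 1 := (Matrix.det_of_mem_unitary M.2).1
  rw [det_eq_ofReal_of_mem_orthogonalInUnitary hM, RCLike.star_def, Complex.conj_ofReal,
    ← det_eq_ofReal_of_mem_orthogonalInUnitary hM] at star_det_mul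
  exact mul_self_eq_one_iff.1 star_det_mul

theorem exists_mem_orthogonalInUnitary_det_eq_neg_one (n : ℕ) [NeZero n] :
    ∃ D ∈ orthogonalInUnitary n, D.1.det = -1 := by
  let d : Fin n → ℂ := Function.update 1 0 (-1)
  have star_mul_self : star (Matrix.diagonal d) * Matrix.diagonal d = 1 := by
    rw [Matrix.star_eq_conjTranspose, Matrix.diagonal_conjTranspose, Matrix.diagonal_mul_diagonal,
      ← Matrix.diagonal_one]
    congr 1
    ext i
    rcases eq_or_ne i 0 with rfl | hi <;> simp [d, *]
  refine ⟨⟨Matrix.diagonal d, Matrix.mem_unitaryGroup_iff'.2 star_mul_self⟩, fun i j => ?_, ?_⟩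
  · change (Matrix.diagonal d i j).im = 0
    rw [Matrix.diagonal_apply]
    split_ifs with hij
    · subst hij
      rcases eq_or_ne i 0 with rfl | hi <;> simp [d, *]
    · rfl
  · rw [Matrix.det_diagonal, Finset.prod_update_of_mem (Finset.mem_univ _)]
    simp

theorem relIndex_specialOrthogonalInUnitary (n : ℕ) [NeZero n] :
    (specialOrthogonalInUnitary n).relIndex (orthogonalInUnitary n) = 2 := by
  obtain ⟨D, hD, det_D⟩ := exists_mem_orthogonalInUnitary_det_eq_neg_one n
  refine Subgroup.relIndex_eq_two_iff_exists_notMem_and.2 ⟨D, hD, fun h => ?_, fun M hM => ?_⟩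
  · have := det_D.symm.trans h.2
    norm_num at this
  · refine (det_eq_one_or_neg_one_of_mem_orthogonalInUnitary hM).symm.imp
      (fun det_M => ⟨mul_mem hM hD, ?_⟩) (⟨hM, ·⟩)
    rw [Submonoid.coe_mul, Matrix.det_mul, det_M, det_D, neg_one_mul, neg_neg]

namespace OrientedLagrangian

theorem form_apply (X : OrientedLagrangian n) [Fact (Module.finrank ℝ X.C = n)]
    (w : Fin n → LinSpace ℂ n) :
    X.form w = X.o.volumeForm fun i => X.C.orthogonalProjectionOnto (w i) := rfl

theorem form_ne_zero (X : OrientedLagrangian n) : X.form ≠ 0 := fun h => by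
  have : Fact (Module.finrank ℝ X.C = n) := ⟨X.finrank_eq⟩
  let b := (stdOrthonormalBasis ℝ X.C).reindex (finCongr X.finrank_eq)
  have form_b : X.form (fun i => b i) = X.o.volumeForm b := by
    rw [form_apply]
    congr 1
    exact funext fun i => Submodule.orthogonalProjectionOnto_mem_subspace_eq_self _
  have abs_form_b := Orientation.abs_volumeForm_apply_of_orthonormal (E := X.C) X.o b
  rw [← form_b, h, Pi.zero_apply, abs_zero] at abs_form_b
  exact zero_ne_one abs_form_b

theorem eq_or_form_eq_neg {X Y : OrientedLagrangian n} (hC : X.C = Y.C) :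
    X = Y ∨ X.form = -Y.form := by
  obtain ⟨C, hX, o⟩ := X
  obtain ⟨D, hY, o'⟩ := Y
  obtain rfl : C = D := hC
  have finrank_C : Module.finrank ℝ C = n := finrank_eq ⟨C, hX, o⟩
  have : Fact (Module.finrank ℝ C = n) := ⟨finrank_C⟩
  refine (o.eq_or_eq_neg o' (by rw [Fintype.card_fin]; exact finrank_C.symm)).imp
    (fun h => by rw [h]) ?_
  rintro rfl
  have volumeForm_neg := Orientation.volumeForm_neg_orientation (E := C) o'
  exact funext fun w =>
    congrArg (fun f => f fun i => C.orthogonalProjectionOnto (w i)) volumeForm_neg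

theorem ext_of_form_eq {X Y : OrientedLagrangian n} (hC : X.C = Y.C) (h : X.form = Y.form) :
    X = Y :=
  (eq_or_form_eq_neg hC).resolve_right fun h' => Y.form_ne_zero (self_eq_neg.1 (h.symm.trans h'))

instance : T2Space (OrientedLagrangian n) :=
  T2Space.of_injective_continuous (f := fun X => (X.C.starProjection, X.form))
    (fun _ _ h => ext_of_form_eq (starProjection_injective (congrArg Prod.fst h))
      (congrArg Prod.snd h))
    continuous_induced_dom

theorem continuous_form (X : OrientedLagrangian n) : Continuous X.form := by
  have : Fact (Module.finrank ℝ X.C = n) := ⟨X.finrank_eq⟩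
  have continuous_volumeForm : Continuous fun w : Fin n → X.C =>
      Orientation.volumeForm (E := X.C) X.o w :=
    (AlternatingMap.mkContinuous (E := X.C) (Orientation.volumeForm (E := X.C) X.o) 1 fun w => by
      rw [one_mul]
      exact Orientation.abs_volumeForm_apply_le (E := X.C) X.o w).coe_continuous
  exact continuous_volumeForm.comp <| continuous_pi fun i =>
    (ContinuousLinearMap.continuous _).comp (continuous_apply i)

/-- `ℝⁿ ⊂ ℂⁿ` with an orientation. -/
def standard (o : Orientation ℝ (realSubspace n) (Fin n)) : OrientedLagrangian n where
  C := realSubspace n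
  lagrangian := isHalfLagrangian_realSubspace
  o := o

variable [NeZero n]

/-- The action of the twisted group on oriented Lagrangian subspaces. -/
noncomputable def image (g : twistedGroup ℂ n) (X : OrientedLagrangian n) :
    OrientedLagrangian n where
  C := imageUnder g X.C
  lagrangian := X.lagrangian.imageUnder g
  o := Orientation.map (Fin n) (LinearIsometryEquiv.submoduleMap X.C g.1).toLinearEquiv X.o

theorem form_image (g : twistedGroup ℂ n) (X : OrientedLagrangian n) (w : Fin n → LinSpace ℂ n) :
    (image g X).form w = X.form fun i => g⁻¹.1 (w i) := by
  have : Fact (Module.finrank ℝ X.C = n) := ⟨X.finrank_eq⟩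
  have : Fact (Module.finrank ℝ (image g X).C = n) := ⟨(image g X).finrank_eq⟩
  have : Fact (Module.finrank ℝ (imageUnder g X.C) = n) := this
  let φ : X.C ≃ₗᵢ[ℝ] imageUnder g X.C := LinearIsometryEquiv.submoduleMap X.C g.1
  have symm_comp_projection : (fun i => X.C.orthogonalProjectionOnto (g⁻¹.1 (w i))) =
      φ.symm ∘ fun i => (imageUnder g X.C).orthogonalProjectionOnto (w i) :=
    funext fun i => Eq.symm <| φ.symm_apply_eq.2 <| Subtype.ext <|
      congrArg (fun f => f (w i)) (starProjection_imageUnder g X.C)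
  have volumeForm_map := Orientation.volumeForm_map (E := X.C) (F := imageUnder g X.C) X.o φ
    fun i => (imageUnder g X.C).orthogonalProjectionOnto (w i)
  rw [← symm_comp_projection] at volumeForm_map
  exact volumeForm_map

theorem image_mul (g h : twistedGroup ℂ n) (X : OrientedLagrangian n) :
    image (g * h) X = image g (image h X) := by
  refine ext_of_form_eq (imageUnder_mul g h X.C) (funext fun w => ?_)
  simp only [form_image, mul_inv_rev]
  rfl

theorem image_one (X : OrientedLagrangian n) : image 1 X = X := by
  refine ext_of_form_eq (imageUnder_one X.C) (funext fun w => ?_)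
  simp only [form_image, inv_one]
  rfl

theorem image_eq_image_iff {g h : twistedGroup ℂ n} {X : OrientedLagrangian n} :
    image g X = image h X ↔ image (g⁻¹ * h) X = X := by
  rw [image_mul]
  constructor <;> intro e
  · rw [← e, ← image_mul, inv_mul_cancel, image_one]
  · rw [← congrArg (image g) e, ← image_mul, mul_inv_cancel, image_one]

theorem continuous_image (X : OrientedLagrangian n) : Continuous (image · X) :=
  continuous_induced_rng.2 <| (continuous_starProjection_imageUnder X.C).prodMk <|
    continuous_pi fun w => by
      simp_rw [form_image]
      exact X.continuous_form.comp <| continuous_pi fun i =>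
        (ContinuousLinearMap.apply ℝ _ (w i)).continuous.comp continuous_twistedCLM_inv

omit [NeZero n] in
theorem exists_form_standard_columns_eq (o : Orientation ℝ (realSubspace n) (Fin n)) :
    ∃ c : ℝ, c ≠ 0 ∧ ∀ N : Matrix (Fin n) (Fin n) ℝ,
      (standard o).form (fun l => WithLp.toLp 2 fun k => (N k l : ℂ)) = c * N.det := by
  let b : Module.Basis (Fin n) ℝ (realSubspace n) := .ofEquivFun (realSubspaceEquiv n)
  obtain ⟨c, hc⟩ : ∃ c : ℝ, Orientation.volumeForm (E := realSubspace n) o = c • b.det :=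
    ⟨_, AlternatingMap.eq_smul_basis_det b (Orientation.volumeForm (E := realSubspace n) o)⟩
  have form_eq (w : Fin n → LinSpace ℂ n) : (standard o).form w =
      c * b.det fun i => (realSubspace n).orthogonalProjectionOnto (w i) :=
    congrArg (fun f => f fun i => (realSubspace n).orthogonalProjectionOnto (w i)) hc
  refine ⟨c, fun h => (standard o).form_ne_zero (funext fun w => ?_), fun N => ?_⟩
  · rw [form_eq, h, zero_mul, Pi.zero_apply]
  · rw [form_eq, Module.Basis.det_apply]
    congr 2
    ext k l
    have column_mem : (WithLp.toLp 2 fun k => (N k l : ℂ)) ∈ realSubspace n :=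
      fun k => Complex.ofReal_im _
    rw [Module.Basis.toMatrix_apply,
      Submodule.orthogonalProjectionOnto_mem_subspace_eq_self ⟨_, column_mem⟩]
    rfl

theorem image_standard_eq_iff (o : Orientation ℝ (realSubspace n) (Fin n))
    {M : Matrix.unitaryGroup (Fin n) ℂ} :
    image (unitaryEquiv n M) (standard o) = standard o ↔ M ∈ specialOrthogonalInUnitary n := by
  by_cases hM : M ∈ orthogonalInUnitary n
  swap
  · exact iff_of_false (fun h => hM (imageUnder_realSubspace_eq_iff.1 (congrArg C h)))
      fun h => hM h.1
  obtain ⟨c, c_ne_zero, form_columns⟩ := exists_form_standard_columns_eq o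
  let columns (l : Fin n) : LinSpace ℂ n := unitaryHom M (PiLp.single 2 l 1)
  have form_standard : (standard o).form columns = c * (M.1.map Complex.re).det := by
    rw [← form_columns]
    congr 1
    ext l k
    rw [unitaryHom_single]
    exact Complex.ext rfl (hM k l)
  have form_image_columns : (image (unitaryEquiv n M) (standard o)).form columns = c := by
    rw [form_image, ← mul_one c, ← Matrix.det_one (n := Fin n), ← form_columns]
    congr 1
    funext l
    refine ((unitaryEquiv n M).1.symm_apply_apply _).trans (PiLp.ext fun k => ?_)
    change (PiLp.single 2 l 1 : LinSpace ℂ n) k = ((1 : Matrix (Fin n) (Fin n) ℝ) k l : ℂ)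
    rw [PiLp.single_apply, Matrix.one_apply]
    split_ifs <;> simp
  have mem_iff : M ∈ specialOrthogonalInUnitary n ↔ (M.1.map Complex.re).det = 1 := by
    rw [← Complex.ofReal_eq_one, ← det_eq_ofReal_of_mem_orthogonalInUnitary hM]
    exact and_iff_right hM
  rw [mem_iff]
  constructor
  · intro h
    rw [h, form_standard] at form_image_columns
    exact (mul_eq_left₀ c_ne_zero).1 form_image_columns
  · refine fun det_eq => (eq_or_form_eq_neg (imageUnder_realSubspace_eq_iff.2 hM)).resolve_right
      fun h => c_ne_zero ?_
    rwa [h, Pi.neg_apply, form_standard, det_eq, mul_one, neg_eq_self] at form_image_columns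

theorem image_standard_surjective (o : Orientation ℝ (realSubspace n) (Fin n)) :
    Function.Surjective (image · (standard o)) := by
  intro X
  obtain ⟨g, hg⟩ := exists_imageUnder_realSubspace_eq X.lagrangian
  refine (eq_or_form_eq_neg (X := image g (standard o)) hg).elim (fun h => ⟨g, h⟩)
    fun form_neg => ?_
  obtain ⟨D, hD, det_D⟩ := exists_mem_orthogonalInUnitary_det_eq_neg_one n
  have image_D_ne : image (unitaryEquiv n D) (standard o) ≠ standard o := fun h => by
    have := det_D.symm.trans ((image_standard_eq_iff o).1 h).2
    norm_num at this
  have image_D_C := imageUnder_realSubspace_eq_iff.2 hD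
  have form_image_D := (eq_or_form_eq_neg image_D_C).resolve_left image_D_ne
  refine ⟨g * unitaryEquiv n D, (image_mul g _ _).trans (ext_of_form_eq ?_ ?_)⟩
  · exact (congrArg (imageUnder g) image_D_C).trans hg
  · rw [← neg_eq_iff_eq_neg.2 form_neg]
    funext w
    rw [form_image, form_image_D, Pi.neg_apply, Pi.neg_apply, form_image]

end OrientedLagrangian

theorem exists_orientedLagrangian_homeomorph [NeZero n]
    (o : Orientation ℝ (realSubspace n) (Fin n)) :
    ∃ h : (twistedGroup ℂ n ⧸
        (specialOrthogonalInUnitary n).map (unitaryEquiv n).toMonoidHom) ≃ₜ OrientedLagrangian n,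
      ∀ g : twistedGroup ℂ n, ∃ f : realSubspace n ≃ₗ[ℝ] (h g).C,
        (∀ x, (f x : LinSpace ℂ n) = g.1 x) ∧ (h g).o = Orientation.map (Fin n) f o := by
  obtain ⟨h, hh⟩ := exists_quotient_homeomorph
    (OrientedLagrangian.continuous_image (.standard o))
    (OrientedLagrangian.image_standard_surjective o) (K :=
      (specialOrthogonalInUnitary n).map (unitaryEquiv n).toMonoidHom) fun g h => by
    obtain ⟨M, hM⟩ := (unitaryEquiv n).surjective (g⁻¹ * h)
    rw [OrientedLagrangian.image_eq_image_iff, ← hM, mem_map_unitaryEquiv,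
      OrientedLagrangian.image_standard_eq_iff]
  refine ⟨h, fun g => ?_⟩
  rw [hh g]
  exact ⟨(LinearIsometryEquiv.submoduleMap (realSubspace n) g.1).toLinearEquiv,
    fun x => rfl, rfl⟩

end Oriented

/-! ### Quaternions and their rotations -/

section QuaternionRotations

/-- The quaternion `i`, as the image of the complex number `i`. -/
abbrev quatI : ℍ[ℝ] := ((Complex.I : ℂ) : ℍ[ℝ])

@[simp] theorem quatJ_re : quatJ.re = 0 := rfl
@[simp] theorem quatJ_imI : quatJ.imI = 0 := rfl
@[simp] theorem quatJ_imJ : quatJ.imJ = 1 := rfl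
@[simp] theorem quatJ_imK : quatJ.imK = 0 := rfl

theorem quatI_mul_quatI : quatI * quatI = -1 := by ext <;> simp
theorem quatJ_mul_quatJ : quatJ * quatJ = -1 := by ext <;> simp
theorem quatJ_mul_quatI : quatJ * quatI = -(quatI * quatJ) := by ext <;> simp
theorem star_quatI : star quatI = -quatI := by ext <;> simp
theorem star_quatJ : star quatJ = -quatJ := by ext <;> simp

theorem mem_imPart_quaternion {x : ℍ[ℝ]} : x ∈ imPart ℍ[ℝ] ↔ x.re = 0 := by
  rw [mem_imPart, Quaternion.inner_def]
  simp

theorem mem_unitary_iff_norm_eq_one {x : ℍ[ℝ]} : x ∈ unitary ℍ[ℝ] ↔ ‖x‖ = 1 := by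
  refine ⟨CStarRing.norm_of_mem_unitary, fun hx => Unitary.mem_iff.2 ?_⟩
  simp [Quaternion.star_mul_self, Quaternion.self_mul_star, Quaternion.normSq_eq_norm_mul_self, hx]

theorem inv_norm_smul_mem_unitary {q : ℍ[ℝ]} (hq : q ≠ 0) : ‖q‖⁻¹ • q ∈ unitary ℍ[ℝ] :=
  mem_unitary_iff_norm_eq_one.2 (norm_smul_inv_norm (𝕜 := ℝ) hq)

theorem quatI_mem_unitary : quatI ∈ unitary ℍ[ℝ] := by
  rw [Unitary.mem_iff, star_quatI, neg_mul, mul_neg, quatI_mul_quatI, neg_neg]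
  exact ⟨rfl, rfl⟩

theorem mul_self_eq_neg_one {w : ℍ[ℝ]} (hw : w ∈ imPart ℍ[ℝ]) (hn : ‖w‖ = 1) : w * w = -1 := by
  rw [← sq, Quaternion.sq_eq_neg_normSq.2 (mem_imPart_quaternion.1 hw),
    Quaternion.normSq_eq_norm_mul_self, hn]
  simp

theorem abs_det_of_norm_map {E : Type*} [NormedAddCommGroup E] [InnerProductSpace ℝ E]
    [FiniteDimensional ℝ E] {f : E →ₗ[ℝ] E} (hf : ∀ x, ‖f x‖ = ‖x‖) : |LinearMap.det f| = 1 := by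
  rw [← LinearMap.normDet_eq_abs_det]
  exact LinearIsometry.normDet_eq_one ⟨f, hf⟩

theorem exists_sq_eq (β : UnitQuaternions) : ∃ γ : UnitQuaternions, γ * γ = β := by
  by_cases h : 1 + (β : ℍ[ℝ]) = 0
  · exact ⟨⟨quatI, quatI_mem_unitary⟩,
      Subtype.ext (quatI_mul_quatI.trans (eq_neg_of_add_eq_zero_right h).symm)⟩
  -- `(1 + β)² = (1 + β) (1 + β)* β = |1 + β|² β`, so a square root is the direction of `1 + β`
  · have hn : ‖1 + (β : ℍ[ℝ])‖ ≠ 0 := norm_ne_zero_iff.2 h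
    have sq_one_add : (1 + (β : ℍ[ℝ])) * (1 + (β : ℍ[ℝ])) =
        (‖1 + (β : ℍ[ℝ])‖ * ‖1 + (β : ℍ[ℝ])‖) • (β : ℍ[ℝ]) := by
      rw [← Quaternion.normSq_eq_norm_mul_self, ← Quaternion.coe_mul_eq_smul,
        ← Quaternion.self_mul_star, mul_assoc, star_add, star_one, add_mul 1 (star (β : ℍ[ℝ])),
        one_mul, Unitary.coe_star_mul_self, add_comm (β : ℍ[ℝ])]
    refine ⟨⟨_, inv_norm_smul_mem_unitary h⟩, Subtype.ext ?_⟩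
    change (_ • _) * (_ • _) = (β : ℍ[ℝ])
    rw [smul_mul_smul_comm, sq_one_add, smul_smul, mul_mul_mul_comm, inv_mul_cancel₀ hn, one_mul,
      one_smul]

theorem det_mulLeft_unitQuaternion (β : UnitQuaternions) :
    LinearMap.det (LinearMap.mulLeft ℝ (β : ℍ[ℝ])) = 1 := by
  obtain ⟨γ, rfl⟩ := exists_sq_eq β
  have abs_det : |LinearMap.det (LinearMap.mulLeft ℝ (γ : ℍ[ℝ]))| = 1 :=
    abs_det_of_norm_map fun x => by simp [CStarRing.norm_coe_unitary]
  rw [Submonoid.coe_mul, LinearMap.mulLeft_mul, LinearMap.det_comp, ← abs_mul_abs_self, abs_det,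
    one_mul]

theorem det_mulRight_unitQuaternion (β : UnitQuaternions) :
    LinearMap.det (LinearMap.mulRight ℝ (β : ℍ[ℝ])) = 1 := by
  let s : ℍ[ℝ] ≃ₗ[ℝ] ℍ[ℝ] := { starAddEquiv with map_smul' := Quaternion.star_smul }
  have conj_star : LinearMap.mulRight ℝ (β : ℍ[ℝ]) = (s : ℍ[ℝ] →ₗ[ℝ] ℍ[ℝ]) ∘ₗ
      LinearMap.mulLeft ℝ ((star β : UnitQuaternions) : ℍ[ℝ]) ∘ₗ (s.symm : ℍ[ℝ] →ₗ[ℝ] ℍ[ℝ]) := by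
    ext1 x
    change x * (β : ℍ[ℝ]) = star (star (β : ℍ[ℝ]) * star x)
    rw [star_mul, star_star, star_star]
  rw [conj_star, LinearMap.det_conj, det_mulLeft_unitQuaternion]

/-- The rotation `x ↦ p x q*` of `ℍ` associated with a pair `(p, q)` of unit quaternions. -/
noncomputable def quatRotation : UnitQuaternions × UnitQuaternions →* (ℍ[ℝ] ≃ₗᵢ[ℝ] ℍ[ℝ]) where
  toFun p :=
    { toFun := fun x => p.1 * x * star (p.2 : ℍ[ℝ])
      invFun := fun x => star (p.1 : ℍ[ℝ]) * x * p.2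
      map_add' := fun x y => by rw [mul_add, add_mul]
      map_smul' := fun c x => by
        rw [mul_smul_comm, smul_mul_assoc, RingHom.id_apply]
      left_inv := fun x => by simp [mul_assoc, ← mul_assoc (star _) (p.1 : ℍ[ℝ])]
      right_inv := fun x => by simp [mul_assoc, ← mul_assoc (p.1 : ℍ[ℝ]) (star _)]
      norm_map' := fun x => by
        change ‖(p.1 : ℍ[ℝ]) * x * star (p.2 : ℍ[ℝ])‖ = ‖x‖
        simp [CStarRing.norm_coe_unitary] }
  map_one' := by
    ext1 x
    change 1 * x * star 1 = x
    rw [one_mul, star_one, mul_one]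
  map_mul' p q := by
    ext1 x
    change (p.1 * q.1 : ℍ[ℝ]) * x * star (p.2 * q.2 : ℍ[ℝ]) =
      p.1 * (q.1 * x * star (q.2 : ℍ[ℝ])) * star (p.2 : ℍ[ℝ])
    simp only [star_mul, mul_assoc]

theorem quatRotation_apply (p : UnitQuaternions × UnitQuaternions) (x : ℍ[ℝ]) :
    quatRotation p x = p.1 * x * star (p.2 : ℍ[ℝ]) := rfl

theorem det_quatRotation (p : UnitQuaternions × UnitQuaternions) :
    LinearMap.det ((quatRotation p).toLinearEquiv : ℍ[ℝ] →ₗ[ℝ] ℍ[ℝ]) = 1 := by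
  have factor : ((quatRotation p).toLinearEquiv : ℍ[ℝ] →ₗ[ℝ] ℍ[ℝ]) =
      LinearMap.mulRight ℝ ((star p.2 : UnitQuaternions) : ℍ[ℝ]) ∘ₗ
        LinearMap.mulLeft ℝ (p.1 : ℍ[ℝ]) := rfl
  rw [factor, LinearMap.det_comp, det_mulRight_unitQuaternion, det_mulLeft_unitQuaternion, one_mul]

/-- The element `1 - w u` satisfies `w (1 - w u) = w + u = (1 - w u) u`. -/
theorem exists_conj_eq_of_ne_neg {u w : ℍ[ℝ]} (hu : u * u = -1) (hw : w * w = -1) (h : w ≠ -u) :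
    ∃ β : UnitQuaternions, (β : ℍ[ℝ]) * u * star (β : ℍ[ℝ]) = w ∧
      ∀ z, Commute (w * u) z → Commute (β : ℍ[ℝ]) z := by
  have hq : 1 - w * u ≠ 0 := fun h0 => h <| by
    linear_combination (norm := noncomm_ring) h0 * u + w * hu
  let β : UnitQuaternions := ⟨_, inv_norm_smul_mem_unitary hq⟩
  have intertwines : (β : ℍ[ℝ]) * u = w * β := by
    change _ • (1 - w * u) * u = w * _ • (1 - w * u)
    rw [smul_mul_assoc, mul_smul_comm]
    congr 1
    linear_combination (norm := noncomm_ring) hw * u - w * hu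
  refine ⟨β, ?_, fun z hz => ((Commute.one_left z).sub_left hz).smul_left _⟩
  rw [intertwines, mul_assoc, Unitary.mul_star_self_of_mem β.2, mul_one]

theorem exists_conj_quatI_eq {w : ℍ[ℝ]} (hw : w * w = -1) :
    ∃ β : UnitQuaternions, (β : ℍ[ℝ]) * quatI * star (β : ℍ[ℝ]) = w := by
  by_cases h : w = -quatI
  · refine ⟨quaternionJ, ?_⟩
    change quatJ * quatI * star quatJ = w
    rw [h, quatJ_mul_quatI, star_quatJ, neg_mul_neg, mul_assoc, quatJ_mul_quatJ, mul_neg_one]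
  · exact (exists_conj_eq_of_ne_neg quatI_mul_quatI hw h).imp fun _ hβ => hβ.1

theorem exists_commute_quatI_conj_quatJ_eq {w : ℍ[ℝ]} (hw : w * w = -1)
    (hwi : w * quatI = -(quatI * w)) :
    ∃ β : UnitQuaternions, Commute (β : ℍ[ℝ]) quatI ∧
      (β : ℍ[ℝ]) * quatJ * star (β : ℍ[ℝ]) = w := by
  by_cases h : w = -quatJ
  · refine ⟨⟨quatI, quatI_mem_unitary⟩, Commute.refl _, ?_⟩
    change quatI * quatJ * star quatI = w
    rw [h, star_quatI, mul_neg, mul_assoc, quatJ_mul_quatI, mul_neg, ← mul_assoc, quatI_mul_quatI,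
      neg_one_mul, neg_neg]
  · obtain ⟨β, hβ, commutes⟩ := exists_conj_eq_of_ne_neg quatJ_mul_quatJ hw h
    refine ⟨β, commutes quatI ?_, hβ⟩
    rw [commute_iff_eq, mul_assoc, quatJ_mul_quatI, mul_neg, ← mul_assoc, hwi, neg_mul, neg_neg,
      mul_assoc]

theorem quaternion_algHom_ext {f g : ℍ[ℝ] →ₐ[ℝ] ℍ[ℝ]} (hi : f quatI = g quatI)
    (hj : f quatJ = g quatJ) : f = g := by
  have quatI_eq : (QuaternionAlgebra.Basis.self ℝ).i = quatI := by ext <;> simp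
  exact Quaternion.hom_ext (by rw [quatI_eq, hi]) hj

/-- The Skolem-Noether theorem for `ℍ`: rotate `i` to its image first, then `j` without moving
`i`. -/
theorem exists_conj_eq_algHom (θ : ℍ[ℝ] →ₐ[ℝ] ℍ[ℝ]) :
    ∃ β : UnitQuaternions, ∀ x, θ x = (β : ℍ[ℝ]) * x * star (β : ℍ[ℝ]) := by
  have sq_map {x : ℍ[ℝ]} (hx : x * x = -1) : θ x * θ x = -1 := by
    rw [← map_mul, hx, map_neg, map_one]
  obtain ⟨β, hβ⟩ := exists_conj_quatI_eq (sq_map quatI_mul_quatI)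
  let c := Unitary.conjStarAlgAut ℝ ℍ[ℝ]
  have c_quatI : c β quatI = θ quatI := hβ
  have c_symm_quatI : (c β).symm (θ quatI) = quatI := by
    rw [← c_quatI, StarAlgEquiv.symm_apply_apply]
  obtain ⟨γ, hγi, hγj⟩ := exists_commute_quatI_conj_quatJ_eq (w := (c β).symm (θ quatJ))
    (by rw [← map_mul, sq_map quatJ_mul_quatJ, map_neg, map_one])
    (by
      rw [← c_symm_quatI, ← map_mul, ← map_mul, ← map_mul, ← map_mul, quatJ_mul_quatI, map_neg,
        map_neg])
  have c_mul (x : ℍ[ℝ]) : c (β * γ) x = c β (c γ x) := by rw [map_mul]; rfl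
  refine ⟨β * γ, fun x => ?_⟩
  suffices θ = ((c (β * γ)).toAlgEquiv : ℍ[ℝ] →ₐ[ℝ] ℍ[ℝ]) from DFunLike.congr_fun this x
  refine quaternion_algHom_ext ?_ ?_
  · change θ quatI = c (β * γ) quatI
    have c_quatI' : c γ quatI = quatI := by
      rw [Unitary.conjStarAlgAut_apply, hγi.eq, mul_assoc, Unitary.mul_star_self_of_mem γ.2,
        mul_one]
    rw [c_mul, c_quatI', c_quatI]
  · change θ quatJ = c (β * γ) quatJ
    rw [c_mul, Unitary.conjStarAlgAut_apply γ, hγj, StarAlgEquiv.apply_symm_apply]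

theorem eq_one_or_neg_one_of_commute {β : UnitQuaternions}
    (h : ∀ x, Commute (β : ℍ[ℝ]) x) : (β : ℍ[ℝ]) = 1 ∨ (β : ℍ[ℝ]) = -1 := by
  have eq_re : (β : ℍ[ℝ]) = ((β : ℍ[ℝ]).re : ℍ[ℝ]) := by
    have hi := congrArg (fun q : ℍ[ℝ] => (q.imJ, q.imK)) (h quatI).eq
    have hj := congrArg (fun q : ℍ[ℝ] => q.imK) (h quatJ).eq
    simp at hi hj
    ext <;> simp <;> linarith
  have norm_eq : ‖(β : ℍ[ℝ])‖ = 1 := CStarRing.norm_coe_unitary β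
  rw [eq_re, Quaternion.norm_coe, Real.norm_eq_abs] at norm_eq
  rcases (abs_eq zero_le_one).1 norm_eq with h | h <;> rw [eq_re, h] <;> simp

end QuaternionRotations

/-! ### The group `Sp(n) Sp(1)` -/

section QuaternionicGroup

variable {n : ℕ}

theorem rightMul_rightMul {F : Type} [NormedRing F] (v : LinSpace F n) (x y : F) :
    rightMul (rightMul v x) y = rightMul v (x * y) := by
  ext k : 1
  exact mul_assoc _ _ _

/-- Right multiplication of `ℍⁿ` by the conjugate of a unit quaternion; the conjugate makes it a
left action. -/
noncomputable def rightUnitHom : UnitQuaternions →* (LinSpace ℍ[ℝ] n ≃ₗᵢ[ℝ] LinSpace ℍ[ℝ] n) where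
  toFun β :=
    { toFun := fun v => rightMul v (star (β : ℍ[ℝ]))
      invFun := fun v => rightMul v β
      map_add' := fun v w => add_rightMul v w _
      map_smul' := fun c v => smul_rightMul c v _
      left_inv := fun v => by
        simp only [rightMul_rightMul, Unitary.coe_star_mul_self, rightMul_one]
      right_inv := fun v => by
        simp only [rightMul_rightMul, Unitary.mul_star_self_of_mem β.2, rightMul_one]
      norm_map' := fun v => by
        change ‖rightMul v (star (β : ℍ[ℝ]))‖ = ‖v‖
        rw [norm_rightMul, norm_star, CStarRing.norm_coe_unitary, mul_one] }
  map_one' := by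
    ext1 v
    change rightMul v (star 1) = v
    rw [star_one, rightMul_one]
  map_mul' β γ := by
    ext1 v
    change rightMul v (star (β * γ : ℍ[ℝ])) = rightMul (rightMul v _) _
    rw [star_mul, rightMul_rightMul]

theorem rightUnitHom_apply (β : UnitQuaternions) (v : LinSpace ℍ[ℝ] n) :
    rightUnitHom β v = rightMul v (star (β : ℍ[ℝ])) := rfl

theorem commute_unitaryHom_rightUnitHom (M : SpGroup n) (β : UnitQuaternions) :
    Commute (unitaryHom M) (rightUnitHom β) :=
  LinearIsometryEquiv.ext fun v => unitaryHom_rightMul M v _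

theorem unitaryHom_rightUnitHom_rightMul (p : SpGroup n × UnitQuaternions) (v : LinSpace ℍ[ℝ] n)
    (x : ℍ[ℝ]) : unitaryHom p.1 (rightUnitHom p.2 (rightMul v x)) =
      rightMul (unitaryHom p.1 (rightUnitHom p.2 v)) (quatRotation (p.2, p.2) x) := by
  rw [← unitaryHom_rightMul, rightUnitHom_apply, rightUnitHom_apply, rightMul_rightMul,
    rightMul_rightMul, quatRotation_apply, ← mul_assoc, ← mul_assoc, Unitary.coe_star_mul_self,
    one_mul]

/-- The homomorphism `(α, β) ↦ (v ↦ α v β*)`. -/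
noncomputable def spHom : SpGroup n × UnitQuaternions →* twistedGroup ℍ[ℝ] n :=
  (unitaryHom.noncommCoprod rightUnitHom commute_unitaryHom_rightUnitHom).codRestrict _ fun p =>
    ⟨quatRotation (p.2, p.2), det_quatRotation _, unitaryHom_rightUnitHom_rightMul p⟩

theorem spHom_apply (p : SpGroup n × UnitQuaternions) (v : LinSpace ℍ[ℝ] n) :
    (spHom p).1 v = rightMul (unitaryHom p.1 v) (star (p.2 : ℍ[ℝ])) :=
  unitaryHom_rightMul p.1 v _

theorem twist_spHom [NeZero n] (p : SpGroup n × UnitQuaternions) :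
    twist (spHom p) = quatRotation (p.2, p.2) :=
  LinearIsometryEquiv.ext fun x =>
    twist_apply_eq_of_forall fun v => unitaryHom_rightUnitHom_rightMul p v x

theorem continuous_spHom :
    Continuous (spHom : SpGroup n × UnitQuaternions →* twistedGroup ℍ[ℝ] n) := by
  refine continuous_twistedGroup_iff.2 fun v => ?_
  simp_rw [spHom_apply]
  refine continuous_rightMul.comp (.prodMk ?_ ?_)
  · have continuous_matrix : Continuous fun p : SpGroup n × UnitQuaternions =>
        (p.1 : Matrix (Fin n) (Fin n) ℍ[ℝ]) :=
      (continuous_fst (X := SpGroup n) (Y := UnitQuaternions)).subtype_val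
    exact continuous_unitaryHom_apply (X := SpGroup n × UnitQuaternions) (f := fun p => p.1)
      (fun k l => (continuous_apply_apply k l).comp continuous_matrix) v
  · exact continuous_star.comp (continuous_subtype_val.comp continuous_snd)

theorem exists_conj_eq_twist [NeZero n] (g : twistedGroup ℍ[ℝ] n) :
    ∃ β : UnitQuaternions, twist g = quatRotation (β, β) := by
  let θ : ℍ[ℝ] →ₐ[ℝ] ℍ[ℝ] := AlgHom.ofLinearMap ((twist g).toLinearEquiv : ℍ[ℝ] →ₗ[ℝ] ℍ[ℝ])
    (twist_apply_one g) fun x y => twist_apply_eq_of_forall fun v => by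
      rw [← rightMul_rightMul, apply_rightMul, apply_rightMul, rightMul_rightMul]
      rfl
  exact (exists_conj_eq_algHom θ).imp fun _ hβ => LinearIsometryEquiv.ext hβ

theorem spHom_surjective [NeZero n] :
    Function.Surjective (spHom : SpGroup n × UnitQuaternions →* twistedGroup ℍ[ℝ] n) := by
  intro g
  obtain ⟨β, hβ⟩ := exists_conj_eq_twist g
  have twist_eq_one : twist (g * (spHom (1, β))⁻¹) = 1 := by
    rw [map_mul, map_inv, twist_spHom, hβ, mul_inv_cancel]
  obtain ⟨M, hM⟩ := exists_unitaryHom_eq (φ := (g * (spHom (1, β))⁻¹).1) fun v x => by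
    rw [apply_rightMul, twist_eq_one]
    rfl
  have spHom_eq : spHom (M, 1) = g * (spHom (1, β))⁻¹ := Subtype.ext <|
    LinearIsometryEquiv.ext fun v => by
      rw [spHom_apply, hM]
      simp [rightMul_one]
  refine ⟨(M, 1) * (1, β), ?_⟩
  rw [map_mul, spHom_eq, inv_mul_cancel_right]

theorem mem_ker_spHom [NeZero n] (p : SpGroup n × UnitQuaternions) :
    p ∈ (spHom (n := n)).ker ↔
      p = 1 ∨ ((p.1 : Matrix (Fin n) (Fin n) ℍ[ℝ]) = -1 ∧ (p.2 : ℍ[ℝ]) = -1) := by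
  have mem_ker_iff : p ∈ (spHom (n := n)).ker ↔
      ∀ v : LinSpace ℍ[ℝ] n, rightMul (unitaryHom p.1 v) (star (p.2 : ℍ[ℝ])) = v := by
    rw [MonoidHom.mem_ker, Subtype.ext_iff, LinearIsometryEquiv.ext_iff]
    simp_rw [spHom_apply]
    rfl
  constructor
  · intro hp
    have conj_eq_one : quatRotation (p.2, p.2) = 1 := by
      rw [← twist_spHom, MonoidHom.mem_ker.1 hp, map_one]
    have commutes (x : ℍ[ℝ]) : Commute (p.2 : ℍ[ℝ]) x := by
      have h : (p.2 : ℍ[ℝ]) * x * star (p.2 : ℍ[ℝ]) = x := DFunLike.congr_fun conj_eq_one x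
      rw [commute_iff_eq, ← mul_one ((p.2 : ℍ[ℝ]) * x), ← Unitary.coe_star_mul_self p.2,
        ← mul_assoc, h]
    have entry (k l : Fin n) : p.1.1 k l = if k = l then (p.2 : ℍ[ℝ]) else 0 := by
      have h := congrArg (fun v => rightMul v (p.2 : ℍ[ℝ]) k)
        (mem_ker_iff.1 hp (PiLp.single 2 l 1))
      rw [rightMul_rightMul, Unitary.coe_star_mul_self, rightMul_one, unitaryHom_single] at h
      simpa using h
    refine (eq_one_or_neg_one_of_commute commutes).imp (fun h => ?_) fun h => ⟨?_, h⟩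
    · refine Prod.ext (Subtype.ext (Matrix.ext fun k l => ?_)) (Subtype.ext h)
      rw [entry, h]
      exact Matrix.one_apply.symm
    · ext1 k l
      rw [entry, h, Matrix.neg_apply, Matrix.one_apply, neg_ite, neg_zero]
  · rintro (rfl | ⟨hM, hβ⟩)
    · exact one_mem _
    · refine mem_ker_iff.2 fun v => ?_
      ext1 k
      rw [rightMul_apply, unitaryHom_apply, hM, hβ]
      simp [Matrix.one_apply]

end QuaternionicGroup

/-! ### Lagrangian subspaces of `ℍⁿ` -/

theorem exists_norm_eq_one_forall_inner_eq_zero {𝕜 E ι : Type*} [RCLike 𝕜] [NormedAddCommGroup E]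
    [InnerProductSpace 𝕜 E] [Fintype ι] {C : Submodule 𝕜 E} [FiniteDimensional 𝕜 C] (v : ι → E)
    (h : Fintype.card ι < Module.finrank 𝕜 C) :
    ∃ x ∈ C, ‖x‖ = 1 ∧ ∀ i, inner 𝕜 (v i) x = 0 := by
  let f : C →ₗ[𝕜] ι → 𝕜 := LinearMap.pi fun i => innerₛₗ 𝕜 (v i) ∘ₗ C.subtype
  have ker_ne_bot : f.ker ≠ ⊥ :=
    LinearMap.ker_ne_bot_of_finrank_lt (by rwa [Module.finrank_fintype_fun_eq_card])
  obtain ⟨x, hx, hx0⟩ := Submodule.exists_mem_ne_zero_of_ne_bot ker_ne_bot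
  refine ⟨(‖x‖⁻¹ : 𝕜) • (x : E), C.smul_mem _ x.2,
    norm_smul_inv_norm (𝕜 := 𝕜) (Submodule.coe_eq_zero.not.2 hx0), fun i => ?_⟩
  rw [inner_smul_right, show inner 𝕜 (v i) (x : E) = 0 from congrFun hx i, mul_zero]

theorem quatI_mem_imPart : quatI ∈ imPart ℍ[ℝ] := mem_imPart_quaternion.2 (by simp)

theorem mem_range_ofComplex {x : ℍ[ℝ]} :
    x ∈ Quaternion.ofComplex.range ↔ x.imJ = 0 ∧ x.imK = 0 := by
  constructor
  · rintro ⟨z, rfl⟩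
    exact ⟨rfl, rfl⟩
  · rintro ⟨hJ, hK⟩
    exact ⟨⟨x.re, x.imI⟩, QuaternionAlgebra.ext rfl rfl hJ.symm hK.symm⟩

theorem mem_range_ofComplex_iff_commute {x : ℍ[ℝ]} :
    x ∈ Quaternion.ofComplex.range ↔ Commute x quatI := by
  rw [mem_range_ofComplex, commute_iff_eq]
  constructor
  · rintro ⟨hJ, hK⟩
    ext <;> simp [hJ, hK]
  · intro h
    have hJ := congrArg (fun q : ℍ[ℝ] => q.imK) h
    have hK := congrArg (fun q : ℍ[ℝ] => q.imJ) h
    simp at hJ hK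
    constructor <;> linarith

section QuaternionicLagrangian

variable {n : ℕ}

theorem mem_complexSubspace {v : LinSpace ℍ[ℝ] n} :
    v ∈ complexSubspace n ↔ ∀ k, v k ∈ Quaternion.ofComplex.range :=
  forall_congr' fun _ => mem_range_ofComplex.symm

/-- The coordinates of `ℂⁿ ⊂ ℍⁿ`. -/
noncomputable def complexSubspaceEquiv (n : ℕ) : complexSubspace n ≃ₗ[ℝ] (Fin n → ℂ) where
  toFun v k := ⟨(v.1 k).re, (v.1 k).imI⟩
  map_add' v w := rfl
  map_smul' c v := funext fun k => Complex.ext (by simp) (by simp)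
  invFun x := ⟨WithLp.toLp 2 fun k => (x k : ℍ[ℝ]), fun k => ⟨rfl, rfl⟩⟩
  left_inv v := Subtype.ext <| PiLp.ext fun k =>
    QuaternionAlgebra.ext rfl rfl (v.2 k).1.symm (v.2 k).2.symm
  right_inv x := rfl

theorem finrank_complexSubspace : Module.finrank ℝ (complexSubspace n) = n * 2 := by
  rw [(complexSubspaceEquiv n).finrank_eq]
  simp [Module.finrank_pi_fintype]

theorem range_ofComplex_le_stableMultipliers_complexSubspace {x : ℍ[ℝ]}
    (hx : x ∈ Quaternion.ofComplex.range) : x ∈ stableMultipliers (complexSubspace n) :=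
  fun _ hc => mem_complexSubspace.2 fun k => mul_mem (mem_complexSubspace.1 hc k) hx

theorem quatI_mem_stableMultipliers_complexSubspace :
    quatI ∈ stableMultipliers (complexSubspace n) :=
  range_ofComplex_le_stableMultipliers_complexSubspace ⟨_, rfl⟩

theorem mem_perpMultipliers_complexSubspace {u : ℍ[ℝ]} (hre : u.re = 0) (hI : u.imI = 0) :
    u ∈ perpMultipliers (complexSubspace n) := by
  intro c hc c' hc'
  rw [PiLp.inner_apply]
  exact Finset.sum_eq_zero fun k _ => by
    simp [Quaternion.inner_def, hre, hI, (hc k).1, (hc k).2, (hc' k).1, (hc' k).2]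

theorem isHalfLagrangian_complexSubspace : IsHalfLagrangian (complexSubspace n) := by
  have span_le {L : Submodule ℝ ℍ[ℝ]} (hj : quatJ ∈ L) (hk : quatI * quatJ ∈ L) :
      Submodule.span ℝ (Set.range ![quatJ, quatI * quatJ]) ≤ L := by
    rw [Submodule.span_le, Set.range_subset_iff, Fin.forall_fin_two]
    exact ⟨hj, hk⟩
  refine isHalfLagrangian_iff.2 ⟨?_, Submodule.span ℝ (Set.range ![quatJ, quatI * quatJ]),
    span_le (mem_imPart_quaternion.2 (by simp)) (mem_imPart_quaternion.2 (by simp)), ?_,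
    span_le (mem_perpMultipliers_complexSubspace (by simp) (by simp))
      (mem_perpMultipliers_complexSubspace (by simp) (by simp))⟩
  · rw [finrank_complexSubspace, finrank_linSpace, Quaternion.finrank_eq_four]
    ring
  · have linearIndependent : LinearIndependent ℝ ![quatJ, quatI * quatJ] := by
      refine LinearIndependent.pair_iff.2 fun s t h => ?_
      have hJ := congrArg (fun q : ℍ[ℝ] => q.imJ) h
      have hK := congrArg (fun q : ℍ[ℝ] => q.imK) h
      exact ⟨by simpa using hJ, by simpa using hK⟩
    rw [finrank_span_eq_card linearIndependent, Fintype.card_fin, Quaternion.finrank_eq_four]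

/-- If `u, u'` is an orthonormal basis of `L`, then `J_u C` and `J_{u'} C` are both the orthogonal
complement of `C`, so that `u u'` maps `C` to itself. -/
theorem IsHalfLagrangian.exists_mem_stableMultipliers {C : Submodule ℝ (LinSpace ℍ[ℝ] n)}
    (hC : IsHalfLagrangian C) : ∃ w ∈ imPart ℍ[ℝ], ‖w‖ = 1 ∧ w ∈ stableMultipliers C := by
  obtain ⟨hCdim, L, hLim, hLdim, hL⟩ := isHalfLagrangian_iff.1 hC
  rw [Quaternion.finrank_eq_four] at hLdim
  let b := (stdOrthonormalBasis ℝ L).reindex (finCongr (show Module.finrank ℝ L = 2 by lia))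
  have norm_b (k) : ‖(b k : ℍ[ℝ])‖ = 1 := b.orthonormal.1 k
  have re_b (k) : (b k : ℍ[ℝ]).re = 0 := mem_imPart_quaternion.1 (hLim (b k).2)
  have inner_b : inner ℝ (b 0 : ℍ[ℝ]) (b 1 : ℍ[ℝ]) = 0 := b.orthonormal.2 zero_ne_one
  refine ⟨b 0 * b 1, mem_imPart_quaternion.2 ?_, by rw [norm_mul, norm_b, norm_b, one_mul],
    fun c hc => ?_⟩
  · rw [Quaternion.inner_def, Quaternion.star_eq_neg.2 (re_b 1), mul_neg] at inner_b
    exact neg_eq_zero.1 inner_b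
  · rw [← rightMul_rightMul]
    refine rightMul_rightMul_mem hCdim (hL (b 0).2) (hL (b 1).2) (fun v => ?_) hc
    rw [rightMul_rightMul, mul_self_eq_neg_one (hLim (b 1).2) (norm_b 1), rightMul_neg,
      rightMul_one]

theorem quatJ_mem_perpMultipliers_of_mem {C : Submodule ℝ (LinSpace ℍ[ℝ] n)} {u : ℍ[ℝ]}
    (hi : quatI ∈ stableMultipliers C) (hu : u ∈ perpMultipliers C) (hre : u.re = 0)
    (hI : u.imI = 0) (hu0 : u ≠ 0) : quatJ ∈ perpMultipliers C := by
  let z : ℍ[ℝ] := u.imJ • (1 : ℍ[ℝ]) - u.imK • quatI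
  have one_mem : (1 : ℍ[ℝ]) ∈ stableMultipliers C := fun c hc => by rwa [rightMul_one]
  have hz : z ∈ stableMultipliers C :=
    sub_mem (Submodule.smul_mem _ _ one_mem) (Submodule.smul_mem _ _ hi)
  have z_mul_u : z * u = (u.imJ ^ 2 + u.imK ^ 2) • quatJ := by
    ext <;> simp [z, hre, hI] <;> ring
  have normSq_ne_zero : u.imJ ^ 2 + u.imK ^ 2 ≠ 0 := by
    have h := Quaternion.normSq_ne_zero.2 hu0
    rw [Quaternion.normSq_def', hre, hI] at h
    simpa using h
  rw [← Submodule.smul_mem_iff _ normSq_ne_zero, ← z_mul_u]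
  intro c hc c' hc'
  rw [← rightMul_rightMul]
  exact hu _ (hz c hc) c' hc'

theorem IsHalfLagrangian.quatJ_mem_perpMultipliers {C : Submodule ℝ (LinSpace ℍ[ℝ] n)}
    (hC : IsHalfLagrangian C) (hi : quatI ∈ stableMultipliers C) : quatJ ∈ perpMultipliers C := by
  obtain ⟨-, L, hLim, hLdim, hL⟩ := isHalfLagrangian_iff.1 hC
  have L_ne_bot : L ≠ ⊥ := by
    rintro rfl
    simp [Quaternion.finrank_eq_four] at hLdim
  obtain ⟨u, hu, hu0⟩ := Submodule.exists_mem_ne_zero_of_ne_bot L_ne_bot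
  intro c hc
  rcases eq_or_ne c 0 with rfl | hc0
  · intro c' _
    rw [show rightMul (0 : LinSpace ℍ[ℝ] n) quatJ = 0 from map_zero (rightMulₗ.flip quatJ),
      inner_zero_left]
  · have inner_u_quatI : inner ℝ u quatI = 0 := by
      have h := hL hu c hc _ (hi c hc)
      rw [inner_rightMul_same] at h
      exact (mul_eq_zero.1 h).resolve_left (by simpa using hc0)
    exact quatJ_mem_perpMultipliers_of_mem hi (hL hu) (mem_imPart_quaternion.1 (hLim hu))
      (by simpa [Quaternion.inner_def] using inner_u_quatI) hu0 c hc

theorem herm_eq_coe_inner {C : Submodule ℝ (LinSpace ℍ[ℝ] n)} (hi : quatI ∈ stableMultipliers C)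
    (hj : quatJ ∈ perpMultipliers C) {v w : LinSpace ℍ[ℝ] n} (hv : v ∈ C) (hw : w ∈ C)
    (h : inner ℝ (rightMul v quatI) w = 0) : herm v w = ((inner ℝ v w : ℝ) : ℍ[ℝ]) := by
  have hJ := hj v hv w hw
  have hK := hj _ (hi v hv) w hw
  rw [rightMul_rightMul] at hK
  rw [inner_eq_inner_one_herm, herm_rightMul_left, Quaternion.inner_def] at h hJ hK
  rw [inner_eq_inner_one_herm, Quaternion.inner_def]
  simp at h hJ hK
  ext <;> simp [h, hJ, hK]

theorem exists_herm_orthonormal {C : Submodule ℝ (LinSpace ℍ[ℝ] n)}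
    (hi : quatI ∈ stableMultipliers C) (hj : quatJ ∈ perpMultipliers C) {m : ℕ}
    (hm : m * 2 ≤ Module.finrank ℝ C) :
    ∃ c : Fin m → LinSpace ℍ[ℝ] n, (∀ k, c k ∈ C) ∧
      ∀ k l, herm (c k) (c l) = if k = l then 1 else 0 := by
  induction m with
  | zero => exact ⟨Fin.elim0, fun k => k.elim0, fun k => k.elim0⟩
  | succ m ih =>
    obtain ⟨c, hc, herm_c⟩ := ih ((Nat.mul_le_mul_right 2 m.le_succ).trans hm)
    obtain ⟨a, ha, norm_a, perp_a⟩ := exists_norm_eq_one_forall_inner_eq_zero (𝕜 := ℝ) (C := C)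
      (Sum.elim c fun k => rightMul (c k) quatI) (by rw [Fintype.card_sum, Fintype.card_fin]; omega)
    have herm_c_a (k) : herm (c k) a = 0 := by
      rw [herm_eq_coe_inner hi hj (hc k) ha (perp_a (.inr k)), show inner ℝ (c k) a = 0 from
        perp_a (.inl k), Quaternion.coe_zero]
    have herm_a_a : herm a a = 1 := by
      have inner_rightMul_quatI : inner ℝ (rightMul a quatI) a = 0 := by
        have h := inner_rightMul_same a 1 quatI
        rwa [rightMul_one, mem_imPart.1 quatI_mem_imPart, mul_zero, real_inner_comm] at h
      rw [herm_eq_coe_inner hi hj ha ha inner_rightMul_quatI, real_inner_self_eq_norm_sq, norm_a,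
        one_pow, Quaternion.coe_one]
    refine ⟨Fin.cons a c, Fin.cases ha hc, Fin.cases (Fin.cases ?_ fun l => ?_) fun k =>
      Fin.cases ?_ fun l => ?_⟩
    · simpa using herm_a_a
    · rw [Fin.cons_zero, Fin.cons_succ, ← star_herm, herm_c_a, if_neg (Fin.succ_ne_zero l).symm,
        star_zero]
    · rw [Fin.cons_zero, Fin.cons_succ, herm_c_a, if_neg (Fin.succ_ne_zero k)]
    · simpa using herm_c k l

theorem exists_imageUnder_spHom_complexSubspace_eq {C : Submodule ℝ (LinSpace ℍ[ℝ] n)}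
    (hC : IsHalfLagrangian C) (hi : quatI ∈ stableMultipliers C) :
    ∃ M : SpGroup n, imageUnder (spHom (M, 1)) (complexSubspace n) = C := by
  have finrank_eq := isHalfLagrangian_complexSubspace.finrank_eq hC
  obtain ⟨c, hc, herm_c⟩ := exists_herm_orthonormal hi (hC.quatJ_mem_perpMultipliers hi)
    (finrank_complexSubspace.symm.trans finrank_eq).le
  obtain ⟨M, hM⟩ := exists_unitaryHom_single_eq herm_c
  refine ⟨M, imageUnder_eq_of_forall_mem finrank_eq.ge fun x hx => ?_⟩
  rw [spHom_apply, OneMemClass.coe_one, star_one, rightMul_one, ← sum_rightMul_single x, map_sum]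
  refine sum_mem fun l _ => ?_
  have x_eq : x l = (x l).re • (1 : ℍ[ℝ]) + (x l).imI • quatI := by
    ext <;> simp [(hx l).1, (hx l).2]
  rw [unitaryHom_rightMul, hM, x_eq, rightMul_add, rightMul_smul, rightMul_smul, rightMul_one]
  exact C.add_mem (C.smul_mem _ (hc l)) (C.smul_mem _ (hi _ (hc l)))

theorem exists_imageUnder_complexSubspace_eq [NeZero n] {C : Submodule ℝ (LinSpace ℍ[ℝ] n)}
    (hC : IsHalfLagrangian C) :
    ∃ g : twistedGroup ℍ[ℝ] n, imageUnder g (complexSubspace n) = C := by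
  obtain ⟨w, hw, norm_w, hCw⟩ := hC.exists_mem_stableMultipliers
  obtain ⟨β, hβ⟩ := exists_conj_quatI_eq (mul_self_eq_neg_one hw norm_w)
  let g : twistedGroup ℍ[ℝ] n := spHom (1, β)
  have twist_g : twist g⁻¹ w = quatI := by
    rw [twist_inv_apply_eq_iff, twist_spHom, quatRotation_apply, hβ]
  obtain ⟨M, hM⟩ := exists_imageUnder_spHom_complexSubspace_eq (hC.imageUnder g⁻¹)
    (twist_g ▸ twist_mem_stableMultipliers g⁻¹ hCw)
  exact ⟨g * spHom (M, 1), by rw [imageUnder_mul, hM, ← imageUnder_mul, mul_inv_cancel,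
    imageUnder_one]⟩

/-! ### The stabilizer of `ℂⁿ ⊂ ℍⁿ` -/

theorem single_mem_complexSubspace (l : Fin n) : PiLp.single 2 l 1 ∈ complexSubspace n := by
  intro k
  rw [PiLp.single_apply]
  split_ifs <;> simp

theorem star_mem_range_ofComplex {x : ℍ[ℝ]} (hx : x ∈ Quaternion.ofComplex.range) :
    star x ∈ Quaternion.ofComplex.range := by
  rw [mem_range_ofComplex] at hx ⊢
  simp [hx.1, hx.2]

theorem imageUnder_spHom_complexSubspace_eq_iff {p : SpGroup n × UnitQuaternions}
    (hp : (p.2 : ℍ[ℝ]) ∈ Quaternion.ofComplex.range) :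
    imageUnder (spHom p) (complexSubspace n) = complexSubspace n ↔
      ∀ k l, p.1.1 k l ∈ Quaternion.ofComplex.range := by
  constructor
  · intro h k l
    have column_mem := mem_complexSubspace.1
      (h.le (Submodule.mem_map_of_mem (single_mem_complexSubspace l))) k
    change (spHom p).1 (PiLp.single 2 l 1) k ∈ _ at column_mem
    rw [spHom_apply, rightMul_apply, unitaryHom_single] at column_mem
    simpa [mul_assoc] using mul_mem column_mem hp
  · intro h
    refine imageUnder_eq_of_forall_mem le_rfl fun x hx => mem_complexSubspace.2 fun k => ?_
    rw [spHom_apply, rightMul_apply, unitaryHom_apply]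
    exact mul_mem (sum_mem fun l _ => mul_mem (h k l) (mem_complexSubspace.1 hx l))
      (star_mem_range_ofComplex hp)

/-- The isometry `v ↦ j v j*` of `ℍⁿ`, which maps `ℂⁿ` to itself and has twist `x ↦ j x j*`. -/
noncomputable def conjJ (n : ℕ) : twistedGroup ℍ[ℝ] n := spHom (scalarJ n, quaternionJ)

theorem imageUnder_conjJ : imageUnder (conjJ n) (complexSubspace n) = complexSubspace n := by
  refine imageUnder_eq_of_forall_mem le_rfl fun x hx k => ?_
  have conjJ_apply : (conjJ n).1 x k = quatJ * x k * star quatJ := by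
    rw [conjJ, spHom_apply, rightMul_apply, unitaryHom_apply]
    change (∑ l, Matrix.diagonal (fun _ => quatJ) k l * x l) * star quatJ = _
    simp [Matrix.diagonal_apply]
  rw [conjJ_apply, star_quatJ]
  simp [(hx k).1, (hx k).2]

theorem imageUnder_mul_conjJ (g : twistedGroup ℍ[ℝ] n) :
    imageUnder (g * conjJ n) (complexSubspace n) = imageUnder g (complexSubspace n) := by
  rw [imageUnder_mul, imageUnder_conjJ]

variable [NeZero n]

theorem eq_quatI_or_eq_neg_of_mem_stableMultipliers {w : ℍ[ℝ]} (hw : w ∈ imPart ℍ[ℝ])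
    (norm_w : ‖w‖ = 1) (h : w ∈ stableMultipliers (complexSubspace n)) :
    w = quatI ∨ w = -quatI := by
  have hre := mem_imPart_quaternion.1 hw
  obtain ⟨hJ, hK⟩ := h _ (single_mem_complexSubspace 0) 0
  rw [rightMul_apply, PiLp.single_apply, if_pos rfl, one_mul] at hJ hK
  have imI_sq : w.imI * w.imI = 1 := by
    have h := Quaternion.normSq_eq_norm_mul_self w
    rw [norm_w, Quaternion.normSq_def', hre, hJ, hK] at h
    linarith
  rcases mul_self_eq_one_iff.1 imI_sq with hI | hI
  · left; ext <;> simp [hre, hJ, hK, hI]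
  · right; ext <;> simp [hre, hJ, hK, hI]

theorem twist_quatI_eq_or_eq_neg {g : twistedGroup ℍ[ℝ] n}
    (hg : imageUnder g (complexSubspace n) = complexSubspace n) :
    twist g quatI = quatI ∨ twist g quatI = -quatI :=
  eq_quatI_or_eq_neg_of_mem_stableMultipliers (twist_mem_imPart g quatI_mem_imPart)
    (by rw [LinearIsometryEquiv.norm_map, mem_unitary_iff_norm_eq_one.1 quatI_mem_unitary])
    (hg ▸ twist_mem_stableMultipliers g quatI_mem_stableMultipliers_complexSubspace)

theorem twist_spHom_quatI_eq_iff {p : SpGroup n × UnitQuaternions} :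
    twist (spHom p) quatI = quatI ↔ (p.2 : ℍ[ℝ]) ∈ Quaternion.ofComplex.range := by
  rw [twist_spHom, quatRotation_apply, mem_range_ofComplex_iff_commute, commute_iff_eq]
  constructor <;> intro h
  · rw [← mul_one (_ * quatI), ← Unitary.coe_star_mul_self p.2, ← mul_assoc, h]
  · rw [h, mul_assoc, Unitary.mul_star_self_of_mem p.2.2, mul_one]

theorem mem_map_unitaryPairs_iff {g : twistedGroup ℍ[ℝ] n} :
    g ∈ (unitaryPairs n).map spHom ↔ imageUnder g (complexSubspace n) = complexSubspace n ∧
      twist g quatI = quatI := by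
  constructor
  · rintro ⟨p, ⟨hM, hβ⟩, rfl⟩
    exact ⟨(imageUnder_spHom_complexSubspace_eq_iff hβ).2 hM, twist_spHom_quatI_eq_iff.2 hβ⟩
  · rintro ⟨himage, htwist⟩
    obtain ⟨p, rfl⟩ := spHom_surjective g
    have hβ := twist_spHom_quatI_eq_iff.1 htwist
    exact ⟨p, ⟨(imageUnder_spHom_complexSubspace_eq_iff hβ).1 himage, hβ⟩, rfl⟩

theorem twist_mul_conjJ_quatI (g : twistedGroup ℍ[ℝ] n) :
    twist (g * conjJ n) quatI = -twist g quatI := by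
  have twist_conjJ : twist (conjJ n) quatI = -quatI := by
    rw [conjJ, twist_spHom]
    change quatJ * quatI * star quatJ = -quatI
    rw [star_quatJ, quatJ_mul_quatI, neg_mul_neg, mul_assoc, quatJ_mul_quatJ, mul_neg_one]
  rw [map_mul, LinearIsometryEquiv.coe_mul, Function.comp_apply, twist_conjJ, map_neg]

theorem imageUnder_complexSubspace_eq_iff {g : twistedGroup ℍ[ℝ] n} :
    imageUnder g (complexSubspace n) = complexSubspace n ↔
      g ∈ (extendedUnitaryPairs n).map spHom := by
  have map_le : (unitaryPairs n).map spHom ≤ (extendedUnitaryPairs n).map spHom :=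
    Subgroup.map_mono le_sup_left
  have conjJ_mem : conjJ n ∈ (extendedUnitaryPairs n).map spHom :=
    ⟨_, Subgroup.mem_sup_right (Subgroup.mem_zpowers _), rfl⟩
  constructor
  · intro h
    rcases twist_quatI_eq_or_eq_neg h with htwist | htwist
    · exact map_le (mem_map_unitaryPairs_iff.2 ⟨h, htwist⟩)
    · refine (Subgroup.mul_mem_cancel_right _ conjJ_mem).1 (map_le ?_)
      rw [mem_map_unitaryPairs_iff, imageUnder_mul_conjJ, twist_mul_conjJ_quatI, htwist, neg_neg]
      exact ⟨h, rfl⟩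
  · let stabilizer : Subgroup (twistedGroup ℍ[ℝ] n) :=
      { carrier := {g | imageUnder g (complexSubspace n) = complexSubspace n}
        mul_mem' := fun {a b} ha hb => (imageUnder_mul a b _).trans ((congrArg _ hb).trans ha)
        one_mem' := imageUnder_one _
        inv_mem' := imageUnder_inv_eq_iff.2 }
    have map_le_stabilizer : (extendedUnitaryPairs n).map spHom ≤ stabilizer := by
      rw [Subgroup.map_le_iff_le_comap, extendedUnitaryPairs, sup_le_iff, Subgroup.zpowers_le]
      exact ⟨fun p hp => (mem_map_unitaryPairs_iff.1 ⟨p, hp, rfl⟩).1, imageUnder_conjJ⟩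
    exact fun h => map_le_stabilizer h

theorem relIndex_unitaryPairs (n : ℕ) [NeZero n] :
    ((unitaryPairs n).map spHom).relIndex ((extendedUnitaryPairs n).map spHom) = 2 := by
  have neg_quatI_ne : -quatI ≠ quatI := fun h => by
    have := congrArg (fun q : ℍ[ℝ] => q.imI) h
    norm_num at this
  refine Subgroup.relIndex_eq_two_iff.2
    ⟨conjJ n, imageUnder_complexSubspace_eq_iff.1 imageUnder_conjJ, fun g hg => ?_⟩
  have hg := imageUnder_complexSubspace_eq_iff.2 hg
  simp only [mem_map_unitaryPairs_iff, imageUnder_mul_conjJ, twist_mul_conjJ_quatI, hg, true_and]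
  rcases twist_quatI_eq_or_eq_neg hg with htwist | htwist
  · rw [htwist]
    exact .inr ⟨rfl, neg_quatI_ne⟩
  · rw [htwist, neg_neg]
    exact .inl ⟨rfl, neg_quatI_ne⟩

theorem isHomogeneousSpace_complexSubspace :
    IsHomogeneousSpace ((extendedUnitaryPairs n).map spHom) (complexSubspace n) :=
  isHomogeneousSpace_of_stabilizer_eq isHalfLagrangian_complexSubspace
    (fun _ hC => exists_imageUnder_complexSubspace_eq hC)
    fun _ => imageUnder_complexSubspace_eq_iff

end QuaternionicLagrangian

/-! ### Polarized Lagrangian subspaces -/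

namespace PolarizedLagrangian

variable {n : ℕ}

instance : T2Space (PolarizedLagrangian n) :=
  T2Space.of_injective_continuous
    (f := fun p : PolarizedLagrangian n => (p.1.1.starProjection, p.1.2))
    (fun p q h => by
      have hC : p.1.1 = q.1.1 := starProjection_injective (congrArg Prod.fst h)
      have hv : p.1.2 = q.1.2 := congrArg (fun r => r.2) h
      exact Subtype.ext (Prod.ext hC hv))
    continuous_induced_dom

variable [NeZero n]

/-- The polarized Lagrangian `(g ℂⁿ, θ(i))`, where `θ` is the twist of `g`. -/
noncomputable def ofTwisted (g : twistedGroup ℍ[ℝ] n) : PolarizedLagrangian n :=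
  ⟨(imageUnder g (complexSubspace n), twist g quatI),
    isHalfLagrangian_complexSubspace.imageUnder g, twist_mem_imPart g quatI_mem_imPart,
    by rw [LinearIsometryEquiv.norm_map, mem_unitary_iff_norm_eq_one.1 quatI_mem_unitary],
    twist_mem_stableMultipliers g quatI_mem_stableMultipliers_complexSubspace⟩

theorem continuous_ofTwisted : Continuous (ofTwisted : twistedGroup ℍ[ℝ] n → _) :=
  continuous_induced_rng.2 <|
    (continuous_starProjection_imageUnder (complexSubspace n)).prodMk (continuous_twist quatI)

theorem ofTwisted_surjective : Function.Surjective (ofTwisted : twistedGroup ℍ[ℝ] n → _) := by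
  rintro ⟨⟨C, v⟩, hC, hv, norm_v, hCv⟩
  obtain ⟨g, rfl⟩ := exists_imageUnder_complexSubspace_eq hC
  have twist_inv_mem := twist_mem_stableMultipliers g⁻¹ hCv
  rw [← imageUnder_mul, inv_mul_cancel, imageUnder_one] at twist_inv_mem
  rcases eq_quatI_or_eq_neg_of_mem_stableMultipliers (twist_mem_imPart g⁻¹ hv)
    (by rw [LinearIsometryEquiv.norm_map, norm_v]) twist_inv_mem with h | h
  · exact ⟨g, Subtype.ext (Prod.ext rfl ((twist_inv_apply_eq_iff g).1 h))⟩
  · refine ⟨g * conjJ n, Subtype.ext (Prod.ext (imageUnder_mul_conjJ g) ?_)⟩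
    refine (twist_mul_conjJ_quatI g).trans ?_
    rw [← map_neg]
    exact (twist_inv_apply_eq_iff g).1 h

theorem ofTwisted_eq_ofTwisted_iff {g h : twistedGroup ℍ[ℝ] n} :
    ofTwisted g = ofTwisted h ↔ g⁻¹ * h ∈ (unitaryPairs n).map spHom := by
  have twist_inv_mul : twist g quatI = twist h quatI ↔ twist (g⁻¹ * h) quatI = quatI := by
    rw [map_mul, LinearIsometryEquiv.coe_mul, Function.comp_apply, twist_inv_apply_eq_iff]
  exact (Subtype.ext_iff.trans Prod.ext_iff).trans <|
    (and_congr imageUnder_eq_imageUnder_iff twist_inv_mul).trans mem_map_unitaryPairs_iff.symm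

end PolarizedLagrangian

theorem exists_polarizedLagrangian_homeomorph (n : ℕ) [NeZero n] :
    ∃ h : (twistedGroup ℍ[ℝ] n ⧸ (unitaryPairs n).map spHom) ≃ₜ PolarizedLagrangian n,
      ∀ g : twistedGroup ℍ[ℝ] n, (h g).1.1 = imageUnder g (complexSubspace n) ∧
        ∀ v : LinSpace ℍ[ℝ] n, g.1 (rightMul v quatI) = rightMul (g.1 v) (h g).1.2 := by
  obtain ⟨h, hh⟩ := exists_quotient_homeomorph PolarizedLagrangian.continuous_ofTwisted
    PolarizedLagrangian.ofTwisted_surjective fun _ _ =>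
      PolarizedLagrangian.ofTwisted_eq_ofTwisted_iff (n := n)
  refine ⟨h, fun g => ?_⟩
  rw [hh g]
  exact ⟨rfl, fun v => apply_rightMul g v _⟩

/-! ### Even central elements of a Clifford algebra -/

section CliffordCenter

open CliffordAlgebra

theorem ι_mul_sub_involute_mul_ι {R M : Type*} [CommRing R] [AddCommGroup M] [Module R M]
    (Q : QuadraticForm R M) (v : M) (x : CliffordAlgebra Q) :
    ι Q v * x - involute x * ι Q v = contractLeft (Q.polarBilin v) x := by
  induction x using CliffordAlgebra.left_induction with
  | algebraMap r => rw [AlgHom.commutes, contractLeft_algebraMap, Algebra.commutes, sub_self]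
  | add x y hx hy =>
    rw [mul_add, map_add, add_mul, map_add, ← hx, ← hy]
    abel
  | ι_mul x a hx =>
    have swap : ι Q v * ι Q a + ι Q a * ι Q v = algebraMap R _ (Q.polarBilin v a) :=
      ι_mul_ι_add_swap v a
    rw [contractLeft_ι_mul, ← hx, map_mul, involute_ι, Algebra.smul_def]
    linear_combination (norm := noncomm_ring) swap * x

section Euler

variable {R M ι' : Type*} [Fintype ι'] [AddCommGroup M]

section CommRing

variable [CommRing R] [Module R M] (b : Module.Basis ι' R M)

/-- The Euler operator `∑ bᵢ ∧ ∂ᵢ` of the exterior algebra, which multiplies forms of degree `k`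
by `k`. The contractions `∂ᵢ` are those of the Clifford algebra of the zero quadratic form. -/
noncomputable def eulerOperator : ExteriorAlgebra R M →ₗ[R] ExteriorAlgebra R M :=
  ∑ i, LinearMap.mulLeft R (ExteriorAlgebra.ι R (b i)) ∘ₗ
    contractLeft (Q := (0 : QuadraticForm R M)) (b.coord i)

theorem eulerOperator_apply (x : ExteriorAlgebra R M) :
    eulerOperator b x = ∑ i, ExteriorAlgebra.ι R (b i) *
      contractLeft (Q := (0 : QuadraticForm R M)) (b.coord i) x := by
  simp [eulerOperator, LinearMap.sum_apply]

theorem eulerOperator_ι_mul (a : M) (x : ExteriorAlgebra R M) :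
    eulerOperator b (ExteriorAlgebra.ι R a * x) =
      ExteriorAlgebra.ι R a * x + ExteriorAlgebra.ι R a * eulerOperator b x := by
  have summand_eq (i) : ExteriorAlgebra.ι R (b i) *
      contractLeft (Q := (0 : QuadraticForm R M)) (b.coord i) (ExteriorAlgebra.ι R a * x) =
        ExteriorAlgebra.ι R (b.repr a i • b i) * x + ExteriorAlgebra.ι R a *
          (ExteriorAlgebra.ι R (b i) *
            contractLeft (Q := (0 : QuadraticForm R M)) (b.coord i) x) := by
    have swap := ExteriorAlgebra.ι_add_mul_swap (R := R) a (b i)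
    rw [contractLeft_ι_mul, mul_sub, mul_smul_comm, map_smul, smul_mul_assoc,
      Module.Basis.coord_apply]
    linear_combination (norm := noncomm_ring) -swap *
      contractLeft (Q := (0 : QuadraticForm R M)) (b.coord i) x
  simp_rw [eulerOperator_apply, summand_eq]
  rw [Finset.sum_add_distrib, ← Finset.sum_mul, ← map_sum, b.sum_repr, Finset.mul_sum]

theorem eulerOperator_of_mem_exteriorPower {k : ℕ} {x : ExteriorAlgebra R M} (hx : x ∈ ⋀[R]^k M) :
    eulerOperator b x = (k : R) • x := by
  induction hx using Submodule.pow_induction_on_left' with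
  | algebraMap r =>
    rw [eulerOperator_apply, Nat.cast_zero, zero_smul]
    refine Finset.sum_eq_zero fun i _ => ?_
    rw [contractLeft_algebraMap, mul_zero]
  | add x y i _ _ ihx ihy => rw [map_add, ihx, ihy, smul_add]
  | mem_mul m hm i x _ ih =>
    obtain ⟨a, rfl⟩ := hm
    rw [eulerOperator_ι_mul, ih, mul_smul_comm, Nat.cast_succ, add_smul, one_smul, add_comm]

theorem proj_eulerOperator (k : ℕ) (x : ExteriorAlgebra R M) :
    GradedAlgebra.proj (fun i : ℕ => ⋀[R]^i M) k (eulerOperator b x) =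
      (k : R) • GradedAlgebra.proj (fun i : ℕ => ⋀[R]^i M) k x := by
  induction x using DirectSum.Decomposition.inductionOn (fun i : ℕ => ⋀[R]^i M) with
  | zero => simp
  | @homogeneous i m =>
    rw [eulerOperator_of_mem_exteriorPower b m.2, map_smul]
    rcases eq_or_ne i k with rfl | hne
    · rfl
    · rw [GradedAlgebra.proj_apply,
        DirectSum.decompose_of_mem_ne (fun i : ℕ => ⋀[R]^i M) m.2 hne, smul_zero, smul_zero]
  | add x y ihx ihy => rw [map_add, map_add, map_add, ihx, ihy, smul_add]

end CommRing

variable [Field R] [CharZero R] [Module R M] (b : Module.Basis ι' R M)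

theorem exists_algebraMap_eq_of_eulerOperator_eq_zero {x : ExteriorAlgebra R M}
    (h : eulerOperator b x = 0) : ∃ r : R, algebraMap R _ r = x := by
  classical
  have proj_eq_zero {k : ℕ} (hk : k ≠ 0) : GradedAlgebra.proj (fun i : ℕ => ⋀[R]^i M) k x = 0 := by
    have smul_proj := proj_eulerOperator b k x
    rw [h, map_zero, eq_comm, smul_eq_zero] at smul_proj
    exact smul_proj.resolve_left (Nat.cast_ne_zero.2 hk)
  have mem_zero : x ∈ ⋀[R]^0 M := by
    rw [← DirectSum.sum_support_decompose (fun i : ℕ => ⋀[R]^i M) x]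
    refine sum_mem fun k _ => ?_
    rcases eq_or_ne k 0 with rfl | hk
    · exact Subtype.mem _
    · rw [← GradedAlgebra.proj_apply, proj_eq_zero hk]
      exact zero_mem _
  rwa [ExteriorAlgebra.exteriorPower, pow_zero, Submodule.mem_one] at mem_zero

end Euler

variable {R M : Type*} [Field R] [CharZero R] [AddCommGroup M] [Module R M] [FiniteDimensional R M]
  {Q : QuadraticForm R M}

theorem exists_algebraMap_eq_of_forall_contractLeft_eq_zero {x : CliffordAlgebra Q}
    (h : ∀ d : Module.Dual R M, contractLeft d x = 0) : ∃ r : R, algebraMap R _ r = x := by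
  let _ : Invertible (2 : R) := invertibleOfNonzero two_ne_zero
  let b := Module.finBasis R M
  have eulerOperator_eq_zero : eulerOperator b (equivExterior Q x) = 0 := by
    rw [eulerOperator_apply]
    refine Finset.sum_eq_zero fun i _ => ?_
    have contract_eq : contractLeft (Q := (0 : QuadraticForm R M)) (b.coord i)
        (equivExterior Q x) = equivExterior Q (contractLeft (b.coord i) x) :=
      (changeForm_contractLeft (h := changeForm.associated_neg_proof) _ _).symm
    rw [contract_eq, h, map_zero, mul_zero]
  obtain ⟨r, hr⟩ := exists_algebraMap_eq_of_eulerOperator_eq_zero b eulerOperator_eq_zero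
  refine ⟨r, (equivExterior Q).injective (Eq.trans ?_ hr)⟩
  exact changeForm_algebraMap (h := changeForm.associated_neg_proof) r

theorem exists_algebraMap_eq_of_involute_eq (hQ : Q.Nondegenerate)
    {x : CliffordAlgebra Q} (involute_eq : involute x = x)
    (commute_ι : ∀ v, Commute (ι Q v) x) : ∃ r : R, algebraMap R _ r = x := by
  refine exists_algebraMap_eq_of_forall_contractLeft_eq_zero fun d => ?_
  let _ : Invertible (2 : R) := invertibleOfNonzero two_ne_zero
  obtain ⟨v, rfl⟩ :=
    (LinearMap.BilinForm.toDual _ (QuadraticMap.nondegenerate_polar_iff.2 hQ)).surjective d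
  change contractLeft (Q.polarBilin v) x = 0
  rw [← ι_mul_sub_involute_mul_ι, involute_eq, commute_ι v, sub_self]

end CliffordCenter

/-! ### Right multiplication by imaginary units -/

section ImaginaryUnits

variable {A : Type} [NormedAddCommGroup A] [InnerProductSpace ℝ A] [Mul A] [One A]
  [IsCompositionAlgebra A] {n : ℕ}

theorem rightMul_rightMul_self {u : A} (hu : u ∈ imPart A) (v : LinSpace A n) :
    rightMul (rightMul v u) u = -(‖u‖ ^ 2) • v := by
  refine ext_inner_right ℝ fun w => ?_
  rw [inner_rightMul_left_of_mem_imPart hu, inner_rightMul_rightMul, real_inner_smul_left,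
    neg_mul]

theorem rightMul_rightMul_add_rightMul_rightMul {u w : A} (hu : u ∈ imPart A) (hw : w ∈ imPart A)
    (v : LinSpace A n) :
    rightMul (rightMul v u) w + rightMul (rightMul v w) u = -(2 * inner ℝ u w) • v := by
  have h := rightMul_rightMul_self (add_mem hu hw) v
  rw [norm_add_sq_real, rightMul_add, rightMul_add, add_rightMul, add_rightMul,
    rightMul_rightMul_self hu, rightMul_rightMul_self hw] at h
  linear_combination (norm := module) h

theorem det_reflection_trans_reflection {E : Type*} [NormedAddCommGroup E] [InnerProductSpace ℝ E]
    [FiniteDimensional ℝ E] {u v : E} (hu : u ≠ 0) (hv : v ≠ 0) :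
    LinearMap.det (((ℝ ∙ u).reflection.trans (ℝ ∙ v).reflection).toLinearEquiv : E →ₗ[ℝ] E) =
      1 := by
  have det_reflection (w : E) (hw : w ≠ 0) :
      LinearMap.det ((ℝ ∙ w).reflection.toLinearEquiv : E →ₗ[ℝ] E) =
        (-1) ^ (Module.finrank ℝ E - 1) := by
    rw [Submodule.det_reflection, ← (ℝ ∙ w).finrank_add_finrank_orthogonal,
      finrank_span_singleton hw, Nat.add_sub_cancel_left]
  calc LinearMap.det (((ℝ ∙ u).reflection.trans (ℝ ∙ v).reflection).toLinearEquiv : E →ₗ[ℝ] E)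
      = LinearMap.det ((ℝ ∙ v).reflection.toLinearEquiv : E →ₗ[ℝ] E) *
          LinearMap.det ((ℝ ∙ u).reflection.toLinearEquiv : E →ₗ[ℝ] E) := LinearMap.det_comp _ _
    _ = 1 := by rw [det_reflection u hu, det_reflection v hv, ← mul_pow, neg_one_mul, neg_neg,
      one_pow]

/-- Conjugation by `u` in `𝔸`, expressed without associativity: for a unit vector `u ∈ Im 𝔸` it
fixes `1` and `u` and is `-1` on the orthogonal complement of both. -/
noncomputable def conjugation (u : A) : A ≃ₗᵢ[ℝ] A :=
  ((ℝ ∙ u).reflection.trans (ℝ ∙ (1 : A)).reflection).trans (LinearIsometryEquiv.neg ℝ)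

theorem conjugation_apply {u : A} (hu : u ∈ imPart A) (norm_u : ‖u‖ = 1) (x : A) :
    conjugation u x = (2 * inner ℝ (1 : A) x) • (1 : A) + (2 * inner ℝ u x) • u - x := by
  change -(ℝ ∙ (1 : A)).reflection ((ℝ ∙ u).reflection x) = _
  rw [Submodule.reflection_singleton_apply, Submodule.reflection_singleton_apply, norm_u,
    IsCompositionAlgebra.norm_one, inner_sub_right, inner_smul_right_eq_smul, inner_smul_right,
    mem_imPart.1 hu]
  simp only [RCLike.ofReal_real_eq_id, id_eq, one_pow, div_one, two_smul, two_mul, add_smul]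
  module

theorem det_conjugation [FiniteDimensional ℝ A] (hA : Even (Module.finrank ℝ A)) {u : A}
    (hu : u ≠ 0) : LinearMap.det ((conjugation u).toLinearEquiv : A →ₗ[ℝ] A) = 1 := by
  have one_ne_zero : (1 : A) ≠ 0 :=
    norm_ne_zero_iff.1 (by rw [IsCompositionAlgebra.norm_one]; exact _root_.one_ne_zero)
  rw [show ((conjugation u).toLinearEquiv : A →ₗ[ℝ] A) = (-1 : ℝ) •
      (((ℝ ∙ u).reflection.trans (ℝ ∙ (1 : A)).reflection).toLinearEquiv : A →ₗ[ℝ] A) from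
      LinearMap.ext fun x => (neg_one_smul ℝ _).symm,
    LinearMap.det_smul, det_reflection_trans_reflection hu one_ne_zero, hA.neg_one_pow, one_mul]

theorem rightMul_rightMul_eq_conjugation {u : A} (hu : u ∈ imPart A) (norm_u : ‖u‖ = 1)
    (v : LinSpace A n) (x : A) :
    rightMul (rightMul v x) u = rightMul (rightMul v u) (conjugation u x) := by
  obtain ⟨a, y, hy, rfl⟩ : ∃ (a : ℝ) (y : A), y ∈ imPart A ∧ a • 1 + y = x :=
    ⟨inner ℝ 1 x, _, sub_inner_one_smul_one_mem_imPart x, add_sub_cancel _ _⟩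
  have conj : conjugation u (a • 1 + y) = a • 1 + (2 * inner ℝ u y) • u - y := by
    rw [conjugation_apply hu norm_u, inner_add_right, inner_add_right, inner_smul_right,
      inner_smul_right, real_inner_self_eq_norm_sq, IsCompositionAlgebra.norm_one, mem_imPart.1 hy,
      real_inner_comm, mem_imPart.1 hu]
    module
  have anticomm := rightMul_rightMul_add_rightMul_rightMul hu hy v
  have square := rightMul_rightMul_self hu v
  rw [norm_u] at square
  rw [conj, sub_eq_add_neg]
  simp only [rightMul_add, add_rightMul, rightMul_smul, smul_rightMul, rightMul_one, rightMul_neg]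
  linear_combination (norm := module) anticomm - (2 * inner ℝ u y) • square

variable [FiniteDimensional ℝ A]

/-- Right multiplication of `𝔸ⁿ` by a unit vector of `𝔸`. -/
noncomputable def rightMulIsometry (u : A) (hu : ‖u‖ = 1) : LinSpace A n ≃ₗᵢ[ℝ] LinSpace A n :=
  LinearIsometry.toLinearIsometryEquiv
    ⟨rightMulₗ.flip u, fun v => (norm_rightMul v u).trans (by rw [hu, mul_one])⟩ rfl

theorem exists_twistedGroup_rightMul [NeZero n] (hA : Even (Module.finrank ℝ A)) {u : A}
    (hu : u ∈ imPart A) (norm_u : ‖u‖ = 1) :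
    ∃ g : twistedGroup A n, (∀ v, g.1 v = rightMul v u) ∧
      ∀ x ∈ imPart A, twist g x = (2 * inner ℝ u x) • u - x := by
  have hu0 : u ≠ 0 := norm_ne_zero_iff.1 (norm_u ▸ one_ne_zero)
  have twisted := rightMul_rightMul_eq_conjugation (n := n) hu norm_u
  refine ⟨⟨rightMulIsometry u norm_u, conjugation u, det_conjugation hA hu0, twisted⟩,
    fun v => rfl, fun x hx => ?_⟩
  rw [twist_apply_eq_of_forall fun v => twisted v x, conjugation_apply hu norm_u, mem_imPart.1 hx]
  module

end ImaginaryUnits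

/-! ### The twisted group of the line -/

section Line

variable {A : Type} [NormedAddCommGroup A] [InnerProductSpace ℝ A]

variable (A) in
/-- The identification of `𝔸` with `𝔸¹`. -/
noncomputable def lineEquiv : A ≃ₗᵢ[ℝ] LinSpace A 1 where
  toFun x := WithLp.toLp 2 fun _ => x
  invFun v := v 0
  map_add' x y := rfl
  map_smul' c x := rfl
  left_inv x := rfl
  right_inv v := by ext i; rw [Fin.fin_one_eq_zero i]
  norm_map' x := by
    rw [← sq_eq_sq₀ (norm_nonneg _) (norm_nonneg _), PiLp.norm_sq_eq_of_L2,
      Fin.sum_univ_one]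
    rfl

variable [Mul A]

/-- The action on `𝔸` of the twisted group of `𝔸¹`. -/
noncomputable def lineAct : twistedGroup A 1 →* (A ≃ₗᵢ[ℝ] A) where
  toFun g := ((lineEquiv A).trans g.1).trans (lineEquiv A).symm
  map_one' := rfl
  map_mul' g h := LinearIsometryEquiv.ext fun x => congrArg (lineEquiv A).symm
    (congrArg g.1 ((lineEquiv A).apply_symm_apply (h.1 (lineEquiv A x))).symm)

theorem lineEquiv_lineAct (g : twistedGroup A 1) (x : A) :
    lineEquiv A (lineAct g x) = g.1 (lineEquiv A x) :=
  (lineEquiv A).apply_symm_apply _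

theorem apply_eq_lineAct (g : twistedGroup A 1) (v : LinSpace A 1) (k : Fin 1) :
    g.1 v k = lineAct g (v k) := by
  obtain ⟨x, rfl⟩ := (lineEquiv A).surjective v
  exact congrArg (· k) (lineEquiv_lineAct g x).symm

theorem lineAct_injective : Function.Injective (lineAct (A := A)) := fun g h hgh =>
  Subtype.ext <| LinearIsometryEquiv.ext fun v => PiLp.ext fun k => by
    rw [apply_eq_lineAct, apply_eq_lineAct, hgh]

/-- The element of the twisted group of `𝔸¹` acting on `𝔸` by `f`. -/
noncomputable def twistedGroup.ofLine (f θ : A ≃ₗᵢ[ℝ] A)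
    (hθ : LinearMap.det (θ.toLinearEquiv : A →ₗ[ℝ] A) = 1)
    (h : ∀ v x, f (v * x) = f v * θ x) : twistedGroup A 1 :=
  ⟨((lineEquiv A).symm.trans f).trans (lineEquiv A), θ, hθ,
    fun v x => PiLp.ext fun _ => h (v 0) x⟩

theorem lineAct_ofLine {f θ : A ≃ₗᵢ[ℝ] A} (hθ : LinearMap.det (θ.toLinearEquiv : A →ₗ[ℝ] A) = 1)
    (h : ∀ v x, f (v * x) = f v * θ x) : lineAct (twistedGroup.ofLine f θ hθ h) = f := rfl

variable [One A] [IsCompositionAlgebra A]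

theorem lineAct_mul_apply (g : twistedGroup A 1) (x y : A) :
    lineAct g (x * y) = lineAct g x * twist g y :=
  congrArg (lineEquiv A).symm (apply_rightMul g (lineEquiv A x) y)

end Line

/-! ### The octonions as a composition algebra -/

namespace Octonion

protected theorem ext {x y : Octonion} (h₁ : x.fst = y.fst) (h₂ : x.snd = y.snd) : x = y :=
  WithLp.ofLp_injective 2 (Prod.ext h₁ h₂)

theorem norm_sq (x : Octonion) :
    ‖x‖ ^ 2 = Quaternion.normSq x.fst + Quaternion.normSq x.snd := by
  rw [WithLp.prod_norm_sq_eq_of_L2, Quaternion.normSq_eq_norm_mul_self,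
    Quaternion.normSq_eq_norm_mul_self, sq, sq]

theorem norm_mul_sq (x y : Octonion) : ‖x * y‖ ^ 2 = ‖x‖ ^ 2 * ‖y‖ ^ 2 := by
  simp only [norm_sq, mul_fst, mul_snd, Quaternion.normSq_def', Quaternion.re_mul,
    Quaternion.imI_mul, Quaternion.imJ_mul, Quaternion.imK_mul, Quaternion.re_star,
    Quaternion.imI_star, Quaternion.imJ_star, Quaternion.imK_star, Quaternion.re_sub,
    Quaternion.imI_sub, Quaternion.imJ_sub, Quaternion.imK_sub, Quaternion.re_add,
    Quaternion.imI_add, Quaternion.imJ_add, Quaternion.imK_add]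
  ring

instance : IsCompositionAlgebra Octonion where
  mul_add x y z := Octonion.ext
    (by simp only [mul_fst, WithLp.add_fst, WithLp.add_snd]; noncomm_ring)
    (by simp only [mul_snd, WithLp.add_fst, WithLp.add_snd]; noncomm_ring)
  add_mul x y z := Octonion.ext
    (by simp only [mul_fst, WithLp.add_fst, WithLp.add_snd, star_add]; noncomm_ring)
    (by simp only [mul_snd, WithLp.add_fst, WithLp.add_snd, star_add]; noncomm_ring)
  mul_smul c x y := Octonion.ext (by simp [mul_fst, smul_sub]) (by simp [mul_snd, smul_add])
  smul_mul c x y := Octonion.ext (by simp [mul_fst, smul_sub]) (by simp [mul_snd, smul_add])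
  mul_one x := Octonion.ext (by simp [mul_fst, one_fst, one_snd])
    (by simp [mul_snd, one_fst, one_snd])
  norm_mul x y := by
    rw [← sq_eq_sq₀ (norm_nonneg _) (by positivity), mul_pow, norm_mul_sq]
  norm_one := by
    rw [← sq_eq_sq₀ (norm_nonneg _) zero_le_one, norm_sq, one_fst, one_snd, map_one, map_zero,
      add_zero, one_pow]

protected theorem one_mul (x : Octonion) : 1 * x = x :=
  Octonion.ext (by simp [mul_fst, one_fst, one_snd]) (by simp [mul_snd, one_fst, one_snd])

/-- The inclusion of the first summand of `𝕆 = ℍ ⊕ ℍ`. -/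
noncomputable def inl : ℍ[ℝ] →ₗᵢ[ℝ] Octonion where
  toFun a := WithLp.toLp 2 (a, 0)
  map_add' _ _ := Octonion.ext rfl (add_zero 0).symm
  map_smul' c _ := Octonion.ext rfl (smul_zero c).symm
  norm_map' a := WithLp.norm_toLp_fst 2 ℍ[ℝ] ℍ[ℝ] a

/-- The inclusion of the second summand of `𝕆 = ℍ ⊕ ℍ`. -/
noncomputable def inr : ℍ[ℝ] →ₗᵢ[ℝ] Octonion where
  toFun b := WithLp.toLp 2 (0, b)
  map_add' _ _ := Octonion.ext (add_zero 0).symm rfl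
  map_smul' c _ := Octonion.ext (smul_zero c).symm rfl
  norm_map' b := WithLp.norm_toLp_snd 2 ℍ[ℝ] ℍ[ℝ] b

@[simp] theorem inl_fst (a : ℍ[ℝ]) : (inl a).fst = a := rfl

@[simp] theorem inl_snd (a : ℍ[ℝ]) : (inl a).snd = 0 := rfl

@[simp] theorem inr_fst (b : ℍ[ℝ]) : (inr b).fst = 0 := rfl

@[simp] theorem inr_snd (b : ℍ[ℝ]) : (inr b).snd = b := rfl

theorem inl_fst_add_inr_snd (x : Octonion) : inl x.fst + inr x.snd = x :=
  Octonion.ext (add_zero _) (zero_add _)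

theorem inl_mul_inl (a c : ℍ[ℝ]) : inl a * inl c = inl (a * c) :=
  Octonion.ext (by simp [mul_fst]) (by simp [mul_snd])

theorem inr_mul_inl (b c : ℍ[ℝ]) : inr b * inl c = inr (c * b) :=
  Octonion.ext (by simp [mul_fst]) (by simp [mul_snd])

theorem inner_inl_left (a : ℍ[ℝ]) (x : Octonion) : inner ℝ (inl a) x = inner ℝ a x.fst := by
  change inner ℝ a x.fst + inner ℝ 0 x.snd = inner ℝ a x.fst
  rw [inner_zero_left, add_zero]

theorem inner_inl_inr (a b : ℍ[ℝ]) : inner ℝ (inl a) (inr b) = 0 := by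
  rw [inner_inl_left, inr_fst, inner_zero_right]

theorem inr_mem_imPart (b : ℍ[ℝ]) : inr b ∈ imPart Octonion :=
  mem_imPart.2 (inner_inl_inr 1 b)

theorem finrank_eq_eight : Module.finrank ℝ Octonion = 8 := by
  rw [(WithLp.linearEquiv 2 ℝ (ℍ[ℝ] × ℍ[ℝ])).finrank_eq, Module.finrank_prod,
    Quaternion.finrank_eq_four]

theorem even_finrank : Even (Module.finrank ℝ Octonion) := finrank_eq_eight ▸ by decide

end Octonion

/-! ### The group `Spin(7)` -/

section ImaginaryTwist

variable {A : Type} [NormedAddCommGroup A] [InnerProductSpace ℝ A] [Mul A] [One A]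
  [IsCompositionAlgebra A] [FiniteDimensional ℝ A]

/-- The isometry of `Im 𝔸` induced by the isometry `θ` of `𝔸` that belongs to an element of the
twisted group. -/
noncomputable def twistIm {n : ℕ} [NeZero n] (g : twistedGroup A n) :
    imPart A ≃ₗᵢ[ℝ] imPart A :=
  LinearIsometry.toLinearIsometryEquiv
    ⟨(twist g).toLinearEquiv.toLinearMap.restrict fun _ hx => twist_mem_imPart g hx,
      fun x => (twist g).norm_map x⟩ rfl

theorem twistIm_apply {n : ℕ} [NeZero n] (g : twistedGroup A n) (x : imPart A) :
    (twistIm g x : A) = twist g x := rfl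

theorem not_forall_twist_eq_neg {n : ℕ} [NeZero n] (hA : Even (Module.finrank ℝ A))
    (g : twistedGroup A n) : ¬∀ x ∈ imPart A, twist g x = -x := fun h => by
  have norm_one := IsCompositionAlgebra.norm_one (A := A)
  have one_ne_zero : (1 : A) ≠ 0 := norm_ne_zero_iff.1 (norm_one ▸ _root_.one_ne_zero)
  have twist_eq : twist g = (ℝ ∙ (1 : A)).reflection := LinearIsometryEquiv.ext fun x => by
    have twist_im := h _ (sub_inner_one_smul_one_mem_imPart x)
    rw [map_sub, map_smul, twist_apply_one, neg_sub, sub_eq_iff_eq_add] at twist_im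
    rw [twist_im, Submodule.reflection_singleton_apply, norm_one]
    simp only [RCLike.ofReal_real_eq_id, id_eq, one_pow, div_one, two_smul]
    abel
  have det_eq := det_twist g
  have finrank_eq := (ℝ ∙ (1 : A)).finrank_add_finrank_orthogonal
  rw [finrank_span_singleton one_ne_zero] at finrank_eq
  have odd_finrank : Odd (Module.finrank ℝ (ℝ ∙ (1 : A))ᗮ) := by
    rw [← finrank_eq] at hA
    exact (Nat.even_add'.1 hA).1 odd_one
  rw [twist_eq, Submodule.det_reflection, odd_finrank.neg_one_pow] at det_eq
  norm_num at det_eq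

theorem exists_lineAct_eq_mul (hA : Even (Module.finrank ℝ A)) {u : A} (hu : u ∈ imPart A)
    (norm_u : ‖u‖ = 1) : ∃ g : twistedGroup A 1, (∀ y, lineAct g y = y * u) ∧
      ∀ x ∈ imPart A, twist g x = (2 * inner ℝ u x) • u - x := by
  obtain ⟨g, hg, twist_g⟩ := exists_twistedGroup_rightMul (n := 1) hA hu norm_u
  exact ⟨g, fun y => congrArg (lineEquiv A).symm (hg (lineEquiv A y)), twist_g⟩

end ImaginaryTwist

section Pin

variable {R M : Type*} [CommRing R] [AddCommGroup M] [Module R M] {Q : QuadraticForm R M} {v : M}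

theorem ι_mul_ι_eq_neg_one (hv : Q v = -1) :
    CliffordAlgebra.ι Q v * CliffordAlgebra.ι Q v = -1 := by
  rw [CliffordAlgebra.ι_sq_scalar, hv, map_neg, map_one]

theorem ι_mem_pinGroup (hv : Q v = -1) : CliffordAlgebra.ι Q v ∈ pinGroup Q := by
  have h := ι_mul_ι_eq_neg_one hv
  refine pinGroup.mem_iff.2 ⟨⟨⟨CliffordAlgebra.ι Q v, -CliffordAlgebra.ι Q v,
    by rw [mul_neg, h, neg_neg], by rw [neg_mul, h, neg_neg]⟩, ?_, rfl⟩, ?_⟩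
  · exact Subgroup.subset_closure ⟨v, rfl⟩
  · rw [Unitary.mem_iff, CliffordAlgebra.star_ι, neg_mul, mul_neg, h, neg_neg]
    exact ⟨rfl, rfl⟩

theorem neg_one_mem_spinGroup (hv : Q v = -1) : -1 ∈ spinGroup Q := by
  refine ⟨?_, (CliffordAlgebra.even Q).neg_mem (one_mem _)⟩
  rw [← ι_mul_ι_eq_neg_one hv]
  exact mul_mem (ι_mem_pinGroup hv) (ι_mem_pinGroup hv)

end Pin

instance : Nontrivial Octonion :=
  (lineEquiv Octonion).toEquiv.nontrivial_congr.2 (nontrivial_linSpace Octonion 1)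

theorem imForm_eq_neg_one {u : imPart Octonion} (norm_u : ‖(u : Octonion)‖ = 1) :
    imForm u = -1 := by
  rw [imForm_apply, norm_u, one_pow]

theorem nondegenerate_imForm : imForm.Nondegenerate := by
  let _ : Invertible (2 : ℝ) := invertibleOfNonzero two_ne_zero
  refine QuadraticMap.nondegenerate_iff_radical_eq_bot.2 (eq_bot_iff.2 fun u hu => ?_)
  have apply_eq_zero : imForm u = 0 := (QuadraticMap.mem_radical_iff'.1 hu).1
  rw [imForm_apply, neg_eq_zero, sq_eq_zero_iff, norm_eq_zero] at apply_eq_zero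
  exact Subtype.ext apply_eq_zero

theorem neg_one_mem_spinGroup_imForm : -1 ∈ spinGroup imForm :=
  neg_one_mem_spinGroup (v := ⟨_, Octonion.inr_mem_imPart 1⟩)
    (imForm_eq_neg_one ((Octonion.inr.norm_map 1).trans norm_one))

theorem spinRep_ι (u : imPart Octonion) (y : Octonion) :
    spinRep (CliffordAlgebra.ι imForm u) y = y * (u : Octonion) := by
  rw [spinRep, CliffordAlgebra.lift_ι_apply, rightMulHom_apply]

theorem inner_spinRep (s : CliffordAlgebra imForm) (y z : Octonion) :
    inner ℝ (spinRep s y) z = inner ℝ y (spinRep (star s) z) := by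
  induction s using CliffordAlgebra.induction generalizing y z with
  | algebraMap r =>
    rw [CliffordAlgebra.star_algebraMap, AlgHom.commutes, Module.algebraMap_end_apply,
      Module.algebraMap_end_apply, real_inner_smul_left, real_inner_smul_right]
  | ι u =>
    rw [CliffordAlgebra.star_ι, map_neg, LinearMap.neg_apply, spinRep_ι, spinRep_ι, inner_neg_right,
      ← (lineEquiv Octonion).inner_map_map, ← (lineEquiv Octonion).inner_map_map y]
    exact inner_rightMul_left_of_mem_imPart u.2 (lineEquiv Octonion y) (lineEquiv Octonion z)
  | mul a b ha hb =>
    rw [star_mul, map_mul, map_mul, Module.End.mul_apply, Module.End.mul_apply, ha, hb]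
  | add a b ha hb =>
    rw [star_add, map_add, map_add, LinearMap.add_apply, LinearMap.add_apply, inner_add_left,
      inner_add_right, ha, hb]

theorem exists_spinRep_ι_eq {v : imPart Octonion} (hv : v ≠ 0) :
    ∃ g : twistedGroup Octonion 1,
      ∀ y, spinRep (CliffordAlgebra.ι imForm v) y = ‖v‖ • lineAct g y := by
  obtain ⟨g, hg, -⟩ := exists_lineAct_eq_mul Octonion.even_finrank (‖v‖⁻¹ • v).2
    (show ‖‖v‖⁻¹ • v‖ = 1 from norm_smul_inv_norm (𝕜 := ℝ) hv)
  refine ⟨g, fun y => ?_⟩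
  rw [spinRep_ι, hg, Submodule.coe_smul, IsCompositionAlgebra.mul_smul, smul_smul,
    mul_inv_cancel₀ (norm_ne_zero_iff.2 hv), one_smul]

theorem exists_spinRep_eq_smul_of_mem_lipschitzGroup {x : (CliffordAlgebra imForm)ˣ}
    (hx : x ∈ lipschitzGroup imForm) :
    ∃ c : ℝ, 0 < c ∧ ∃ g : twistedGroup Octonion 1, ∀ y, spinRep x y = c • lineAct g y := by
  induction hx using Subgroup.closure_induction with
  | mem x hx =>
    obtain ⟨v, hv : CliffordAlgebra.ι imForm v = x⟩ := hx
    have v_ne_zero : v ≠ 0 := by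
      rintro rfl
      have : Nontrivial (CliffordAlgebra imForm) := spinRep.toRingHom.domain_nontrivial
      exact x.ne_zero (hv.symm.trans (map_zero _))
    exact ⟨‖v‖, norm_pos_iff.2 v_ne_zero, hv ▸ exists_spinRep_ι_eq v_ne_zero⟩
  | one => exact ⟨1, one_pos, 1, fun y => by simp⟩
  | mul x y _ _ hx hy =>
    obtain ⟨c, hc, g, hg⟩ := hx
    obtain ⟨d, hd, h, hh⟩ := hy
    refine ⟨c * d, mul_pos hc hd, g * h, fun z => ?_⟩
    rw [Units.val_mul, map_mul, Module.End.mul_apply, hh, map_smul, hg, map_mul, mul_comm,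
      mul_smul, LinearIsometryEquiv.coe_mul, Function.comp_apply]
  | inv x _ hx =>
    obtain ⟨c, hc, g, hg⟩ := hx
    refine ⟨c⁻¹, inv_pos.2 hc, g⁻¹, fun y => ?_⟩
    have h : spinRep x (c⁻¹ • lineAct g⁻¹ y) = y := by
      rw [hg, map_smul, smul_smul, mul_inv_cancel₀ hc.ne', one_smul, map_inv]
      exact (lineAct g).apply_symm_apply y
    conv_lhs => rw [← h]
    rw [← Module.End.mul_apply, ← map_mul, Units.inv_mul, map_one, Module.End.one_apply]

theorem exists_lineAct_eq_spinRep (s : SpinSeven) :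
    ∃ g : twistedGroup Octonion 1, ∀ y, lineAct g y = spinRep (s : CliffordAlgebra imForm) y := by
  obtain ⟨⟨⟨x, hx, hxs : (x : CliffordAlgebra imForm) = s⟩, hu⟩, -⟩ := s.2
  obtain ⟨c, hc, g, hg⟩ := exists_spinRep_eq_smul_of_mem_lipschitzGroup hx
  rw [hxs] at hg
  have inner_one := inner_spinRep s 1 (spinRep s 1)
  rw [← Module.End.mul_apply, ← map_mul, (Unitary.mem_iff.1 hu).1, map_one spinRep,
    Module.End.one_apply, real_inner_self_eq_norm_sq, real_inner_self_eq_norm_sq, hg, norm_smul,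
    LinearIsometryEquiv.norm_map, IsCompositionAlgebra.norm_one, mul_one, one_pow,
    Real.norm_of_nonneg hc.le, pow_eq_one_iff_of_nonneg hc.le two_ne_zero] at inner_one
  exact ⟨g, fun y => by rw [hg, inner_one, one_smul]⟩

/-- The spin representation as a homomorphism to `G_𝕆(1)`. -/
noncomputable def spinHom : SpinSeven →* twistedGroup Octonion 1 where
  toFun s := (exists_lineAct_eq_spinRep s).choose
  map_one' := lineAct_injective (LinearIsometryEquiv.ext fun y => by
    rw [(exists_lineAct_eq_spinRep 1).choose_spec, OneMemClass.coe_one, map_one, map_one]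
    rfl)
  map_mul' s t := lineAct_injective (LinearIsometryEquiv.ext fun y => by
    rw [(exists_lineAct_eq_spinRep _).choose_spec, map_mul, LinearIsometryEquiv.coe_mul,
      Function.comp_apply, (exists_lineAct_eq_spinRep _).choose_spec,
      (exists_lineAct_eq_spinRep _).choose_spec, Submonoid.coe_mul, map_mul,
      Module.End.mul_apply])

theorem lineAct_spinHom (s : SpinSeven) (y : Octonion) :
    lineAct (spinHom s) y = spinRep (s : CliffordAlgebra imForm) y :=
  (exists_lineAct_eq_spinRep s).choose_spec y

theorem commute_ι_of_spinRep_eq_one {s : CliffordAlgebra imForm} (hs : s ∈ spinGroup imForm)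
    (h : spinRep s = 1) (v : imPart Octonion) : Commute (CliffordAlgebra.ι imForm v) s := by
  let _ : Invertible (2 : ℝ) := invertibleOfNonzero two_ne_zero
  obtain ⟨w, hw⟩ := spinGroup.conjAct_smul_ι_mem_range_ι (x := spinGroup.toUnits ⟨s, hs⟩) hs v
  have ι_mul : CliffordAlgebra.ι imForm w * s = s * CliffordAlgebra.ι imForm v := by
    rw [hw, ConjAct.units_smul_def, ConjAct.ofConjAct_toConjAct]
    exact Units.inv_mul_cancel_right _ (spinGroup.toUnits ⟨s, hs⟩)
  have w_eq_v : w = v := by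
    have apply_one := congrArg (fun a => spinRep a (1 : Octonion)) ι_mul
    simp only [map_mul, h, one_mul, mul_one, spinRep_ι, Octonion.one_mul] at apply_one
    exact Subtype.ext apply_one
  rwa [w_eq_v] at ι_mul

theorem spinHom_injective : Function.Injective spinHom := by
  refine (injective_iff_map_eq_one spinHom).2 fun s hs => Subtype.ext ?_
  have spinRep_eq_one : spinRep (s : CliffordAlgebra imForm) = 1 := LinearMap.ext fun y => by
    rw [← lineAct_spinHom, hs, map_one]
    rfl
  obtain ⟨r, hr⟩ := exists_algebraMap_eq_of_involute_eq nondegenerate_imForm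
    (spinGroup.involute_eq s.2) (commute_ι_of_spinRep_eq_one s.2 spinRep_eq_one)
  rw [← hr, AlgHom.commutes, ← map_one (algebraMap ℝ (Module.End ℝ Octonion))] at spinRep_eq_one
  rw [← hr, (algebraMap ℝ (Module.End ℝ Octonion)).injective spinRep_eq_one, map_one,
    OneMemClass.coe_one]

/-- The isometries `T` of `Im 𝕆` for which the action on `𝕆` of some pinor of parity `k` belongs to
`G_𝕆(1)` and has the twist `(-1)^k T` on `Im 𝕆`. -/
def pinIsometries : Submonoid (imPart Octonion ≃ₗᵢ[ℝ] imPart Octonion) where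
  carrier := {T | ∃ (k : ℕ) (s : CliffordAlgebra imForm) (g : twistedGroup Octonion 1),
    s ∈ pinGroup imForm ∧ s ∈ CliffordAlgebra.evenOdd imForm k ∧
    (∀ y, spinRep s y = lineAct g y) ∧
    ∀ x : imPart Octonion, twist g x = (-1 : ℝ) ^ k • (T x : Octonion)}
  one_mem' := by
    refine ⟨0, 1, 1, one_mem _, ?_, fun y => by simp, fun x => by simp⟩
    rw [Nat.cast_zero, ← CliffordAlgebra.even_toSubmodule]
    exact one_mem (CliffordAlgebra.even imForm)
  mul_mem' := by
    rintro T T' ⟨k, s, g, hs, hk, hg, twist_g⟩ ⟨k', s', g', hs', hk', hg', twist_g'⟩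
    refine ⟨k + k', s * s', g * g', mul_mem hs hs', ?_, fun y => ?_, fun x => ?_⟩
    · rw [Nat.cast_add]
      exact CliffordAlgebra.evenOdd_mul_le _ _ _ (Submodule.mul_mem_mul hk hk')
    · rw [map_mul, map_mul, Module.End.mul_apply, LinearIsometryEquiv.coe_mul,
        Function.comp_apply, hg', hg]
    · rw [map_mul, LinearIsometryEquiv.coe_mul, LinearIsometryEquiv.coe_mul, Function.comp_apply,
        Function.comp_apply, twist_g', map_smul, twist_g, pow_add, mul_comm, mul_smul]

theorem reflection_mem_pinIsometries (v : imPart Octonion) :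
    (ℝ ∙ v)ᗮ.reflection ∈ pinIsometries := by
  rcases eq_or_ne v 0 with rfl | hv
  · have reflection_eq_one : (ℝ ∙ (0 : imPart Octonion))ᗮ.reflection = 1 :=
      LinearIsometryEquiv.ext fun x => by
        rw [Submodule.reflection_orthogonal_apply, Submodule.reflection_singleton_apply,
          smul_zero, smul_zero, zero_sub, neg_neg, LinearIsometryEquiv.coe_one, id]
    exact reflection_eq_one ▸ one_mem _
  obtain ⟨u, norm_u, span_u⟩ : ∃ u : imPart Octonion, ‖u‖ = 1 ∧ (ℝ ∙ u) = ℝ ∙ v :=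
    ⟨‖v‖⁻¹ • v, norm_smul_inv_norm (𝕜 := ℝ) hv, Submodule.span_singleton_smul_eq
      (isUnit_iff_ne_zero.2 (inv_ne_zero (norm_ne_zero_iff.2 hv))) v⟩
  obtain ⟨g, hg, twist_g⟩ := exists_lineAct_eq_mul Octonion.even_finrank u.2 norm_u
  refine ⟨1, CliffordAlgebra.ι imForm u, g, ι_mem_pinGroup (imForm_eq_neg_one norm_u), ?_,
    fun y => (spinRep_ι u y).trans (hg y).symm, fun x => ?_⟩
  · rw [Nat.cast_one]
    exact CliffordAlgebra.ι_mem_evenOdd_one _ u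
  · have reflection_eq : (ℝ ∙ v)ᗮ.reflection x = (ℝ ∙ u)ᗮ.reflection x := by
      simp only [span_u]
    rw [twist_g x x.2, reflection_eq, Submodule.reflection_orthogonal_apply,
      Submodule.reflection_singleton_apply, norm_u, pow_one, neg_one_smul]
    simp only [Submodule.coe_neg, Submodule.coe_sub, Submodule.coe_add, Submodule.coe_smul,
      Submodule.coe_inner, RCLike.ofReal_real_eq_id, id, one_pow, div_one, two_mul, two_smul,
      add_smul, neg_neg]

theorem mem_pinIsometries (T : imPart Octonion ≃ₗᵢ[ℝ] imPart Octonion) : T ∈ pinIsometries := by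
  obtain ⟨l, -, rfl⟩ := LinearIsometryEquiv.reflections_generate_dim T
  refine Submonoid.list_prod_mem _ fun r hr => ?_
  obtain ⟨v, -, rfl⟩ := List.mem_map.1 hr
  exact reflection_mem_pinIsometries v

theorem exists_twist_spinHom_eq (g : twistedGroup Octonion 1) :
    ∃ s : SpinSeven, ∀ x ∈ imPart Octonion, twist (spinHom s) x = twist g x := by
  obtain ⟨k, s, g', hs, hk, hg', twist_g'⟩ := mem_pinIsometries (twistIm g)
  rcases Nat.even_or_odd k with even_k | odd_k
  · rw [even_k.natCast_zmod_two, ← CliffordAlgebra.even_toSubmodule] at hk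
    have spinHom_eq : spinHom ⟨s, hs, hk⟩ = g' :=
      lineAct_injective (LinearIsometryEquiv.ext fun y => (lineAct_spinHom _ y).trans (hg' y))
    refine ⟨⟨s, hs, hk⟩, fun x hx => ?_⟩
    rw [spinHom_eq, twist_g' ⟨x, hx⟩, even_k.neg_one_pow, one_smul, twistIm_apply]
  · refine (not_forall_twist_eq_neg Octonion.even_finrank (g⁻¹ * g') fun x hx => ?_).elim
    rw [map_mul, LinearIsometryEquiv.coe_mul, Function.comp_apply, twist_g' ⟨x, hx⟩,
      odd_k.neg_one_pow, neg_one_smul, map_neg, twistIm_apply, neg_inj, twist_inv_apply_eq_iff]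

namespace Octonion

theorem snd_eq_zero_of_mul_assoc {a : Octonion} (h : ∀ v x, a * (v * x) = a * v * x) :
    a.snd = 0 := by
  have fst_eq (v d : ℍ[ℝ]) : star v * d * star a.snd = d * (star a.snd * star v) := by
    simpa [mul_fst, mul_snd] using
      congrArg WithLp.fst (h (inl v) (inr d))
  have commutator_mul : (star quatI * quatJ - quatJ * star quatI) * star a.snd = 0 := by
    have h₁ := fst_eq quatI 1
    rw [one_mul, mul_one] at h₁
    rw [sub_mul, fst_eq, ← h₁, mul_assoc, sub_self]
  refine star_eq_zero.1 ((mul_eq_zero.1 commutator_mul).resolve_left fun h₀ => ?_)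
  have imK_eq := congrArg (fun x : ℍ[ℝ] => x.imK) h₀
  norm_num at imK_eq

theorem commute_fst_of_mul_assoc {a : Octonion} (h : ∀ v x, a * (v * x) = a * v * x) (q : ℍ[ℝ]) :
    Commute a.fst q := by
  have snd_eq : star a.fst * star q = star q * star a.fst := by
    simpa [mul_fst, mul_snd] using
      congrArg WithLp.snd (h (inl q) (inr 1))
  change a.fst * q = q * a.fst
  simpa using congrArg star snd_eq.symm

theorem eq_one_or_neg_one_of_mul_assoc {a : Octonion} (norm_a : ‖a‖ = 1)
    (h : ∀ v x, a * (v * x) = a * v * x) : a = 1 ∨ a = -1 := by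
  have snd_eq := snd_eq_zero_of_mul_assoc h
  have norm_fst : ‖a.fst‖ = 1 := by
    rw [← sq_eq_sq₀ (norm_nonneg _) zero_le_one, ← norm_a, norm_sq, snd_eq, map_zero, add_zero,
      Quaternion.normSq_eq_norm_mul_self, sq]
  refine (eq_one_or_neg_one_of_commute
    (β := ⟨a.fst, mem_unitary_iff_norm_eq_one.2 norm_fst⟩) (commute_fst_of_mul_assoc h)).imp
    (fun fst_eq => Octonion.ext fst_eq snd_eq) fun fst_eq => Octonion.ext fst_eq ?_
  rw [snd_eq, WithLp.neg_snd, one_snd, neg_zero]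

end Octonion

theorem lineAct_eq_or_eq_neg_of_twist_eq {g : twistedGroup Octonion 1}
    (h : ∀ x ∈ imPart Octonion, twist g x = x) :
    (∀ y, lineAct g y = y) ∨ ∀ y, lineAct g y = -y := by
  have twist_eq (x : Octonion) : twist g x = x := by
    have twist_im := h _ (sub_inner_one_smul_one_mem_imPart x)
    rwa [map_sub, map_smul, twist_apply_one, sub_left_inj] at twist_im
  have lineAct_mul (v x : Octonion) : lineAct g (v * x) = lineAct g v * x := by
    rw [lineAct_mul_apply, twist_eq]
  have lineAct_eq (y : Octonion) : lineAct g y = lineAct g 1 * y := by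
    rw [← lineAct_mul, Octonion.one_mul]
  refine (Octonion.eq_one_or_neg_one_of_mul_assoc (a := lineAct g 1)
    (by rw [LinearIsometryEquiv.norm_map, IsCompositionAlgebra.norm_one])
    fun v x => by rw [← lineAct_eq, ← lineAct_eq, lineAct_mul]).imp (fun h y => ?_) fun h y => ?_
  · rw [lineAct_eq, h, Octonion.one_mul]
  · rw [lineAct_eq, h, ← neg_one_smul ℝ, IsCompositionAlgebra.smul_mul, Octonion.one_mul,
      neg_one_smul]

/-- An element of `G_𝕆(1)` is determined up to sign by its twist, which some spinor realises. -/
theorem spinHom_surjective : Function.Surjective spinHom := fun g => by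
  obtain ⟨s, twist_s⟩ := exists_twist_spinHom_eq g
  suffices h : ∃ t, spinHom t = (spinHom s)⁻¹ * g by
    obtain ⟨t, ht⟩ := h
    exact ⟨s * t, by rw [map_mul, ht, mul_inv_cancel_left]⟩
  have twist_eq (x : Octonion) (hx : x ∈ imPart Octonion) : twist ((spinHom s)⁻¹ * g) x = x := by
    rw [map_mul, LinearIsometryEquiv.coe_mul, Function.comp_apply, ← twist_s x hx,
      twist_inv_apply_eq_iff]
  rcases lineAct_eq_or_eq_neg_of_twist_eq twist_eq with h | h
  · exact ⟨1, lineAct_injective (LinearIsometryEquiv.ext fun y => by rw [h, map_one, map_one]; rfl)⟩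
  · refine ⟨⟨-1, neg_one_mem_spinGroup_imForm⟩, lineAct_injective (LinearIsometryEquiv.ext fun y =>
      ?_)⟩
    rw [h, lineAct_spinHom, map_neg, map_one, LinearMap.neg_apply, Module.End.one_apply]

/-- The isomorphism of `Spin(7)` with `G_𝕆(1)`. -/
noncomputable def spinEquiv : SpinSeven ≃* twistedGroup Octonion 1 :=
  MulEquiv.ofBijective spinHom ⟨spinHom_injective, spinHom_surjective⟩

theorem spinEquiv_apply (s : SpinSeven) (v : LinSpace Octonion 1) (k : Fin 1) :
    (spinEquiv s).1 v k = spinRep (s : CliffordAlgebra imForm) (v k) :=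
  (apply_eq_lineAct _ _ _).trans (lineAct_spinHom s _)

/-! ### The homomorphism `Sp(1)³ → G_𝕆(1)` -/

theorem det_withLpProdCongr {E F : Type*} [NormedAddCommGroup E] [InnerProductSpace ℝ E]
    [FiniteDimensional ℝ E] [NormedAddCommGroup F] [InnerProductSpace ℝ F] [FiniteDimensional ℝ F]
    (f : E ≃ₗᵢ[ℝ] E) (g : F ≃ₗᵢ[ℝ] F) :
    LinearMap.det ((LinearIsometryEquiv.withLpProdCongr 2 f g).toLinearEquiv :
        WithLp 2 (E × F) →ₗ[ℝ] WithLp 2 (E × F)) =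
      LinearMap.det (f.toLinearEquiv : E →ₗ[ℝ] E) * LinearMap.det (g.toLinearEquiv : F →ₗ[ℝ] F) :=
  (LinearMap.det_conj _ (WithLp.linearEquiv 2 ℝ (E × F)).symm).trans (LinearMap.det_prodMap _ _)

/-- The isometry `(a, b) ↦ (p a q*, q b r*)` of `𝕆 = ℍ ⊕ ℍ`. -/
noncomputable def tripleIsometry (t : UnitQuaternions × UnitQuaternions × UnitQuaternions) :
    Octonion ≃ₗᵢ[ℝ] Octonion :=
  LinearIsometryEquiv.withLpProdCongr 2 (quatRotation (t.1, t.2.1)) (quatRotation (t.2.1, t.2.2))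

/-- The isometry `(c, d) ↦ (q c q*, p d r*)` of `𝕆 = ℍ ⊕ ℍ` by which `tripleIsometry (p, q, r)` is
twisted. -/
noncomputable def tripleTwist (t : UnitQuaternions × UnitQuaternions × UnitQuaternions) :
    Octonion ≃ₗᵢ[ℝ] Octonion :=
  LinearIsometryEquiv.withLpProdCongr 2 (quatRotation (t.2.1, t.2.1)) (quatRotation (t.1, t.2.2))

theorem tripleIsometry_mul (t u : UnitQuaternions × UnitQuaternions × UnitQuaternions) :
    tripleIsometry (t * u) = tripleIsometry t * tripleIsometry u :=
  LinearIsometryEquiv.ext fun x => Octonion.ext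
    (congrArg (· x.fst) (map_mul quatRotation (t.1, t.2.1) (u.1, u.2.1)))
    (congrArg (· x.snd) (map_mul quatRotation (t.2.1, t.2.2) (u.2.1, u.2.2)))

theorem det_tripleTwist (t : UnitQuaternions × UnitQuaternions × UnitQuaternions) :
    LinearMap.det ((tripleTwist t).toLinearEquiv : Octonion →ₗ[ℝ] Octonion) = 1 := by
  rw [tripleTwist, det_withLpProdCongr, det_quatRotation, det_quatRotation, one_mul]

theorem tripleIsometry_mul_apply (t : UnitQuaternions × UnitQuaternions × UnitQuaternions)
    (v x : Octonion) : tripleIsometry t (v * x) = tripleIsometry t v * tripleTwist t x := by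
  have cancel (u : UnitQuaternions) (z : ℍ[ℝ]) : star (u : ℍ[ℝ]) * (u * z) = z := by
    rw [← mul_assoc, Unitary.coe_star_mul_self, one_mul]
  apply Octonion.ext
  · change t.1 * (v * x).fst * star (t.2.1 : ℍ[ℝ]) =
      t.1 * v.fst * star (t.2.1 : ℍ[ℝ]) * (t.2.1 * x.fst * star (t.2.1 : ℍ[ℝ])) -
        t.1 * x.snd * star (t.2.2 : ℍ[ℝ]) * star (t.2.1 * v.snd * star (t.2.2 : ℍ[ℝ]))
    simp only [Octonion.mul_fst, star_mul, star_star, mul_sub, sub_mul, mul_assoc, cancel]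
  · change t.2.1 * (v * x).snd * star (t.2.2 : ℍ[ℝ]) =
      star (t.1 * v.fst * star (t.2.1 : ℍ[ℝ])) * (t.1 * x.snd * star (t.2.2 : ℍ[ℝ])) +
        t.2.1 * x.fst * star (t.2.1 : ℍ[ℝ]) * (t.2.1 * v.snd * star (t.2.2 : ℍ[ℝ]))
    simp only [Octonion.mul_snd, star_mul, star_star, mul_add, add_mul, mul_assoc, cancel]

/-- The homomorphism `(p, q, r) ↦ ((a, b) ↦ (p a q*, q b r*))` from `Sp(1)³` to `G_𝕆(1)`. -/
noncomputable def tripleHom :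
    UnitQuaternions × UnitQuaternions × UnitQuaternions →* twistedGroup Octonion 1 where
  toFun t := twistedGroup.ofLine (tripleIsometry t) (tripleTwist t) (det_tripleTwist t)
    (tripleIsometry_mul_apply t)
  map_one' := lineAct_injective (LinearIsometryEquiv.ext fun x => Octonion.ext
    (congrArg (· x.fst) (map_one quatRotation)) (congrArg (· x.snd) (map_one quatRotation)))
  map_mul' t u := lineAct_injective (by
    rw [map_mul, lineAct_ofLine, lineAct_ofLine, lineAct_ofLine, tripleIsometry_mul])

theorem lineAct_tripleHom (t : UnitQuaternions × UnitQuaternions × UnitQuaternions) :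
    lineAct (tripleHom t) = tripleIsometry t := rfl

theorem tripleHom_apply (t : UnitQuaternions × UnitQuaternions × UnitQuaternions)
    (v : LinSpace Octonion 1) (k : Fin 1) : (tripleHom t).1 v k = WithLp.toLp 2
      (t.1 * (v k).fst * star (t.2.1 : ℍ[ℝ]), t.2.1 * (v k).snd * star (t.2.2 : ℍ[ℝ])) :=
  apply_eq_lineAct _ _ _

theorem continuous_tripleHom : Continuous tripleHom := by
  refine continuous_twistedGroup_iff.2 fun v => (PiLp.continuous_toLp 2 _).comp
    (continuous_pi fun _ => (WithLp.prod_continuous_toLp 2 _ _).comp ?_)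
  change Continuous fun t : UnitQuaternions × UnitQuaternions × UnitQuaternions =>
    ((t.1 : ℍ[ℝ]) * (v 0).fst * star (t.2.1 : ℍ[ℝ]),
      (t.2.1 : ℍ[ℝ]) * (v 0).snd * star (t.2.2 : ℍ[ℝ]))
  fun_prop

theorem eq_of_quatRotation_eq_one {p : UnitQuaternions × UnitQuaternions}
    (h : quatRotation p = 1) : p.1 = p.2 := by
  have apply_one : (p.1 : ℍ[ℝ]) * 1 * star (p.2 : ℍ[ℝ]) = 1 := congrArg (· 1) h
  rw [mul_one] at apply_one
  refine Subtype.ext ?_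
  rw [← mul_one (p.1 : ℍ[ℝ]), ← Unitary.coe_star_mul_self p.2, ← mul_assoc, apply_one, one_mul]

theorem quatRotation_eq_one_iff {p : UnitQuaternions × UnitQuaternions} :
    quatRotation p = 1 ↔ p = 1 ∨ ((p.1 : ℍ[ℝ]) = -1 ∧ (p.2 : ℍ[ℝ]) = -1) := by
  constructor
  · intro h
    obtain ⟨β, γ⟩ := p
    obtain rfl : β = γ := eq_of_quatRotation_eq_one h
    refine (eq_one_or_neg_one_of_commute (β := β) fun x => ?_).imp
      (fun hβ => Prod.ext (Subtype.ext hβ) (Subtype.ext hβ)) fun hβ => ⟨hβ, hβ⟩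
    have apply_x : (β : ℍ[ℝ]) * x * star (β : ℍ[ℝ]) = x := congrArg (· x) h
    change (β : ℍ[ℝ]) * x = x * β
    conv_rhs => rw [← apply_x]
    rw [mul_assoc _ _ (β : ℍ[ℝ]), Unitary.coe_star_mul_self, mul_one]
  · rintro (rfl | ⟨h₁, h₂⟩)
    · exact map_one _
    · exact LinearIsometryEquiv.ext fun x => by simp [quatRotation_apply, h₁, h₂]

theorem tripleIsometry_eq_one_iff {t : UnitQuaternions × UnitQuaternions × UnitQuaternions} :
    tripleIsometry t = 1 ↔ quatRotation (t.1, t.2.1) = 1 ∧ quatRotation (t.2.1, t.2.2) = 1 :=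
  ⟨fun h => ⟨LinearIsometryEquiv.ext fun a => congrArg (fun f => (f (Octonion.inl a)).fst) h,
    LinearIsometryEquiv.ext fun b => congrArg (fun f => (f (Octonion.inr b)).snd) h⟩,
    fun h => LinearIsometryEquiv.ext fun x =>
      Octonion.ext (congrArg (· x.fst) h.1) (congrArg (· x.snd) h.2)⟩

theorem mem_ker_tripleHom (t : UnitQuaternions × UnitQuaternions × UnitQuaternions) :
    t ∈ tripleHom.ker ↔ t = 1 ∨
      ((t.1 : ℍ[ℝ]) = -1 ∧ (t.2.1 : ℍ[ℝ]) = -1 ∧ (t.2.2 : ℍ[ℝ]) = -1) := by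
  rw [MonoidHom.mem_ker, ← lineAct_injective.eq_iff, lineAct_tripleHom, map_one,
    tripleIsometry_eq_one_iff]
  constructor
  · rintro ⟨h, h'⟩
    obtain ⟨p, q, r⟩ := t
    obtain rfl : p = q := eq_of_quatRotation_eq_one h
    obtain rfl : p = r := eq_of_quatRotation_eq_one h'
    exact (quatRotation_eq_one_iff.1 h).imp (fun hp => by
      obtain rfl : p = 1 := congrArg Prod.fst hp
      rfl) fun hp => ⟨hp.1, hp⟩
  · rintro (rfl | ⟨hp, hq, hr⟩)
    · exact ⟨map_one _, map_one _⟩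
    · exact ⟨quatRotation_eq_one_iff.2 (.inr ⟨hp, hq⟩), quatRotation_eq_one_iff.2 (.inr ⟨hq, hr⟩)⟩

/-! ### Half Lagrangian subspaces of `𝕆` -/

section OctonionicLagrangian

theorem lineEquiv_mem_quaternionSubspace {x : Octonion} :
    lineEquiv Octonion x ∈ quaternionSubspace ↔ x.snd = 0 :=
  ⟨fun h => h 0, fun h _ => h⟩

theorem quaternionSubspace_eq_map_range_inl :
    quaternionSubspace = (LinearMap.range Octonion.inl.toLinearMap).map
      ((lineEquiv Octonion).toLinearEquiv : Octonion →ₗ[ℝ] LinSpace Octonion 1) := by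
  ext v
  obtain ⟨x, rfl⟩ := (lineEquiv Octonion).surjective v
  rw [lineEquiv_mem_quaternionSubspace]
  constructor
  · exact fun hx => ⟨x, ⟨x.fst, Octonion.ext rfl hx.symm⟩, rfl⟩
  · rintro ⟨_, ⟨a, rfl⟩, ha⟩
    rw [← (lineEquiv Octonion).injective ha]
    exact Octonion.inl_snd a

/-- The subspace `0 ⊕ ℍ` of `𝕆 = 𝕆¹`. -/
noncomputable def sndQuaternionSubspace : Submodule ℝ (LinSpace Octonion 1) :=
  (LinearMap.range Octonion.inr.toLinearMap).map
    ((lineEquiv Octonion).toLinearEquiv : Octonion →ₗ[ℝ] LinSpace Octonion 1)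

theorem range_inr_le_imPart : LinearMap.range Octonion.inr.toLinearMap ≤ imPart Octonion := by
  rintro _ ⟨b, rfl⟩
  exact Octonion.inr_mem_imPart b

theorem finrank_range_inr : Module.finrank ℝ (LinearMap.range Octonion.inr.toLinearMap) = 4 := by
  rw [LinearMap.finrank_range_of_inj Octonion.inr.injective, Quaternion.finrank_eq_four]

theorem finrank_sndQuaternionSubspace : Module.finrank ℝ sndQuaternionSubspace = 4 := by
  rw [sndQuaternionSubspace, LinearEquiv.finrank_map_eq, finrank_range_inr]

theorem finrank_quaternionSubspace : Module.finrank ℝ quaternionSubspace = 4 := by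
  rw [quaternionSubspace_eq_map_range_inl, LinearEquiv.finrank_map_eq,
    LinearMap.finrank_range_of_inj Octonion.inl.injective, Quaternion.finrank_eq_four]

theorem isHalfLagrangian_quaternionSubspace : IsHalfLagrangian quaternionSubspace := by
  refine isHalfLagrangian_iff.2 ⟨?_, LinearMap.range Octonion.inr.toLinearMap,
    range_inr_le_imPart, ?_, ?_⟩
  · rw [finrank_quaternionSubspace, finrank_linSpace, Octonion.finrank_eq_eight]
  · rw [finrank_range_inr, Octonion.finrank_eq_eight]
  · rintro _ ⟨b, rfl⟩ c hc c' hc'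
    rw [quaternionSubspace_eq_map_range_inl] at hc hc'
    obtain ⟨_, ⟨a, rfl⟩, rfl⟩ := hc
    obtain ⟨_, ⟨a', rfl⟩, rfl⟩ := hc'
    rw [real_inner_comm]
    refine ((lineEquiv Octonion).inner_map_map _ (Octonion.inl a * Octonion.inr b)).trans ?_
    refine (Octonion.inner_inl_left _ _).trans ?_
    rw [Octonion.mul_fst, Octonion.inr_fst]
    simp

theorem mul_inr_star_mul_inr_one (x : Octonion) (e : ℍ[ℝ]) :
    x * Octonion.inr (star e) * Octonion.inr 1 =
      -(Octonion.inl (e * x.fst) + Octonion.inr (x.snd * e)) :=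
  Octonion.ext (by simp [Octonion.mul_fst, Octonion.mul_snd])
    (by simp [Octonion.mul_fst, Octonion.mul_snd])

variable {C : Submodule ℝ (LinSpace Octonion 1)}

theorem lineEquiv_inl_add_inr_mem
    (hdim : 2 * Module.finrank ℝ C = Module.finrank ℝ (LinSpace Octonion 1))
    (hC : LinearMap.range Octonion.inr.toLinearMap ≤ perpMultipliers C) (e : ℍ[ℝ]) {x : Octonion}
    (hx : lineEquiv Octonion x ∈ C) :
    lineEquiv Octonion (Octonion.inl (e * x.fst) + Octonion.inr (x.snd * e)) ∈ C := by
  have sq_eq_neg (v : LinSpace Octonion 1) :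
      rightMul (rightMul v (Octonion.inr 1)) (Octonion.inr 1) = -v := by
    rw [rightMul_rightMul_self (Octonion.inr_mem_imPart 1), LinearIsometry.norm_map,
      CStarRing.norm_one, one_pow, neg_one_smul]
  have mem := rightMul_rightMul_mem hdim (hC ⟨star e, rfl⟩) (hC ⟨1, rfl⟩) sq_eq_neg hx
  rw [← neg_mem_iff, ← map_neg, ← mul_inr_star_mul_inr_one]
  exact mem

/-- The operators `(a, b) ↦ (e a, b e)` preserve `C`. They multiply on the left in the first
summand and on the right in the second, so that those of `ij` and of `i` followed by `j` agree on
the second summand only. -/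
theorem lineEquiv_inl_mul_fst_mem
    (hdim : 2 * Module.finrank ℝ C = Module.finrank ℝ (LinSpace Octonion 1))
    (hC : LinearMap.range Octonion.inr.toLinearMap ≤ perpMultipliers C) (e : ℍ[ℝ]) {x : Octonion}
    (hx : lineEquiv Octonion x ∈ C) : lineEquiv Octonion (Octonion.inl (e * x.fst)) ∈ C := by
  have op_mem (e : ℍ[ℝ]) {x : Octonion} := lineEquiv_inl_add_inr_mem hdim hC e (x := x)
  have commutator : quatI * quatJ * (quatI * quatJ - quatJ * quatI) = (-2 : ℝ) • 1 := by
    ext <;> simp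
    norm_num
  have sub_mem := C.sub_mem (op_mem (quatI * quatJ) hx) (op_mem quatJ (op_mem quatI hx))
  rw [← map_sub] at sub_mem
  convert op_mem ((-1 / 2 : ℝ) • e * (quatI * quatJ)) sub_mem using 2
  apply Octonion.ext
  · simp only [WithLp.sub_fst, WithLp.add_fst, WithLp.add_snd, Octonion.inl_fst, Octonion.inr_fst,
      add_zero]
    rw [← mul_assoc quatJ, ← sub_mul, ← mul_assoc, mul_assoc _ (quatI * quatJ), commutator,
      mul_smul_comm, mul_one, smul_smul]
    norm_num
  · simp only [WithLp.sub_snd, WithLp.add_fst, WithLp.add_snd, Octonion.inl_snd, Octonion.inr_snd,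
      zero_add]
    rw [mul_assoc x.snd, sub_self, zero_mul]

theorem eq_quaternionSubspace_or_eq_sndQuaternionSubspace
    (hdim : 2 * Module.finrank ℝ C = Module.finrank ℝ (LinSpace Octonion 1))
    (hC : LinearMap.range Octonion.inr.toLinearMap ≤ perpMultipliers C) :
    C = quaternionSubspace ∨ C = sndQuaternionSubspace := by
  have finrank_C : Module.finrank ℝ C = 4 := by
    rw [finrank_linSpace, Octonion.finrank_eq_eight] at hdim
    omega
  by_cases h : ∃ x, lineEquiv Octonion x ∈ C ∧ x.fst ≠ 0
  · left
    obtain ⟨x, hx, fst_ne_zero⟩ := h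
    refine (Submodule.eq_of_le_of_finrank_le ?_
      (finrank_C.trans finrank_quaternionSubspace.symm).le).symm
    rw [quaternionSubspace_eq_map_range_inl]
    rintro _ ⟨_, ⟨a, rfl⟩, rfl⟩
    have mem := lineEquiv_inl_mul_fst_mem hdim hC (a * x.fst⁻¹) hx
    rwa [inv_mul_cancel_right₀ fst_ne_zero] at mem
  · right
    push Not at h
    refine Submodule.eq_of_le_of_finrank_le (fun v hv => ?_)
      (finrank_sndQuaternionSubspace.trans finrank_C.symm).le
    obtain ⟨x, rfl⟩ := (lineEquiv Octonion).surjective v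
    exact ⟨x, ⟨x.snd, Octonion.ext (h x hv).symm rfl⟩, rfl⟩

theorem exists_isometry_forall_mem {E : Type*} [NormedAddCommGroup E] [InnerProductSpace ℝ E]
    [FiniteDimensional ℝ E] {S S' : Submodule ℝ E}
    (h : Module.finrank ℝ S = Module.finrank ℝ S') : ∃ T : E ≃ₗᵢ[ℝ] E, ∀ x ∈ S, T x ∈ S' := by
  let e := (stdOrthonormalBasis ℝ S).equiv (stdOrthonormalBasis ℝ S') (finCongr h)
  let f := S'.subtypeₗᵢ.comp e.toLinearIsometry
  refine ⟨f.extend.toLinearIsometryEquiv rfl, fun x hx => ?_⟩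
  exact (f.extend_apply ⟨x, hx⟩).symm ▸ (e ⟨x, hx⟩).2

theorem exists_forall_twist_mem {L L' : Submodule ℝ Octonion} (hL : L ≤ imPart Octonion)
    (hL' : L' ≤ imPart Octonion) (hdim : Module.finrank ℝ L = Module.finrank ℝ L') :
    ∃ g : twistedGroup Octonion 1, ∀ u ∈ L, twist g u ∈ L' := by
  obtain ⟨T, hT⟩ := exists_isometry_forall_mem (S := L.comap (imPart Octonion).subtype)
    (S' := L'.comap (imPart Octonion).subtype) (by
      rw [(Submodule.comapSubtypeEquivOfLe hL).finrank_eq,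
        (Submodule.comapSubtypeEquivOfLe hL').finrank_eq, hdim])
  obtain ⟨k, -, g, -, -, -, twist_g⟩ := mem_pinIsometries T
  refine ⟨g, fun u hu => ?_⟩
  rw [show twist g u = _ from twist_g ⟨u, hL hu⟩]
  exact L'.smul_mem _ (hT ⟨u, hL hu⟩ hu)

theorem exists_imageUnder_quaternionSubspace_eq_sndQuaternionSubspace :
    ∃ g, imageUnder g quaternionSubspace = sndQuaternionSubspace := by
  obtain ⟨g, hg, -⟩ := exists_lineAct_eq_mul Octonion.even_finrank (Octonion.inr_mem_imPart 1)
    ((Octonion.inr.norm_map 1).trans CStarRing.norm_one)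
  refine ⟨g, imageUnder_eq_of_forall_mem
    (finrank_sndQuaternionSubspace.trans finrank_quaternionSubspace.symm).le ?_⟩
  rw [quaternionSubspace_eq_map_range_inl]
  rintro _ ⟨_, ⟨a, rfl⟩, rfl⟩
  refine ⟨Octonion.inl a * Octonion.inr 1, ⟨star a, Octonion.ext ?_ ?_⟩, ?_⟩
  · simp [Octonion.mul_fst]
  · simp [Octonion.mul_snd]
  · rw [← hg]
    exact lineEquiv_lineAct g _

theorem exists_imageUnder_quaternionSubspace_eq (hC : IsHalfLagrangian C) :
    ∃ g, imageUnder g quaternionSubspace = C := by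
  obtain ⟨hdim, L, hL, hLdim, hLC⟩ := isHalfLagrangian_iff.1 hC
  obtain ⟨g, hg⟩ := exists_forall_twist_mem range_inr_le_imPart hL (by
    rw [Octonion.finrank_eq_eight] at hLdim
    rw [finrank_range_inr]
    omega)
  have range_inr_le : LinearMap.range Octonion.inr.toLinearMap ≤
      perpMultipliers (imageUnder g⁻¹ C) := fun u hu => by
    rw [← (twist_inv_apply_eq_iff g).2 (rfl : twist g u = _)]
    exact twist_mem_perpMultipliers g⁻¹ (hLC (hg u hu))
  rcases eq_quaternionSubspace_or_eq_sndQuaternionSubspace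
    (by rw [finrank_imageUnder, hdim]) range_inr_le with h | h
  · exact ⟨g, imageUnder_inv_eq_iff.1 h⟩
  · obtain ⟨g', hg'⟩ := exists_imageUnder_quaternionSubspace_eq_sndQuaternionSubspace
    exact ⟨g * g', by rw [imageUnder_mul, hg', imageUnder_inv_eq_iff.1 h]⟩

end OctonionicLagrangian

/-! ### The stabilizer of `ℍ ⊕ 0` -/

section Stabilizer

variable {g : twistedGroup Octonion 1}

theorem exists_lineAct_inl (h : imageUnder g quaternionSubspace = quaternionSubspace) (a : ℍ[ℝ]) :
    ∃ c, lineAct g (Octonion.inl a) = Octonion.inl c := by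
  refine ⟨(lineAct g (Octonion.inl a)).fst, Octonion.ext rfl ?_⟩
  rw [Octonion.inl_snd, ← lineEquiv_mem_quaternionSubspace, lineEquiv_lineAct, ← h]
  exact Submodule.mem_map_of_mem (lineEquiv_mem_quaternionSubspace.2 (Octonion.inl_snd a))

theorem exists_lineAct_inr (h : imageUnder g quaternionSubspace = quaternionSubspace) (b : ℍ[ℝ]) :
    ∃ d, lineAct g (Octonion.inr b) = Octonion.inr d := by
  refine ⟨(lineAct g (Octonion.inr b)).snd, Octonion.ext ?_ rfl⟩
  set c := (lineAct g (Octonion.inr b)).fst with c_def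
  obtain ⟨a, ha⟩ := exists_lineAct_inl (imageUnder_inv_eq_iff.2 h) c
  rw [map_inv, LinearIsometryEquiv.inv_def, LinearIsometryEquiv.symm_apply_eq] at ha
  have inner_eq_zero := Octonion.inner_inl_inr a b
  rwa [← (lineAct g).inner_map_map, ← ha, Octonion.inner_inl_left, ← c_def,
    inner_self_eq_zero] at inner_eq_zero

theorem exists_twist_inl_eq_conj (h : imageUnder g quaternionSubspace = quaternionSubspace) :
    ∃ q : UnitQuaternions, ∀ c,
      twist g (Octonion.inl c) = Octonion.inl (q * c * star (q : ℍ[ℝ])) := by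
  obtain ⟨p, hp⟩ := exists_lineAct_inl h 1
  have p_ne_zero : p ≠ 0 := fun hp0 => by
    rw [hp0, map_zero, map_eq_zero_iff _ (lineAct g).injective] at hp
    exact one_ne_zero (congrArg WithLp.fst hp)
  have lineAct_inl (c : ℍ[ℝ]) :
      lineAct g (Octonion.inl c) = Octonion.inl p * twist g (Octonion.inl c) := by
    rw [← hp, ← lineAct_mul_apply, Octonion.inl_mul_inl, one_mul]
  have snd_twist (c : ℍ[ℝ]) : (twist g (Octonion.inl c)).snd = 0 := by
    obtain ⟨d, hd⟩ := exists_lineAct_inl h c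
    have snd_eq := congrArg WithLp.snd ((lineAct_inl c).symm.trans hd)
    rw [Octonion.mul_snd, Octonion.inl_fst, Octonion.inl_snd, Octonion.inl_snd, mul_zero,
      add_zero] at snd_eq
    exact (mul_eq_zero.1 snd_eq).resolve_left (star_ne_zero.2 p_ne_zero)
  let R : ℍ[ℝ] →ₗ[ℝ] ℍ[ℝ] :=
    { toFun c := (twist g (Octonion.inl c)).fst
      map_add' c d := by rw [map_add, map_add, WithLp.add_fst]
      map_smul' r c := by rw [map_smul, map_smul, WithLp.smul_fst, RingHom.id_apply] }
  have twist_inl (c : ℍ[ℝ]) : twist g (Octonion.inl c) = Octonion.inl (R c) :=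
    Octonion.ext rfl (snd_twist c)
  have map_one : R 1 = 1 := congrArg WithLp.fst (twist_apply_one g)
  have map_mul (c d : ℍ[ℝ]) : R (c * d) = R c * R d := by
    refine mul_left_cancel₀ p_ne_zero (Octonion.inl.injective ?_)
    rw [← Octonion.inl_mul_inl, ← twist_inl, ← lineAct_inl, ← Octonion.inl_mul_inl,
      lineAct_mul_apply, lineAct_inl, twist_inl, twist_inl, Octonion.inl_mul_inl,
      Octonion.inl_mul_inl, mul_assoc]
  obtain ⟨q, hq⟩ := exists_conj_eq_algHom (AlgHom.ofLinearMap R map_one map_mul)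
  exact ⟨q, fun c => (twist_inl c).trans (congrArg Octonion.inl (hq c))⟩

theorem mem_range_tripleHom_of_imageUnder_eq
    (h : imageUnder g quaternionSubspace = quaternionSubspace) : g ∈ tripleHom.range := by
  obtain ⟨p, hp⟩ := exists_lineAct_inl h 1
  obtain ⟨r, hr⟩ := exists_lineAct_inr h 1
  obtain ⟨q, hq⟩ := exists_twist_inl_eq_conj h
  have norm_p : ‖p‖ = 1 := by
    rw [← Octonion.inl.norm_map, ← hp, LinearIsometryEquiv.norm_map, Octonion.inl.norm_map,
      CStarRing.norm_one]
  have norm_r : ‖r‖ = 1 := by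
    rw [← Octonion.inr.norm_map, ← hr, LinearIsometryEquiv.norm_map, Octonion.inr.norm_map,
      CStarRing.norm_one]
  have lineAct_inl (a : ℍ[ℝ]) :
      lineAct g (Octonion.inl a) = Octonion.inl (p * (q * a * star (q : ℍ[ℝ]))) := by
    rw [← one_mul a, ← Octonion.inl_mul_inl, lineAct_mul_apply, hp, hq, one_mul,
      Octonion.inl_mul_inl]
  have lineAct_inr (b : ℍ[ℝ]) :
      lineAct g (Octonion.inr b) = Octonion.inr (q * b * star (q : ℍ[ℝ]) * r) := by
    rw [← mul_one b, ← Octonion.inr_mul_inl, lineAct_mul_apply, hr, hq, mul_one,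
      Octonion.inr_mul_inl]
  refine ⟨(⟨p, mem_unitary_iff_norm_eq_one.2 norm_p⟩ * q, q,
    ⟨r, mem_unitary_iff_norm_eq_one.2 norm_r⟩⁻¹ * q),
    lineAct_injective (LinearIsometryEquiv.ext fun x => ?_)⟩
  conv_rhs => rw [← Octonion.inl_fst_add_inr_snd x, map_add, lineAct_inl, lineAct_inr]
  apply Octonion.ext
  · change p * q * x.fst * star (q : ℍ[ℝ]) = p * (q * x.fst * star (q : ℍ[ℝ])) + 0
    rw [add_zero, mul_assoc, mul_assoc, mul_assoc]
  · change q * x.snd * star (star r * q) = 0 + q * x.snd * star (q : ℍ[ℝ]) * r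
    rw [zero_add, star_mul, star_star, mul_assoc _ _ r]

theorem imageUnder_quaternionSubspace_eq_iff :
    imageUnder g quaternionSubspace = quaternionSubspace ↔ g ∈ tripleHom.range := by
  refine ⟨mem_range_tripleHom_of_imageUnder_eq, ?_⟩
  rintro ⟨t, rfl⟩
  refine imageUnder_eq_of_forall_mem le_rfl fun v hv k => ?_
  rw [tripleHom_apply, show (v k).snd = 0 from hv k]
  simp

end Stabilizer

theorem isHomogeneousSpace_quaternionSubspace :
    IsHomogeneousSpace tripleHom.range quaternionSubspace :=
  isHomogeneousSpace_of_stabilizer_eq isHalfLagrangian_quaternionSubspace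
    (fun _ => exists_imageUnder_quaternionSubspace_eq)
    fun _ => imageUnder_quaternionSubspace_eq_iff

theorem mainTheorem9 :
    -- the complex case
    (∀ n : ℕ, 1 ≤ n →
      ∃ e : Matrix.unitaryGroup (Fin n) ℂ ≃ₜ* twistedGroup ℂ n,
        (∀ (M : Matrix.unitaryGroup (Fin n) ℂ) (v : LinSpace ℂ n) (k : Fin n),
          (e M).1 v k = ∑ l, M.1 k l * v l) ∧
        IsHomogeneousSpace ((orthogonalInUnitary n).map e.toMonoidHom) (realSubspace n) ∧
        (specialOrthogonalInUnitary n).relIndex (orthogonalInUnitary n) = 2 ∧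
        ∀ o : Orientation ℝ (realSubspace n) (Fin n),
          ∃ h : (twistedGroup ℂ n ⧸ (specialOrthogonalInUnitary n).map e.toMonoidHom) ≃ₜ
              OrientedLagrangian n,
            ∀ g : twistedGroup ℂ n, ∃ f : realSubspace n ≃ₗ[ℝ] (h g).C,
              (∀ x, (f x : LinSpace ℂ n) = g.1 x) ∧ (h g).o = Orientation.map (Fin n) f o) ∧
    -- the quaternionic case
    (∀ n : ℕ, 1 ≤ n →
      ∃ Φ : SpGroup n × UnitQuaternions →* twistedGroup ℍ[ℝ] n,
        Continuous Φ ∧ Function.Surjective Φ ∧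
        (∀ p, p ∈ Φ.ker ↔ p = 1 ∨ ((p.1 : Matrix (Fin n) (Fin n) ℍ[ℝ]) = -1 ∧ (p.2 : ℍ[ℝ]) = -1)) ∧
        (∀ (p : SpGroup n × UnitQuaternions) (v : LinSpace ℍ[ℝ] n) (k : Fin n),
          (Φ p).1 v k = (∑ l, p.1.1 k l * v l) * star (p.2 : ℍ[ℝ])) ∧
        IsHomogeneousSpace ((extendedUnitaryPairs n).map Φ) (complexSubspace n) ∧
        ((unitaryPairs n).map Φ).relIndex ((extendedUnitaryPairs n).map Φ) = 2 ∧
        ∃ h : (twistedGroup ℍ[ℝ] n ⧸ (unitaryPairs n).map Φ) ≃ₜ PolarizedLagrangian n,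
          ∀ g : twistedGroup ℍ[ℝ] n, (h g).1.1 = imageUnder g (complexSubspace n) ∧
            ∀ v : LinSpace ℍ[ℝ] n,
              g.1 (rightMul v ((Complex.I : ℂ) : ℍ[ℝ])) = rightMul (g.1 v) (h g).1.2) ∧
    -- the octonionic case
    (∃ S : SpinSeven ≃* twistedGroup Octonion 1,
      (∀ (s : SpinSeven) (v : LinSpace Octonion 1) (k : Fin 1),
        (S s).1 v k = spinRep (s : CliffordAlgebra imForm) (v k)) ∧
      ∃ Ψ : UnitQuaternions × UnitQuaternions × UnitQuaternions →* twistedGroup Octonion 1,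
        Continuous Ψ ∧
        (∀ t, t ∈ Ψ.ker ↔ t = 1 ∨
          ((t.1 : ℍ[ℝ]) = -1 ∧ (t.2.1 : ℍ[ℝ]) = -1 ∧ (t.2.2 : ℍ[ℝ]) = -1)) ∧
        (∀ (t : UnitQuaternions × UnitQuaternions × UnitQuaternions)
          (v : LinSpace Octonion 1) (k : Fin 1),
          (Ψ t).1 v k = WithLp.toLp 2
            ((t.1 : ℍ[ℝ]) * (v k).fst * star (t.2.1 : ℍ[ℝ]),
              (t.2.1 : ℍ[ℝ]) * (v k).snd * star (t.2.2 : ℍ[ℝ]))) ∧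
        IsHomogeneousSpace Ψ.range quaternionSubspace) :=
  ⟨fun n hn =>
      have : NeZero n := ⟨by omega⟩
      ⟨unitaryEquiv n, fun M v k => by rw [unitaryEquiv_val]; rfl, isHomogeneousSpace_realSubspace,
        relIndex_specialOrthogonalInUnitary n, exists_orientedLagrangian_homeomorph⟩,
    fun n hn =>
      have : NeZero n := ⟨by omega⟩
      ⟨spHom, continuous_spHom, spHom_surjective, mem_ker_spHom,
        fun p v k => by rw [spHom_apply]; rfl, isHomogeneousSpace_complexSubspace,
        relIndex_unitaryPairs n, exists_polarizedLagrangian_homeomorph n⟩,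
    spinEquiv, spinEquiv_apply, tripleHom, continuous_tripleHom, mem_ker_tripleHom,
      tripleHom_apply, isHomogeneousSpace_quaternionSubspace⟩
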